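/- Let $n\ge 1$ and let $A,B$ be complex $n\times n$ matrices with $-B^\dagger A+A^\dagger B=0$ and $A^\dagger A+B^\dagger B>0$. In $L^2=L^2((0,\infty);\mathbf C^n)$ let $H=H_{0,A,B}$ be the operator $H\psi=-\psi''$ whose domain consists of all $\psi$ in the second Sobolev space of $\mathbf C^n$-valued functions on $(0,\infty)$ with $-B^\dagger\psi(0)+A^\dagger\psi'(0)=0$. For real $k\neq0$ put $$\varphi(k,x)=\cos(kx)\,A+\frac{\sin(kx)}{k}\,B,\qquad J(k)=B-ikA,\qquad \psi(k,x)=-ik\,\varphi(k,x)\,J(k)^{-1},\qquad \psi^\pm(k,x)=\psi(\mp k,x).$$ Then the following hold. 1. $H$ has no zero or positive eigenvalues. It has finitely many negative eigenvalues, each of multiplicity at most $n$. The spectrum of $H$ is the union of the set of negative eigenvalues and $[0,\infty)$. 2. $H$ has a spectral resolution $E$ (a projection-valued measure on the Borel sets of $\mathbf R$ with $H=\int\lambda\,dE(\lambda)$), and the spectrum on $[0,\infty)$ is absolutely continuous: for every $\psi\in L^2$ the restriction to $[0,\infty)$ of the measure $O\mapsto (E(O)\psi,\psi)$ is absolutely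 continuous with respect to Lebesgue measure. 3. For each choice of the sign, there is a bounded operator $F^\pm=F^\pm_{0,A,B}$ on $L^2$ with $$(F^\pm\psi)(k)=\sqrt{\tfrac2\pi}\int_0^\infty \psi^\pm(k,x)^\dagger\,\psi(x)\,dx\quad\text{for a.e. } k>0,\qquad \psi\in L^2\cap L^1 .$$ It is partially isometric with initial subspace $\mathcal H_{\rm ac}(H)$, the space of all $\psi$ for which the measure $O\mapsto(E(O)\psi,\psi)$ is absolutely continuous, and with final subspace $L^2$. Its adjoint is given by $$((F^\pm)^\dagger\psi)(x)=\sqrt{\tfrac2\pi}\int_0^\infty \psi^\pm(k,x)\,\psi(k)\,dk\quad\text{for a.e. } x>0,\qquad \psi\in L^2\cap L^1 .$$ 4. $F^\pm H (F^\pm)^\dagger=k^2$ as operators: for $\psi\in L^2$, $(F^\pm)^\dagger\psi$ is in the domain of $H$ if and only if $k^2\psi(k)\in L^2$, and then $(F^\pm H (F^\pm)^\dagger\psi)(k)=k^2\psi(k)$ for a.e. $k>0$. -/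

import Mathlib

open MeasureTheory Set
open scoped Matrix InnerProductSpace ContDiff ComplexOrder

noncomputable section

namespace HalfLine

/-- The Hilbert space `L²((0, ∞); ℂⁿ)`. -/
abbrev L2 (n : ℕ) : Type :=
  Lp (EuclideanSpace ℂ (Fin n)) 2 (volume.restrict (Ioi (0 : ℝ)))

/-- The action of an `n × n` matrix on a column vector of `ℂⁿ`. -/
abbrev act {n : ℕ} (M : Matrix (Fin n) (Fin n) ℂ) (v : EuclideanSpace ℂ (Fin n)) :
    EuclideanSpace ℂ (Fin n) :=
  Matrix.toEuclideanCLM (n := Fin n) (𝕜 := ℂ) M v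

/-! ### Sobolev regularity on the half line and boundary values -/

/-- `g` is the distributional derivative of `f` on `(0, ∞)`; both are square integrable. -/
def IsWeakDeriv {n : ℕ} (f g : L2 n) : Prop :=
  ∀ φ : ℝ → ℝ, ContDiff ℝ ∞ φ → HasCompactSupport φ → tsupport φ ⊆ Ioi (0 : ℝ) →
    ∫ x in Ioi (0 : ℝ), deriv φ x • f x = -∫ x in Ioi (0 : ℝ), φ x • g x

/-- `a` is the boundary value `f(0)`: the value at `0` of the representative of `f` that is
continuous on `[0, ∞)`. Every `f` with a square integrable weak derivative has exactly one. -/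
def HasTrace {n : ℕ} (f : L2 n) (a : EuclideanSpace ℂ (Fin n)) : Prop :=
  ∃ u : ℝ → EuclideanSpace ℂ (Fin n), ContinuousOn u (Ici (0 : ℝ)) ∧
    f =ᵐ[volume.restrict (Ioi (0 : ℝ))] u ∧ u 0 = a

lemma integrable_smul_lp {n : ℕ} {φ : ℝ → ℝ} (hφ : Continuous φ) (hc : HasCompactSupport φ)
    (f : L2 n) : Integrable (fun x => φ x • f x) (volume.restrict (Ioi (0 : ℝ))) := by
  have h1 : MemLp φ 2 (volume.restrict (Ioi (0 : ℝ))) := (hφ.memLp_of_hasCompactSupport hc)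
  exact memLp_one_iff_integrable.mp ((Lp.memLp f).smul h1)

lemma IsWeakDeriv.add {n : ℕ} {f g f' g' : L2 n} (h : IsWeakDeriv f g) (h' : IsWeakDeriv f' g') :
    IsWeakDeriv (f + f') (g + g') := by
  intro φ hφ hc hs
  have hd : Continuous (deriv φ) := hφ.continuous_deriv (by simp)
  have e1 : ∫ x in Ioi (0 : ℝ), deriv φ x • (f + f' : L2 n) x
      = ∫ x in Ioi (0 : ℝ), (deriv φ x • f x + deriv φ x • f' x) := by
    apply integral_congr_ae
    filter_upwards [Lp.coeFn_add f f'] with x hx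
    rw [hx, Pi.add_apply, smul_add]
  have e2 : ∫ x in Ioi (0 : ℝ), φ x • (g + g' : L2 n) x
      = ∫ x in Ioi (0 : ℝ), (φ x • g x + φ x • g' x) := by
    apply integral_congr_ae
    filter_upwards [Lp.coeFn_add g g'] with x hx
    rw [hx, Pi.add_apply, smul_add]
  rw [e1, e2, integral_add (integrable_smul_lp hd hc.deriv f) (integrable_smul_lp hd hc.deriv f'),
    integral_add (integrable_smul_lp hφ.continuous hc g)
      (integrable_smul_lp hφ.continuous hc g'), h φ hφ hc hs, h' φ hφ hc hs, neg_add]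

lemma IsWeakDeriv.smul {n : ℕ} {f g : L2 n} (c : ℂ) (h : IsWeakDeriv f g) :
    IsWeakDeriv (c • f) (c • g) := by
  intro φ hφ hc hs
  have e1 : ∫ x in Ioi (0 : ℝ), deriv φ x • (c • f : L2 n) x
      = c • ∫ x in Ioi (0 : ℝ), deriv φ x • f x := by
    rw [← integral_smul]
    apply integral_congr_ae
    filter_upwards [Lp.coeFn_smul c f] with x hx
    rw [hx, Pi.smul_apply, smul_comm]
  have e2 : ∫ x in Ioi (0 : ℝ), φ x • (c • g : L2 n) x
      = c • ∫ x in Ioi (0 : ℝ), φ x • g x := by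
    rw [← integral_smul]
    apply integral_congr_ae
    filter_upwards [Lp.coeFn_smul c g] with x hx
    rw [hx, Pi.smul_apply, smul_comm]
  rw [e1, e2, h φ hφ hc hs, smul_neg]

lemma IsWeakDeriv.unique {n : ℕ} {f g g' : L2 n} (h : IsWeakDeriv f g) (h' : IsWeakDeriv f g') :
    g = g' := by
  have hloc : LocallyIntegrableOn (fun x => g x - g' x) (Ioi (0 : ℝ)) volume := by
    have hm : MemLp (fun x => g x - g' x) 2 (volume.restrict (Ioi (0 : ℝ))) :=
      (Lp.memLp g).sub (Lp.memLp g')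
    exact locallyIntegrableOn_of_locallyIntegrable_restrict
      (hm.locallyIntegrable (by norm_num))
  have key := isOpen_Ioi.ae_eq_zero_of_integral_contDiff_smul_eq_zero hloc (by
    intro φ hφ hc hs
    have hz : ∀ x, x ∉ Ioi (0 : ℝ) → φ x • (g x - g' x) = 0 := by
      intro x hx
      have : φ x = 0 := image_eq_zero_of_notMem_tsupport fun hx' => hx (hs hx')
      rw [this, zero_smul]
    rw [← setIntegral_eq_integral_of_forall_compl_eq_zero hz]
    simp_rw [smul_sub]
    rw [integral_sub (integrable_smul_lp hφ.continuous hc g)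
      (integrable_smul_lp hφ.continuous hc g'), sub_eq_zero]
    exact neg_injective ((h φ hφ hc hs).symm.trans (h' φ hφ hc hs)))
  apply Lp.ext
  rw [Filter.EventuallyEq, ae_restrict_iff' measurableSet_Ioi]
  filter_upwards [key] with x hx hx0
  exact sub_eq_zero.mp (hx hx0)

lemma HasTrace.add {n : ℕ} {f f' : L2 n} {a a' : EuclideanSpace ℂ (Fin n)}
    (h : HasTrace f a) (h' : HasTrace f' a') : HasTrace (f + f') (a + a') := by
  obtain ⟨u, hu, hf, h0⟩ := h
  obtain ⟨u', hu', hf', h0'⟩ := h'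
  refine ⟨u + u', hu.add hu', ?_, by simp [h0, h0']⟩
  exact (Lp.coeFn_add f f').trans (hf.add hf')

lemma HasTrace.smul {n : ℕ} {f : L2 n} {a : EuclideanSpace ℂ (Fin n)} (c : ℂ)
    (h : HasTrace f a) : HasTrace (c • f) (c • a) := by
  obtain ⟨u, hu, hf, h0⟩ := h
  refine ⟨c • u, hu.const_smul c, ?_, by simp [h0]⟩
  exact (Lp.coeFn_smul c f).trans (hf.const_smul c)

/-! ### The Hamiltonian `H_{0,A,B}` -/

/-- `ψ` is in the second Sobolev space, satisfies `-B† ψ(0) + A† ψ'(0) = 0`, and `ψ'' = χ`. -/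
def HamRel {n : ℕ} (A B : Matrix (Fin n) (Fin n) ℂ) (ψ χ : L2 n) : Prop :=
  ∃ ψ' : L2 n, IsWeakDeriv ψ ψ' ∧ IsWeakDeriv ψ' χ ∧
    ∃ a b : EuclideanSpace ℂ (Fin n), HasTrace ψ a ∧ HasTrace ψ' b ∧
      -act Bᴴ a + act Aᴴ b = 0

lemma HamRel.add {n : ℕ} {A B : Matrix (Fin n) (Fin n) ℂ} {ψ χ φ η : L2 n}
    (h : HamRel A B ψ χ) (h' : HamRel A B φ η) : HamRel A B (ψ + φ) (χ + η) := by
  obtain ⟨p, h1, h2, a, b, ha, hb, hab⟩ := h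
  obtain ⟨q, h1', h2', a', b', ha', hb', hab'⟩ := h'
  refine ⟨p + q, h1.add h1', h2.add h2', a + a', b + b', ha.add ha', hb.add hb', ?_⟩
  have := congrArg₂ (· + ·) hab hab'
  simp only [act, map_add, add_zero] at this ⊢
  rw [← this]; abel

lemma HamRel.smul {n : ℕ} {A B : Matrix (Fin n) (Fin n) ℂ} {ψ χ : L2 n} (c : ℂ)
    (h : HamRel A B ψ χ) : HamRel A B (c • ψ) (c • χ) := by
  obtain ⟨p, h1, h2, a, b, ha, hb, hab⟩ := h
  refine ⟨c • p, h1.smul c, h2.smul c, c • a, c • b, ha.smul c, hb.smul c, ?_⟩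
  have := congrArg (c • ·) hab
  simpa only [act, map_smul, smul_add, smul_neg, smul_zero] using this

lemma HamRel.zero {n : ℕ} {A B : Matrix (Fin n) (Fin n) ℂ} : HamRel A B (0 : L2 n) 0 := by
  have hw : IsWeakDeriv (0 : L2 n) 0 := by
    intro φ _ _ _
    have h0 := Lp.coeFn_zero (EuclideanSpace ℂ (Fin n)) 2 (volume.restrict (Ioi (0 : ℝ)))
    have : ∀ η : ℝ → ℝ, ∫ x in Ioi (0 : ℝ), η x • (0 : L2 n) x = 0 := by
      intro η
      rw [integral_eq_zero_of_ae]
      filter_upwards [h0] with x hx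
      rw [hx]; simp
    rw [this, this, neg_zero]
  have ht : HasTrace (0 : L2 n) 0 := ⟨0, continuousOn_const, Lp.coeFn_zero _ _ _, rfl⟩
  exact ⟨0, hw, hw, 0, 0, ht, ht, by simp⟩

lemma HamRel.unique {n : ℕ} {A B : Matrix (Fin n) (Fin n) ℂ} {ψ χ η : L2 n}
    (h : HamRel A B ψ χ) (h' : HamRel A B ψ η) : χ = η := by
  obtain ⟨p, h1, h2, _⟩ := h
  obtain ⟨q, h1', h2', _⟩ := h'
  obtain rfl := h1.unique h1'
  exact h2.unique h2'

/-- The domain of `H_{0,A,B}`: all `ψ` in the second Sobolev space such that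
`-B† ψ(0) + A† ψ'(0) = 0`. -/
def hamDomain {n : ℕ} (A B : Matrix (Fin n) (Fin n) ℂ) : Submodule ℂ (L2 n) where
  carrier := {ψ | ∃ χ, HamRel A B ψ χ}
  add_mem' := by
    rintro ψ φ ⟨χ, h⟩ ⟨η, h'⟩
    exact ⟨_, h.add h'⟩
  zero_mem' := ⟨0, HamRel.zero⟩
  smul_mem' := by
    rintro c ψ ⟨χ, h⟩
    exact ⟨_, h.smul c⟩

/-- The operator `H_{0,A,B} ψ = -ψ''` with domain `hamDomain A B`. -/
def ham {n : ℕ} (A B : Matrix (Fin n) (Fin n) ℂ) : L2 n →ₗ.[ℂ] L2 n where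
  domain := hamDomain A B
  toFun :=
    { toFun := fun ψ => -Classical.choose ψ.2
      map_add' := by
        intro ψ φ
        have h := (Classical.choose_spec ψ.2).add (Classical.choose_spec φ.2)
        rw [(Classical.choose_spec (ψ + φ).2).unique h, neg_add]
      map_smul' := by
        intro c ψ
        have h := (Classical.choose_spec ψ.2).smul c
        rw [(Classical.choose_spec (c • ψ).2).unique h, RingHom.id_apply, smul_neg] }

/-- The value of the operator: `H_{0,A,B} ψ = -ψ''`. -/
lemma ham_apply {n : ℕ} {A B : Matrix (Fin n) (Fin n) ℂ} {ψ χ : L2 n} (h : HamRel A B ψ χ)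
    (hψ : ψ ∈ (ham A B).domain) : ham A B ⟨ψ, hψ⟩ = -χ :=
  congrArg Neg.neg (HamRel.unique (Classical.choose_spec hψ) h)

/-! ### Spectral notions for a linear operator in a Hilbert space -/

section Spectral

/-- The eigenspace of an unbounded operator, all `ψ` in the domain such that `T ψ = z ψ`.
Its dimension is the multiplicity of `z`. -/
def eigenspace {𝓗 : Type*} [AddCommGroup 𝓗] [Module ℂ 𝓗] (T : 𝓗 →ₗ.[ℂ] 𝓗) (z : ℂ) :
    Submodule ℂ 𝓗 where
  carrier := {ψ | ∃ h : ψ ∈ T.domain, T ⟨ψ, h⟩ = z • ψ}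
  add_mem' := by
    rintro ψ φ ⟨h, e⟩ ⟨h', e'⟩
    refine ⟨T.domain.add_mem h h', ?_⟩
    have := T.map_add ⟨ψ, h⟩ ⟨φ, h'⟩
    rw [e, e', ← smul_add] at this
    exact this
  zero_mem' := ⟨T.domain.zero_mem, by
    have := T.map_zero
    rw [smul_zero]
    exact this⟩
  smul_mem' := by
    rintro c ψ ⟨h, e⟩
    refine ⟨T.domain.smul_mem c h, ?_⟩
    have := T.map_smul c ⟨ψ, h⟩
    rw [e, smul_comm] at this
    exact this

variable {𝓗 : Type*} [NormedAddCommGroup 𝓗] [InnerProductSpace ℂ 𝓗]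

/-- The resolvent set: all `z` such that `T - z` is a bijection of the domain of `T` onto the
space, with a bounded inverse `R`. -/
def resolventSet (T : 𝓗 →ₗ.[ℂ] 𝓗) : Set ℂ :=
  {z | ∃ R : 𝓗 →L[ℂ] 𝓗,
    (∀ ψ : 𝓗, ∃ h : R ψ ∈ T.domain, T ⟨R ψ, h⟩ - z • R ψ = ψ) ∧
    (∀ ψ : T.domain, R (T ψ - z • (ψ : 𝓗)) = ψ)}

/-- The spectrum of an unbounded operator. -/
def spec (T : 𝓗 →ₗ.[ℂ] 𝓗) : Set ℂ := (resolventSet T)ᶜ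

variable (𝓗) in
/-- A projection-valued measure on the Borel sets of `ℝ`. Only the values `proj O` at Borel sets
`O` are meaningful. -/
structure ProjValuedMeasure [CompleteSpace 𝓗] where
  /-- the projector of a Borel set -/
  proj : Set ℝ → 𝓗 →L[ℂ] 𝓗
  isStarProjection : ∀ O, MeasurableSet O → IsStarProjection (proj O)
  proj_univ : proj univ = 1
  hasSum_iUnion : ∀ O : ℕ → Set ℝ, (∀ i, MeasurableSet (O i)) →
    Pairwise (Function.onFun Disjoint O) →
      ∀ ψ : 𝓗, HasSum (fun i => proj (O i) ψ) (proj (⋃ i, O i) ψ)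

namespace ProjValuedMeasure

variable [CompleteSpace 𝓗] (E : ProjValuedMeasure 𝓗)

lemma proj_empty (ψ : 𝓗) : E.proj ∅ ψ = 0 := by
  have h := E.hasSum_iUnion (fun _ => ∅) (fun _ => MeasurableSet.empty)
    (fun _ _ _ => disjoint_bot_left) ψ
  exact (summable_const_iff _).mp h.summable

lemma inner_proj {O : Set ℝ} (hO : MeasurableSet O) (ψ : 𝓗) :
    ⟪ψ, E.proj O ψ⟫_ℂ = ((‖E.proj O ψ‖ ^ 2 : ℝ) : ℂ) := by
  have hp := E.isStarProjection O hO
  have h1 : E.proj O (E.proj O ψ) = E.proj O ψ := congrArg (fun T => T ψ) hp.isIdempotentElem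
  have h2 : ContinuousLinearMap.adjoint (E.proj O) = E.proj O := hp.isSelfAdjoint
  calc ⟪ψ, E.proj O ψ⟫_ℂ = ⟪ψ, E.proj O (E.proj O ψ)⟫_ℂ := by rw [h1]
    _ = ⟪E.proj O ψ, E.proj O ψ⟫_ℂ := by
      conv_lhs => rw [← h2]
      rw [ContinuousLinearMap.adjoint_inner_right, h2]
    _ = _ := by rw [inner_self_eq_norm_sq_to_K]; norm_cast

/-- The spectral measure `O ↦ (E(O) ψ, ψ) = ‖E(O) ψ‖²` of a vector `ψ`. -/
def measure (ψ : 𝓗) : Measure ℝ :=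
  Measure.ofMeasurable (fun O _ => ENNReal.ofReal (‖E.proj O ψ‖ ^ 2))
    (by simp [E.proj_empty])
    (by
      intro O hO hd
      have h := (E.hasSum_iUnion O hO hd ψ).mapL (innerSL ℂ ψ)
      simp only [innerSL_apply_apply, E.inner_proj (hO _),
        E.inner_proj (MeasurableSet.iUnion hO)] at h
      have h' := Complex.hasSum_ofReal.mp h
      rw [← h'.tsum_eq, ENNReal.ofReal_tsum_of_nonneg (fun _ => sq_nonneg _) h'.summable])

lemma measure_apply (ψ : 𝓗) {O : Set ℝ} (hO : MeasurableSet O) :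
    E.measure ψ O = ENNReal.ofReal (‖E.proj O ψ‖ ^ 2) :=
  Measure.ofMeasurable_apply O hO

lemma absolutelyContinuous_iff (ψ : 𝓗) : E.measure ψ ≪ volume ↔
    ∀ O, MeasurableSet O → volume O = 0 → E.proj O ψ = 0 := by
  have key : ∀ O, MeasurableSet O → (E.measure ψ O = 0 ↔ E.proj O ψ = 0) := by
    intro O hO
    rw [E.measure_apply ψ hO, ENNReal.ofReal_eq_zero]
    constructor
    · intro h
      exact norm_eq_zero.mp (pow_eq_zero_iff two_ne_zero |>.mp (le_antisymm h (sq_nonneg _)))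
    · intro h; simp [h]
  constructor
  · intro h O hO h0
    exact (key O hO).mp (h h0)
  · intro h
    exact Measure.AbsolutelyContinuous.mk fun O hO h0 => (key O hO).mpr (h O hO h0)

/-- The subspace of absolute continuity: all vectors whose spectral measure is absolutely
continuous with respect to Lebesgue measure. -/
def acSubspace : Submodule ℂ 𝓗 where
  carrier := {ψ | E.measure ψ ≪ volume}
  add_mem' := by
    intro ψ φ h h'
    rw [mem_ofPred_eq, absolutelyContinuous_iff] at *
    intro O hO h0
    rw [map_add, h O hO h0, h' O hO h0, add_zero]
  zero_mem' := by
    rw [mem_ofPred_eq, absolutelyContinuous_iff]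
    intro O _ _
    exact map_zero _
  smul_mem' := by
    intro c ψ h
    rw [mem_ofPred_eq, absolutelyContinuous_iff] at *
    intro O hO h0
    rw [map_smul, h O hO h0, smul_zero]

/-- `E` is the spectral resolution of `T`, that is to say `T = ∫ t dE(t)`: a vector `ψ` is in the
domain if and only if `∫ t² d(E(t)ψ, ψ)` is finite, and then `(Tψ, ψ) = ∫ t d(E(t)ψ, ψ)`.
There is such an `E` exactly if `T` is selfadjoint, and then it is unique on Borel sets. -/
def IsSpectralResolution (T : 𝓗 →ₗ.[ℂ] 𝓗) : Prop :=
  (∀ ψ : 𝓗, ψ ∈ T.domain ↔ ∫⁻ t, ENNReal.ofReal (t ^ 2) ∂(E.measure ψ) < ⊤) ∧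
  ∀ ψ : T.domain, ⟪(ψ : 𝓗), T ψ⟫_ℂ = ((∫ t, t ∂(E.measure (ψ : 𝓗)) : ℝ) : ℂ)

end ProjValuedMeasure

/-- `F` is partially isometric with initial subspace `M` and final subspace `N`. -/
def IsPartialIsometry (F : 𝓗 →L[ℂ] 𝓗) (M N : Submodule ℂ 𝓗) : Prop :=
  (∀ ψ ∈ M, ‖F ψ‖ = ‖ψ‖) ∧ (∀ ψ ∈ Mᗮ, F ψ = 0) ∧
    LinearMap.range (F : 𝓗 →ₗ[ℂ] 𝓗) = N

end Spectral

/-! ### Physical solutions and generalized Fourier maps for zero potential -/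

/-- The regular solution `φ_{0,A,B}(k,x) = cos(kx) A + (sin(kx)/k) B`: the matrix solution of
`-φ'' = k² φ` with `φ(k,0) = A`, `φ'(k,0) = B`. (At `k = 0` the coefficient of `B` is `x`.) -/
def regularSol {n : ℕ} (A B : Matrix (Fin n) (Fin n) ℂ) (k x : ℝ) :
    Matrix (Fin n) (Fin n) ℂ :=
  ((Real.cos (k * x) : ℝ) : ℂ) • A + ((x * Real.sinc (k * x) : ℝ) : ℂ) • B

/-- The Jost matrix `J_{0,A,B}(k) = f(-k,0)† B - f'(-k,0)† A = B - ikA`, where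
`f(k,x) = exp(ikx)` is the Jost solution for zero potential. It is invertible for `k ≠ 0`. -/
def jost {n : ℕ} (A B : Matrix (Fin n) (Fin n) ℂ) (k : ℝ) : Matrix (Fin n) (Fin n) ℂ :=
  B - (Complex.I * (k : ℂ)) • A

/-- The physical solution `ψ_{0,A,B}(k,x) = -ik φ_{0,A,B}(k,x) J_{0,A,B}(k)⁻¹`. -/
def physicalSol {n : ℕ} (A B : Matrix (Fin n) (Fin n) ℂ) (k x : ℝ) :
    Matrix (Fin n) (Fin n) ℂ :=
  (-(Complex.I * (k : ℂ))) • (regularSol A B k x * (jost A B k)⁻¹)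

/-- The physical solutions `ψ^±_{0,A,B}(k,x) = ψ_{0,A,B}(∓k,x)`; the sign is `σ = 1` or
`σ = -1`. -/
def physicalSolSigned {n : ℕ} (A B : Matrix (Fin n) (Fin n) ℂ) (σ k x : ℝ) :
    Matrix (Fin n) (Fin n) ℂ :=
  physicalSol A B (-σ * k) x

/-- `F` is the generalized Fourier map `F^±_{0,A,B}` (for `σ = ±1`): the bounded operator on `L²`
such that `(Fψ)(k) = √(2/π) ∫₀^∞ ψ^±(k,x)† ψ(x) dx` for `ψ ∈ L² ∩ L¹`. There is at most one,
because `L² ∩ L¹` is dense. -/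
def IsFourierMap {n : ℕ} (A B : Matrix (Fin n) (Fin n) ℂ) (σ : ℝ) (F : L2 n →L[ℂ] L2 n) : Prop :=
  ∀ ψ : L2 n, Integrable ψ (volume.restrict (Ioi (0 : ℝ))) →
    F ψ =ᵐ[volume.restrict (Ioi (0 : ℝ))] fun k =>
      √(2 / Real.pi) • ∫ x in Ioi (0 : ℝ), act (physicalSolSigned A B σ k x)ᴴ (ψ x)

/-- The negative eigenvalues of `H_{0,A,B}`. -/
def negEigenvalues {n : ℕ} (A B : Matrix (Fin n) (Fin n) ℂ) : Set ℝ :=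
  {t | t < 0 ∧ eigenspace (ham A B) (t : ℂ) ≠ ⊥}

end HalfLine

end

open scoped ENNReal FourierTransform Topology

namespace HalfLine

-- Let C and S be the cosine and sine transforms of L²((0,∞); ℂⁿ), with kernels √(2/π) cos(kx) and
-- √(2/π) sin(kx). Both are selfadjoint involutions, inherited from the L² Fourier transform of the
-- line. Put J = J(-σk) = B + iσkA, c = iσk A J⁻¹ and s = iσ B J⁻¹; then ψ^±(k,x) = cos(kx) c(k) +
-- sin(kx) s(k). Because A†B = B†A, the mixed terms in J†J cancel, J†J = B†B + k²A†A, and therefore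
-- c†c + s†s = 1 (`coeff_isometry`). So c and s are contractions, and F = c†C + s†S is bounded with
-- adjoint F† = Cc + Ss.
--
-- The analysis is contained in the partial integrations k C f = -S f' and k S f = C f' + √(2/π)
-- f(0), and in their duals (C h)' = -S(k h) and (S h)' = C(k h). They have three consequences. (a)
-- F F† = 1 (`fourierMap_fourierAdj`): the diagonal terms give c†c + s†s, and the cross terms c†CSs
-- + s†SCc cancel since k C S u = -S C(k u) and A†B = B†A. (b) F H = k² F on the domain of H, and H
-- F† = F† k² (`fourierMap_hamRel`, `hamRel_fourierAdj`): in the first the boundary terms combine to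
-- the boundary condition of ψ; in the second the boundary condition of F†f follows from B†c = k
-- A†s. (c) The kernel of F is spanned by bound states (`exists_boundStates`): F ψ = 0 forces (A†ψ)'
-- = B†ψ. In an orthonormal basis v_j with A w_j = α_j v_j and B w_j = β_j v_j this becomes α_j p' =
-- β_j p for each component, whose square integrable solutions are multiples of exp(κx) v_j with κ =
-- β_j/α_j < 0. These at most n functions are eigenvectors with eigenvalue -κ², and they do not
-- depend on σ.
--
-- Thus H is unitarily equivalent to multiplication by k² plus a finite diagonal matrix with
-- negative entries. The structure `Diagonalizes` records just this, and the rest is read off from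
-- it: the graph of H, its eigenspaces, spectrum and resolvent, the spectral projectors F† 1[k² ∈ O]
-- F + Σ 1[λ_i ∈ O] ⟨e_i, ·⟩ e_i, and absolute continuity, which holds since k ↦ k² pulls null sets
-- of [0,∞) back to null sets.

local notation "ν₀" => (volume.restrict (Ioi (0 : ℝ)) : Measure ℝ)

/-! ### Restriction, extension, reflection, dilation and multiplication on vector valued L². -/

section Operators

set_option linter.unusedSectionVars false

variable {V : Type*} [NormedAddCommGroup V] [InnerProductSpace ℂ V]

lemma norm_sq_eq_integral {α : Type*} [MeasurableSpace α] {μ : Measure α} (f : Lp V 2 μ) :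
    ‖f‖ ^ 2 = ∫ x, ‖f x‖ ^ 2 ∂μ := by
  have h : (((‖f‖ ^ 2 : ℝ)) : ℂ) = ((∫ x, ‖f x‖ ^ 2 ∂μ : ℝ) : ℂ) := by
    rw [← integral_complex_ofReal]
    push_cast
    have := (inner_self_eq_norm_sq_to_K (𝕜 := ℂ) f).symm
    simp only [Complex.coe_algebraMap] at this
    rw [this, L2.inner_def]
    refine integral_congr_ae (ae_of_all _ fun x => ?_)
    simp [inner_self_eq_norm_sq_to_K]
  exact_mod_cast h

lemma integrable_norm_sq {α : Type*} [MeasurableSpace α] {μ : Measure α} (f : Lp V 2 μ) :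
    Integrable (fun x => ‖f x‖ ^ 2) μ := (memLp_two_iff_integrable_sq_norm (Lp.memLp f).1).1
      (Lp.memLp f)

/-! ### Restriction, extension by zero, reflection -/

lemma indicator_ae_eq_of_restrict_ae_eq {α : Type*} [MeasurableSpace α] {μ : Measure α}
    {s : Set α} (hs : MeasurableSet s) {f g : α → V} (h : f =ᵐ[μ.restrict s] g) :
    s.indicator f =ᵐ[μ] s.indicator g := by
  rw [Filter.EventuallyEq, ae_restrict_iff' hs] at h
  filter_upwards [h] with x hx
  by_cases hs' : x ∈ s
  · rw [indicator_of_mem hs', indicator_of_mem hs', hx hs']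
  · rw [indicator_of_notMem hs', indicator_of_notMem hs']

lemma memLp_indicator_of_restrict {α : Type*} [MeasurableSpace α] {μ : Measure α} {s : Set α}
    (hs : MeasurableSet s) {f : α → V} {p : ℝ≥0∞} (hf : MemLp f p (μ.restrict s)) :
    MemLp (s.indicator f) p μ := (memLp_indicator_iff_restrict hs).2 hf

/-- Extension of a function on `(0, ∞)` by zero. -/
noncomputable def zeroExt (V : Type*) [NormedAddCommGroup V] [InnerProductSpace ℂ V] :
    Lp V 2 ν₀ →L[ℂ] Lp V 2 (volume : Measure ℝ) :=
  LinearMap.mkContinuous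
    { toFun := fun f => (memLp_indicator_of_restrict measurableSet_Ioi (Lp.memLp f)).toLp _
      map_add' := by
        intro f g
        rw [← MemLp.toLp_add]
        apply MemLp.toLp_congr
        rw [← indicator_add']
        exact indicator_ae_eq_of_restrict_ae_eq measurableSet_Ioi (Lp.coeFn_add f g)
      map_smul' := by
        intro c f
        rw [RingHom.id_apply, ← MemLp.toLp_const_smul]
        apply MemLp.toLp_congr
        have : c • (Ioi (0 : ℝ)).indicator f = (Ioi (0 : ℝ)).indicator (c • f : ℝ → V) :=
          (indicator_const_smul _ c f).symm
        rw [this]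
        exact indicator_ae_eq_of_restrict_ae_eq measurableSet_Ioi (Lp.coeFn_smul c f) } 1 (by
    intro f
    rw [LinearMap.coe_mk, AddHom.coe_mk, one_mul, Lp.norm_toLp,
      eLpNorm_indicator_eq_eLpNorm_restrict measurableSet_Ioi, Lp.norm_def])

lemma coeFn_zeroExt (f : Lp V 2 ν₀) :
    zeroExt V f =ᵐ[volume] (Ioi (0 : ℝ)).indicator f :=
  MemLp.coeFn_toLp (memLp_indicator_of_restrict measurableSet_Ioi (Lp.memLp f))

/-- Restriction to `(0, ∞)`. -/
noncomputable def restr (V : Type*) [NormedAddCommGroup V] [InnerProductSpace ℂ V] :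
    Lp V 2 (volume : Measure ℝ) →L[ℂ] Lp V 2 ν₀ :=
  LpToLpRestrictCLM ℝ V ℂ volume 2 (Ioi 0)

lemma coeFn_restr (f : Lp V 2 (volume : Measure ℝ)) : restr V f =ᵐ[ν₀] f :=
  LpToLpRestrictCLM_coeFn ℂ _ f

/-- Reflection of functions on the line. -/
noncomputable def reflect (V : Type*) [NormedAddCommGroup V] [InnerProductSpace ℂ V] :
    Lp V 2 (volume : Measure ℝ) →ₗᵢ[ℂ] Lp V 2 (volume : Measure ℝ) :=
  Lp.compMeasurePreservingₗᵢ ℂ (fun x : ℝ => -x) (Measure.measurePreserving_neg volume)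

lemma coeFn_reflect (f : Lp V 2 (volume : Measure ℝ)) :
    reflect V f =ᵐ[volume] fun x => f (-x) :=
  Lp.coeFn_compMeasurePreserving f (Measure.measurePreserving_neg volume)

lemma restr_zeroExt (f : Lp V 2 ν₀) : restr V (zeroExt V f) = f := by
  apply Lp.ext
  filter_upwards [coeFn_restr (zeroExt V f), ae_restrict_of_ae (coeFn_zeroExt f),
    ae_restrict_mem measurableSet_Ioi] with x h1 h2 h3
  rw [h1, h2, indicator_of_mem h3]

lemma restr_reflect_zeroExt (f : Lp V 2 ν₀) : restr V (reflect V (zeroExt V f)) = 0 := by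
  apply Lp.ext
  have h := (Measure.measurePreserving_neg (volume : Measure ℝ)).quasiMeasurePreserving.ae
    (coeFn_zeroExt f)
  filter_upwards [coeFn_restr (reflect V (zeroExt V f)), ae_restrict_of_ae (coeFn_reflect (zeroExt V f)),
    ae_restrict_mem measurableSet_Ioi, ae_restrict_of_ae h, Lp.coeFn_zero V 2 ν₀]
    with x h1 h2 h3 h4 h5
  rw [h1, h2, h5, h4, indicator_of_notMem, Pi.zero_apply]
  simp only [mem_Ioi] at h3 ⊢
  linarith

/-- A function on the line is the sum of its two halves, each written through the half line. For
even or odd v the two halves come from the same function on (0, ∞). -/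
lemma zeroExt_restr_add_reflect (v : Lp V 2 (volume : Measure ℝ)) :
    zeroExt V (restr V v) + reflect V (zeroExt V (restr V (reflect V v))) = v := by
  have key : ∀ w : Lp V 2 (volume : Measure ℝ),
      zeroExt V (restr V w) =ᵐ[volume] (Ioi (0 : ℝ)).indicator w := fun w =>
    (coeFn_zeroExt _).trans (indicator_ae_eq_of_restrict_ae_eq measurableSet_Ioi (coeFn_restr w))
  have hn := (Measure.measurePreserving_neg (volume : Measure ℝ)).quasiMeasurePreserving
  apply Lp.ext
  have h0 : ∀ᵐ x : ℝ, x ≠ 0 := by simp [ae_iff, measure_singleton]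
  filter_upwards [Lp.coeFn_add (zeroExt V (restr V v))
      (reflect V (zeroExt V (restr V (reflect V v)))), key v,
    coeFn_reflect (zeroExt V (restr V (reflect V v))), hn.ae (key (reflect V v)),
    hn.ae (coeFn_reflect v), h0] with x h1 h2 h3 h4 h5 h6
  rw [h1, Pi.add_apply, h2, h3, h4]
  rcases lt_or_gt_of_ne h6 with h | h
  · rw [indicator_of_notMem (by simpa using h.le), indicator_of_mem (by simpa using h), h5]
    simp
  · rw [indicator_of_mem (by simpa using h), indicator_of_notMem (by simpa using h.le)]
    simp

lemma inner_zeroExt (f : Lp V 2 ν₀) (g : Lp V 2 (volume : Measure ℝ)) :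
    ⟪zeroExt V f, g⟫_ℂ = ⟪f, restr V g⟫_ℂ := by
  rw [L2.inner_def, L2.inner_def, ← integral_indicator measurableSet_Ioi]
  have h := coeFn_restr g
  rw [Filter.EventuallyEq, ae_restrict_iff' measurableSet_Ioi] at h
  apply integral_congr_ae
  filter_upwards [coeFn_zeroExt f, h] with x h1 h2
  rw [h1]
  by_cases hx : x ∈ Ioi (0 : ℝ)
  · rw [indicator_of_mem hx, indicator_of_mem hx, h2 hx]
  · rw [indicator_of_notMem hx, indicator_of_notMem hx, inner_zero_left]

/-! ### Dilations -/

lemma map_mul_restrict_Ioi {c : ℝ} (hc : 0 < c) :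
    Measure.map (fun x => c * x) ν₀ = ENNReal.ofReal c⁻¹ • ν₀ := by
  have h1 : (fun x : ℝ => c * x) ⁻¹' Ioi 0 = Ioi 0 := by
    ext x; simp [hc]
  have h2 := Real.map_volume_mul_left hc.ne'
  rw [abs_of_pos (inv_pos.2 hc)] at h2
  rw [← Measure.restrict_smul, ← h2, Measure.restrict_map (measurable_const_mul c)
    measurableSet_Ioi, h1]

lemma quasiMeasurePreserving_mul {c : ℝ} (hc : 0 < c) :
    Measure.QuasiMeasurePreserving (fun x => c * x) ν₀ ν₀ :=
  ⟨measurable_const_mul c, by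
    rw [map_mul_restrict_Ioi hc]; exact Measure.smul_absolutelyContinuous⟩

lemma memLp_comp_mul {c : ℝ} (hc : 0 < c) {f : ℝ → V} (hf : MemLp f 2 ν₀) :
    MemLp (fun x => f (c * x)) 2 ν₀ := by
  refine MemLp.comp_of_map (g := f) (f := fun x => c * x) ?_ (by fun_prop)
  rw [map_mul_restrict_Ioi hc]
  exact hf.smul_measure (by simp)

/-- The unitary dilation `f ↦ √c f(c x)` for `c > 0`. -/
noncomputable def dilate (V : Type*) [NormedAddCommGroup V] [InnerProductSpace ℂ V] (c : ℝ)
    (hc : 0 < c) : Lp V 2 ν₀ →L[ℂ] Lp V 2 ν₀ :=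
  LinearMap.mkContinuous
    { toFun := fun f => ((memLp_comp_mul hc (Lp.memLp f)).const_smul ((√c : ℝ) : ℂ)).toLp _
      map_add' := by
        intro f g
        rw [← MemLp.toLp_add]
        apply MemLp.toLp_congr
        filter_upwards [(quasiMeasurePreserving_mul hc).ae (Lp.coeFn_add f g)] with x hx
        simp only [Pi.smul_apply, Pi.add_apply, hx, smul_add]
      map_smul' := by
        intro a f
        rw [RingHom.id_apply, ← MemLp.toLp_const_smul]
        apply MemLp.toLp_congr
        filter_upwards [(quasiMeasurePreserving_mul hc).ae (Lp.coeFn_smul a f)] with x hx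
        simp only [Pi.smul_apply, hx]
        rw [smul_comm] } 1 (by
    intro f
    rw [LinearMap.coe_mk, AddHom.coe_mk, one_mul, ← sq_le_sq₀ (norm_nonneg _) (norm_nonneg _),
      norm_sq_eq_integral, norm_sq_eq_integral]
    apply le_of_eq
    have h1 := integral_comp_mul_left_Ioi (fun x => ‖f x‖ ^ 2) 0 hc
    rw [mul_zero] at h1
    have h2 : ∫ x, ‖f x‖ ^ 2 ∂ν₀ = ∫ x, c * ‖f (c * x)‖ ^ 2 ∂ν₀ := by
      rw [integral_const_mul, h1, smul_eq_mul, mul_inv_cancel_left₀ hc.ne']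
    rw [h2]
    apply integral_congr_ae
    filter_upwards [MemLp.coeFn_toLp ((memLp_comp_mul hc (Lp.memLp f)).const_smul
      ((√c : ℝ) : ℂ))] with x hx
    rw [hx, Pi.smul_apply, norm_smul, mul_pow]
    simp [Real.sq_sqrt hc.le])

lemma coeFn_dilate (c : ℝ) (hc : 0 < c) (f : Lp V 2 ν₀) :
    dilate V c hc f =ᵐ[ν₀] fun x => ((√c : ℝ) : ℂ) • f (c * x) :=
  MemLp.coeFn_toLp ((memLp_comp_mul hc (Lp.memLp f)).const_smul ((√c : ℝ) : ℂ))

lemma dilate_dilate_inv (c d : ℝ) (hc : 0 < c) (hd : 0 < d) (h : c * d = 1) (f : Lp V 2 ν₀) :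
    dilate V c hc (dilate V d hd f) = f := by
  apply Lp.ext
  filter_upwards [coeFn_dilate c hc (dilate V d hd f),
    (quasiMeasurePreserving_mul hc).ae (coeFn_dilate d hd f)] with x h1 h2
  rw [h1, h2, smul_smul, ← mul_assoc, mul_comm d c, h, one_mul, ← Complex.ofReal_mul,
    ← Real.sqrt_mul hc.le, h]
  simp

lemma inner_dilate (c d : ℝ) (hc : 0 < c) (hd : 0 < d) (h : c * d = 1) (f g : Lp V 2 ν₀) :
    ⟪dilate V c hc f, g⟫_ℂ = ⟪f, dilate V d hd g⟫_ℂ := by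
  rw [L2.inner_def, L2.inner_def]
  have h1 := integral_comp_mul_left_Ioi (fun x => ⟪f x, dilate V d hd g x⟫_ℂ) 0 hc
  rw [mul_zero] at h1
  have h2 : ∫ x, ⟪f x, dilate V d hd g x⟫_ℂ ∂ν₀
      = ∫ x, (c : ℂ) * ⟪f (c * x), dilate V d hd g (c * x)⟫_ℂ ∂ν₀ := by
    rw [integral_const_mul, h1, Complex.real_smul, ← mul_assoc, ← Complex.ofReal_mul,
      mul_inv_cancel₀ hc.ne']
    simp
  rw [h2]
  apply integral_congr_ae
  filter_upwards [coeFn_dilate c hc f, (quasiMeasurePreserving_mul hc).ae (coeFn_dilate d hd g)]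
    with x h3 h4
  rw [h3, h4, ← mul_assoc, mul_comm d c, h, one_mul, inner_smul_left, inner_smul_right,
    Complex.conj_ofReal, ← mul_assoc, ← Complex.ofReal_mul]
  congr 2
  nth_rw 2 [← Real.mul_self_sqrt hc.le]
  rw [mul_assoc, ← Real.sqrt_mul hc.le, h]
  simp

/-! ### Multiplication operators -/

/-- Multiplication by a bounded operator valued function. -/
noncomputable def mulOp {α : Type*} [MeasurableSpace α] {μ : Measure α} (M : α → V →L[ℂ] V)
    (hM : MemLp M ∞ μ) : Lp V 2 μ →L[ℂ] Lp V 2 μ :=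
  (ContinuousLinearMap.id ℂ (V →L[ℂ] V)).holderL μ ∞ 2 2 (hM.toLp M)

section MulOp

variable {α : Type*} [MeasurableSpace α] {μ : Measure α}

lemma coeFn_mulOp {M : α → V →L[ℂ] V} (hM : MemLp M ∞ μ) (f : Lp V 2 μ) :
    mulOp M hM f =ᵐ[μ] fun x => M x (f x) := by
  filter_upwards [ContinuousLinearMap.coeFn_holder (r := 2) (ContinuousLinearMap.id ℂ (V →L[ℂ] V))
    (hM.toLp M) f, hM.coeFn_toLp] with x h1 h2
  have : mulOp M hM f x = _ := h1
  rw [this, h2]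
  rfl

lemma inner_mulOp [CompleteSpace V] {M N : α → V →L[ℂ] V} (hM : MemLp M ∞ μ) (hN : MemLp N ∞ μ)
    (h : ∀ᵐ x ∂μ, ∀ v w, ⟪M x v, w⟫_ℂ = ⟪v, N x w⟫_ℂ) (f g : Lp V 2 μ) :
    ⟪mulOp M hM f, g⟫_ℂ = ⟪f, mulOp N hN g⟫_ℂ := by
  rw [L2.inner_def, L2.inner_def]
  apply integral_congr_ae
  filter_upwards [coeFn_mulOp hM f, coeFn_mulOp hN g, h] with x h1 h2 h3
  rw [h1, h2, h3]

/-- Dominated convergence for the squared norm, with majorant C²‖f(x)‖²: uniformly bounded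
multipliers that converge pointwise converge strongly. The truncation arguments below rest on this.
-/
lemma tendsto_mulOp {ι : Type*} {l : Filter ι} [l.IsCountablyGenerated]
    {M : ι → α → V →L[ℂ] V} {N : α → V →L[ℂ] V} (hM : ∀ i, MemLp (M i) ∞ μ) (hN : MemLp N ∞ μ)
    (C : ℝ) (hC : ∀ i, ∀ᵐ x ∂μ, ‖M i x - N x‖ ≤ C)
    (h : ∀ᵐ x ∂μ, Filter.Tendsto (fun i => M i x) l (𝓝 (N x))) (f : Lp V 2 μ) :
    Filter.Tendsto (fun i => mulOp (M i) (hM i) f) l (𝓝 (mulOp N hN f)) := by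
  rw [tendsto_iff_norm_sub_tendsto_zero]
  have h1 : Filter.Tendsto (fun i => ‖mulOp (M i) (hM i) f - mulOp N hN f‖ ^ 2) l (𝓝 0) := by
    have h2 : ∀ i, ‖mulOp (M i) (hM i) f - mulOp N hN f‖ ^ 2
        = ∫ x, ‖(M i x - N x) (f x)‖ ^ 2 ∂μ := by
      intro i
      rw [norm_sq_eq_integral]
      apply integral_congr_ae
      filter_upwards [Lp.coeFn_sub (mulOp (M i) (hM i) f) (mulOp N hN f), coeFn_mulOp (hM i) f,
        coeFn_mulOp hN f] with x h1 h2 h3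
      rw [h1, Pi.sub_apply, h2, h3, sub_apply]
    simp_rw [h2]
    rw [← integral_zero α ℝ (μ := μ)]
    apply tendsto_integral_filter_of_dominated_convergence (fun x => C ^ 2 * ‖f x‖ ^ 2)
    · refine Filter.Eventually.of_forall fun i => ?_
      have := (ContinuousLinearMap.id ℂ (V →L[ℂ] V)).aestronglyMeasurable_comp₂
        ((hM i).1.sub hN.1) (Lp.memLp f).1
      exact (this.norm.pow 2)
    · refine Filter.Eventually.of_forall fun i => ?_
      filter_upwards [hC i] with x hx
      rw [Real.norm_of_nonneg (sq_nonneg _), ← mul_pow]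
      gcongr
      exact (ContinuousLinearMap.le_opNorm _ _).trans (by gcongr)
    · exact (integrable_norm_sq f).const_mul _
    · filter_upwards [h] with x hx
      have h3 : Filter.Tendsto (fun i => ‖(M i x - N x) (f x)‖) l (𝓝 0) := by
        have h4 : Filter.Tendsto (fun i => (M i x - N x)) l (𝓝 0) := by
          rw [← sub_self (N x)]; exact hx.sub_const _
        have := ((ContinuousLinearMap.apply ℂ V (f x)).continuous.tendsto 0).comp h4
        simpa using this.norm
      simpa using h3.pow 2
  have := h1.sqrt
  simpa [Real.sqrt_sq (norm_nonneg _)] using this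

end MulOp

end Operators

/-! ### Cosine and sine transforms on the half line from the Fourier transform on the line. -/

section Fourier

set_option linter.unusedSectionVars false

variable {V : Type*} [NormedAddCommGroup V] [InnerProductSpace ℂ V] [CompleteSpace V]

/-- On `L¹ ∩ L²` the Fourier transform of `L²` is given by the integral. -/
lemma coeFn_fourier_of_integrable (f : Lp V 2 (volume : Measure ℝ)) (hf : Integrable f) :
    (𝓕 f : Lp V 2 (volume : Measure ℝ)) =ᵐ[volume] 𝓕 (f : ℝ → V) := by
  have hcont : Continuous (𝓕 (f : ℝ → V)) :=
    VectorFourier.fourierIntegral_continuous Real.continuous_fourierChar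
      (by exact continuous_inner) hf
  -- Both sides are tested against smooth compactly supported functions. The L² transform agrees
  -- with that of tempered distributions, and the integral transform is moved onto the test function
  -- by Fubini (`h2`).
  apply ae_eq_of_integral_contDiff_smul_eq ((Lp.memLp _).locallyIntegrable (by norm_num))
    hcont.locallyIntegrable
  intro φ hφ hc
  have hφ' : ContDiff ℝ ∞ (fun x => (φ x : ℂ)) := Complex.ofRealCLM.contDiff.comp hφ
  have hc' : HasCompactSupport (fun x => (φ x : ℂ)) := hc.comp_left Complex.ofReal_zero
  let g : SchwartzMap ℝ ℂ := hc'.toSchwartzMap hφ'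
  have h1 := congrArg (fun T => T g) (Lp.fourier_toTemperedDistribution_eq f)
  simp only [TemperedDistribution.fourier_apply, Lp.toTemperedDistribution_apply] at h1
  have h2 := VectorFourier.integral_fourierIntegral_smul_eq_flip (e := Real.fourierChar)
    (L := innerₗ ℝ) (μ := volume) (ν := volume) Real.continuous_fourierChar continuous_inner
    g.integrable hf
  rw [flip_innerₗ] at h2
  have h3 : ∀ x, g x = (φ x : ℂ) := fun _ => rfl
  simp only [h3, SchwartzMap.fourier_coe, Complex.coe_smul] at h1 h2
  exact h1.symm.trans h2

lemma reflect_reflect (f : Lp V 2 (volume : Measure ℝ)) : reflect V (reflect V f) = f := by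
  apply Lp.ext
  filter_upwards [coeFn_reflect (reflect V f),
    (Measure.measurePreserving_neg (volume : Measure ℝ)).quasiMeasurePreserving.ae
      (coeFn_reflect f)] with x h1 h2
  rw [h1, h2, neg_neg]

/-- Both sides are continuous in f, so it suffices to take Schwartz functions, for which the
integral formulas differ only by the sign of the frequency. -/
lemma reflect_fourier (f : Lp V 2 (volume : Measure ℝ)) : reflect V (𝓕 f) = 𝓕⁻ f := by
  refine DenseRange.induction_on (p := fun f => reflect V (𝓕 f) = 𝓕⁻ f)
    (SchwartzMap.denseRange_toLpCLM (F := V) (p := 2) (μ := (volume : Measure ℝ))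
      ENNReal.ofNat_ne_top) f ?_ ?_
  · exact isClosed_eq ((reflect V).continuous.comp (FourierTransform.fourierCLM ℂ _).continuous)
      (FourierTransform.fourierInvCLM ℂ _).continuous
  · intro g
    change reflect V (𝓕 (g.toLp 2)) = 𝓕⁻ (g.toLp 2)
    rw [SchwartzMap.toLp_fourier_eq, SchwartzMap.toLp_fourierInv_eq]
    apply Lp.ext
    filter_upwards [coeFn_reflect ((𝓕 g).toLp 2), (𝓕⁻ g).coeFn_toLp 2 volume,
      (Measure.measurePreserving_neg (volume : Measure ℝ)).quasiMeasurePreserving.ae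
        ((𝓕 g).coeFn_toLp 2 volume)] with x h1 h2 h3
    rw [h1, h2, h3, SchwartzMap.fourier_coe, SchwartzMap.fourierInv_coe,
      Real.fourierInv_eq_fourier_neg]

lemma fourier_reflect (f : Lp V 2 (volume : Measure ℝ)) : 𝓕 (reflect V f) = 𝓕⁻ f := by
  have h := reflect_fourier (𝓕⁻ f)
  rw [FourierTransform.fourier_fourierInv_eq] at h
  rw [h, FourierTransform.fourier_fourierInv_eq]

lemma coeFn_fourierInv_of_integrable (f : Lp V 2 (volume : Measure ℝ)) (hf : Integrable f) :
    (𝓕⁻ f : Lp V 2 (volume : Measure ℝ)) =ᵐ[volume] 𝓕⁻ (f : ℝ → V) := by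
  rw [← reflect_fourier]
  filter_upwards [coeFn_reflect (𝓕 f),
    (Measure.measurePreserving_neg (volume : Measure ℝ)).quasiMeasurePreserving.ae
      (coeFn_fourier_of_integrable f hf)] with x h1 h2
  rw [h1, h2, Real.fourierInv_eq_fourier_neg]

lemma inner_fourier_left (f g : Lp V 2 (volume : Measure ℝ)) : ⟪𝓕 f, g⟫_ℂ = ⟪f, 𝓕⁻ g⟫_ℂ := by
  rw [← Lp.inner_fourier_eq f, FourierTransform.fourier_fourierInv_eq]

lemma inner_fourierInv_left (f g : Lp V 2 (volume : Measure ℝ)) :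
    ⟪𝓕⁻ f, g⟫_ℂ = ⟪f, 𝓕 g⟫_ℂ := by
  rw [← Lp.inner_fourier_eq, FourierTransform.fourier_fourierInv_eq]

/-! ### The cosine and sine transforms with kernels `2 cos(2πkx)` and `2 sin(2πkx)` -/

/-- `f ↦ 2 ∫ cos(2πkx) f(x) dx`. -/
noncomputable def cosAux (V : Type*) [NormedAddCommGroup V] [InnerProductSpace ℂ V]
    [CompleteSpace V] : Lp V 2 ν₀ →L[ℂ] Lp V 2 ν₀ :=
  restr V ∘L (FourierTransform.fourierCLM ℂ (Lp V 2 (volume : Measure ℝ)) +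
    FourierTransform.fourierInvCLM ℂ (Lp V 2 (volume : Measure ℝ))) ∘L zeroExt V

/-- `f ↦ 2 ∫ sin(2πkx) f(x) dx`. -/
noncomputable def sinAux (V : Type*) [NormedAddCommGroup V] [InnerProductSpace ℂ V]
    [CompleteSpace V] : Lp V 2 ν₀ →L[ℂ] Lp V 2 ν₀ :=
  Complex.I • (restr V ∘L (FourierTransform.fourierCLM ℂ (Lp V 2 (volume : Measure ℝ)) -
    FourierTransform.fourierInvCLM ℂ (Lp V 2 (volume : Measure ℝ))) ∘L zeroExt V)

lemma cosAux_apply (f : Lp V 2 ν₀) :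
    cosAux V f = restr V (𝓕 (zeroExt V f) + 𝓕⁻ (zeroExt V f)) := rfl

lemma sinAux_apply (f : Lp V 2 ν₀) :
    sinAux V f = Complex.I • restr V (𝓕 (zeroExt V f) - 𝓕⁻ (zeroExt V f)) := rfl

lemma inner_cosAux (f g : Lp V 2 ν₀) : ⟪cosAux V f, g⟫_ℂ = ⟪f, cosAux V g⟫_ℂ := by
  rw [cosAux_apply, cosAux_apply, ← inner_zeroExt, ← inner_conj_symm, ← inner_zeroExt,
    inner_conj_symm, inner_add_left, inner_add_right, inner_fourier_left, inner_fourierInv_left,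
    add_comm]

lemma inner_sinAux (f g : Lp V 2 ν₀) : ⟪sinAux V f, g⟫_ℂ = ⟪f, sinAux V g⟫_ℂ := by
  rw [sinAux_apply, sinAux_apply, inner_smul_left, inner_smul_right, ← inner_zeroExt,
    ← inner_conj_symm (restr V _) g, ← inner_zeroExt, inner_conj_symm, inner_sub_left,
    inner_sub_right, inner_fourier_left, inner_fourierInv_left, Complex.conj_I]
  ring

lemma cosAux_cosAux (f : Lp V 2 ν₀) : cosAux V (cosAux V f) = f := by
  set v := 𝓕 (zeroExt V f) + 𝓕⁻ (zeroExt V f) with hv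
  -- Since v is even, the zero extension of its restriction and the reflection of that extension add
  -- up to v. The second 𝓕 + 𝓕⁻ thereby becomes a single 𝓕 applied to v.
  have h1 : reflect V v = v := by
    rw [hv, map_add, reflect_fourier, ← reflect_fourier (zeroExt V f), reflect_reflect, add_comm]
  have h2 := zeroExt_restr_add_reflect v
  rw [h1] at h2
  rw [cosAux_apply f, ← hv, cosAux_apply, ← fourier_reflect (zeroExt V (restr V v)),
    ← FourierAdd.fourier_add, h2, hv, FourierAdd.fourier_add,
    FourierTransform.fourier_fourierInv_eq, map_add, restr_zeroExt]
  have h3 : 𝓕 (𝓕 (zeroExt V f)) = reflect V (zeroExt V f) := by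
    have := reflect_fourier (𝓕 (zeroExt V f))
    rw [FourierTransform.fourierInv_fourier_eq] at this
    rw [← reflect_reflect (𝓕 (𝓕 (zeroExt V f))), this]
  rw [h3, restr_reflect_zeroExt, zero_add]

lemma sinAux_sinAux (f : Lp V 2 ν₀) : sinAux V (sinAux V f) = f := by
  set v := 𝓕 (zeroExt V f) - 𝓕⁻ (zeroExt V f) with hv
  -- As for the cosine transform, but v is odd; the two factors i make up for the sign.
  have h1 : reflect V v = -v := by
    rw [hv, map_sub, reflect_fourier, ← reflect_fourier (zeroExt V f), reflect_reflect, neg_sub]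
  have h2 := zeroExt_restr_add_reflect v
  rw [h1, map_neg, map_neg, map_neg, ← sub_eq_add_neg] at h2
  have h4 : sinAux V (restr V v) = Complex.I • restr V (𝓕 v) := by
    rw [sinAux_apply, ← fourier_reflect (zeroExt V (restr V v))]
    conv_rhs => rw [← h2]
    rw [sub_eq_add_neg, sub_eq_add_neg, FourierAdd.fourier_add, FourierTransform.fourier_neg]
  have h3 : 𝓕 (𝓕 (zeroExt V f)) = reflect V (zeroExt V f) := by
    have := reflect_fourier (𝓕 (zeroExt V f))
    rw [FourierTransform.fourierInv_fourier_eq] at this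
    rw [← reflect_reflect (𝓕 (𝓕 (zeroExt V f))), this]
  rw [sinAux_apply f, ← hv, map_smul, h4, hv, sub_eq_add_neg, FourierAdd.fourier_add,
    FourierTransform.fourier_neg, FourierTransform.fourier_fourierInv_eq, map_add, map_neg,
    restr_zeroExt, h3, restr_reflect_zeroExt, zero_add, smul_smul, Complex.I_mul_I, neg_smul,
    one_smul, neg_neg]

lemma integrable_smul_cos {f : ℝ → V} (hf : Integrable f ν₀) (k : ℝ) :
    Integrable (fun x => ((Real.cos (k * x) : ℝ) : ℂ) • f x) ν₀ := by
  refine hf.bdd_smul 1 (by fun_prop) (ae_of_all _ fun x => ?_)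
  rw [Complex.norm_real]
  exact Real.abs_cos_le_one _

lemma integrable_smul_sin {f : ℝ → V} (hf : Integrable f ν₀) (k : ℝ) :
    Integrable (fun x => ((Real.sin (k * x) : ℝ) : ℂ) • f x) ν₀ := by
  refine hf.bdd_smul 1 (by fun_prop) (ae_of_all _ fun x => ?_)
  rw [Complex.norm_real]
  exact Real.abs_sin_le_one _

lemma integrable_zeroExt {f : Lp V 2 ν₀} (hf : Integrable f ν₀) :
    Integrable (zeroExt V f) volume :=
  ((integrable_indicator_iff measurableSet_Ioi).2 hf).congr (coeFn_zeroExt f).symm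

lemma fourier_zeroExt {f : Lp V 2 ν₀} (hf : Integrable f ν₀) (k : ℝ) :
    𝓕 (zeroExt V f : ℝ → V) k = (∫ x, ((Real.cos (2 * Real.pi * k * x) : ℝ) : ℂ) • f x ∂ν₀)
      - Complex.I • ∫ x, ((Real.sin (2 * Real.pi * k * x) : ℝ) : ℂ) • f x ∂ν₀ := by
  have h0 := integral_sub (integrable_smul_cos hf (2 * Real.pi * k))
    ((integrable_smul_sin hf (2 * Real.pi * k)).smul Complex.I)
  simp only [Pi.smul_apply, integral_smul] at h0
  rw [← h0, Real.fourier_real_eq_integral_exp_smul, ← integral_indicator measurableSet_Ioi]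
  apply integral_congr_ae
  filter_upwards [coeFn_zeroExt f] with x hx
  rw [hx]
  by_cases h : x ∈ Ioi (0 : ℝ)
  · rw [indicator_of_mem h, indicator_of_mem h, smul_smul, ← sub_smul]
    congr 1
    have : ((-2 * Real.pi * x * k : ℝ) : ℂ) * Complex.I
        = ((-(2 * Real.pi * k * x) : ℝ) : ℂ) * Complex.I := by push_cast; ring
    rw [this, Complex.exp_mul_I, ← Complex.ofReal_cos, ← Complex.ofReal_sin, Real.cos_neg,
      Real.sin_neg]
    push_cast; ring
  · rw [indicator_of_notMem h, indicator_of_notMem h, smul_zero]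

lemma coeFn_cosAux {f : Lp V 2 ν₀} (hf : Integrable f ν₀) : cosAux V f =ᵐ[ν₀] fun k =>
    (2 : ℂ) • ∫ x, ((Real.cos (2 * Real.pi * k * x) : ℝ) : ℂ) • f x ∂ν₀ := by
  rw [cosAux_apply]
  filter_upwards [coeFn_restr (𝓕 (zeroExt V f) + 𝓕⁻ (zeroExt V f)),
    ae_restrict_of_ae (Lp.coeFn_add (𝓕 (zeroExt V f)) (𝓕⁻ (zeroExt V f))),
    ae_restrict_of_ae (coeFn_fourier_of_integrable _ (integrable_zeroExt hf)),
    ae_restrict_of_ae (coeFn_fourierInv_of_integrable _ (integrable_zeroExt hf))] with k h1 h2 h3 h4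
  rw [h1, h2, Pi.add_apply, h3, h4, Real.fourierInv_eq_fourier_neg, fourier_zeroExt hf,
    fourier_zeroExt hf]
  simp only [mul_neg, neg_mul, Real.cos_neg, Real.sin_neg, Complex.ofReal_neg, neg_smul,
    integral_neg, smul_neg, sub_neg_eq_add]
  rw [two_smul]
  abel

lemma coeFn_sinAux {f : Lp V 2 ν₀} (hf : Integrable f ν₀) : sinAux V f =ᵐ[ν₀] fun k =>
    (2 : ℂ) • ∫ x, ((Real.sin (2 * Real.pi * k * x) : ℝ) : ℂ) • f x ∂ν₀ := by
  rw [sinAux_apply]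
  filter_upwards [coeFn_restr (𝓕 (zeroExt V f) - 𝓕⁻ (zeroExt V f)),
    Lp.coeFn_smul Complex.I (restr V (𝓕 (zeroExt V f) - 𝓕⁻ (zeroExt V f))),
    ae_restrict_of_ae (Lp.coeFn_sub (𝓕 (zeroExt V f)) (𝓕⁻ (zeroExt V f))),
    ae_restrict_of_ae (coeFn_fourier_of_integrable _ (integrable_zeroExt hf)),
    ae_restrict_of_ae (coeFn_fourierInv_of_integrable _ (integrable_zeroExt hf))]
    with k h1 h5 h2 h3 h4
  rw [h5, Pi.smul_apply, h1, h2, Pi.sub_apply, h3, h4, Real.fourierInv_eq_fourier_neg,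
    fourier_zeroExt hf, fourier_zeroExt hf]
  simp only [mul_neg, neg_mul, Real.cos_neg, Real.sin_neg, Complex.ofReal_neg, neg_smul,
    integral_neg, smul_neg, sub_neg_eq_add]
  rw [sub_add_eq_sub_sub, sub_sub_cancel_left, ← neg_add', smul_neg, smul_add, smul_smul,
    Complex.I_mul_I, two_smul]
  simp

/-! ### The cosine and sine transforms with kernels `√(2/π) cos(kx)` and `√(2/π) sin(kx)` -/

lemma sqrt_two_pi_pos : 0 < √(2 * Real.pi) := Real.sqrt_pos.2 (by positivity)

/-- The cosine transform of `L²((0, ∞); V)`. -/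
noncomputable def cosT (V : Type*) [NormedAddCommGroup V] [InnerProductSpace ℂ V]
    [CompleteSpace V] : Lp V 2 ν₀ →L[ℂ] Lp V 2 ν₀ :=
  dilate V (√(2 * Real.pi))⁻¹ (inv_pos.2 sqrt_two_pi_pos) ∘L cosAux V ∘L
    dilate V (√(2 * Real.pi)) sqrt_two_pi_pos

/-- The sine transform of `L²((0, ∞); V)`. -/
noncomputable def sinT (V : Type*) [NormedAddCommGroup V] [InnerProductSpace ℂ V]
    [CompleteSpace V] : Lp V 2 ν₀ →L[ℂ] Lp V 2 ν₀ :=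
  dilate V (√(2 * Real.pi))⁻¹ (inv_pos.2 sqrt_two_pi_pos) ∘L sinAux V ∘L
    dilate V (√(2 * Real.pi)) sqrt_two_pi_pos

lemma inner_cosT (f g : Lp V 2 ν₀) : ⟪cosT V f, g⟫_ℂ = ⟪f, cosT V g⟫_ℂ := by
  have h : (√(2 * Real.pi))⁻¹ * √(2 * Real.pi) = 1 := inv_mul_cancel₀ sqrt_two_pi_pos.ne'
  simp only [cosT, ContinuousLinearMap.comp_apply]
  rw [inner_dilate _ _ _ sqrt_two_pi_pos h, inner_cosAux,
    inner_dilate _ _ _ (inv_pos.2 sqrt_two_pi_pos) (by rw [mul_comm, h])]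

lemma inner_sinT (f g : Lp V 2 ν₀) : ⟪sinT V f, g⟫_ℂ = ⟪f, sinT V g⟫_ℂ := by
  have h : (√(2 * Real.pi))⁻¹ * √(2 * Real.pi) = 1 := inv_mul_cancel₀ sqrt_two_pi_pos.ne'
  simp only [sinT, ContinuousLinearMap.comp_apply]
  rw [inner_dilate _ _ _ sqrt_two_pi_pos h, inner_sinAux,
    inner_dilate _ _ _ (inv_pos.2 sqrt_two_pi_pos) (by rw [mul_comm, h])]

@[simp]
lemma cosT_cosT (f : Lp V 2 ν₀) : cosT V (cosT V f) = f := by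
  have h : (√(2 * Real.pi))⁻¹ * √(2 * Real.pi) = 1 := inv_mul_cancel₀ sqrt_two_pi_pos.ne'
  simp only [cosT, ContinuousLinearMap.comp_apply]
  rw [dilate_dilate_inv (√(2 * Real.pi)) _ _ _ (by rw [mul_comm, h]), cosAux_cosAux,
    dilate_dilate_inv _ _ _ _ h]

@[simp]
lemma sinT_sinT (f : Lp V 2 ν₀) : sinT V (sinT V f) = f := by
  have h : (√(2 * Real.pi))⁻¹ * √(2 * Real.pi) = 1 := inv_mul_cancel₀ sqrt_two_pi_pos.ne'
  simp only [sinT, ContinuousLinearMap.comp_apply]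
  rw [dilate_dilate_inv (√(2 * Real.pi)) _ _ _ (by rw [mul_comm, h]), sinAux_sinAux,
    dilate_dilate_inv _ _ _ _ h]

lemma integrable_dilate {c : ℝ} (hc : 0 < c) {f : Lp V 2 ν₀} (hf : Integrable f ν₀) :
    Integrable (dilate V c hc f) ν₀ := by
  have h1 : Integrable (fun x => f (c * x)) ν₀ := by
    have := (integrableOn_Ioi_comp_mul_left_iff (f : ℝ → V) 0 hc).2 (by rwa [mul_zero])
    exact this
  exact (h1.smul ((√c : ℝ) : ℂ)).congr (coeFn_dilate c hc f).symm

/-- The dilated kernel: common part of the integral formulas for `cosT` and `sinT`. -/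
lemma integral_dilate_kernel (T : ℝ → ℝ) (f : Lp V 2 ν₀) (k : ℝ) :
    ((√((√(2 * Real.pi))⁻¹) : ℝ) : ℂ) • (2 : ℂ) • ∫ x,
      ((T (2 * Real.pi * ((√(2 * Real.pi))⁻¹ * k) * x) : ℝ) : ℂ) •
        dilate V (√(2 * Real.pi)) sqrt_two_pi_pos f x ∂ν₀
    = √(2 / Real.pi) • ∫ x, ((T (k * x) : ℝ) : ℂ) • f x ∂ν₀ := by
  set s := √(2 * Real.pi) with hs
  have hs0 : 0 < s := sqrt_two_pi_pos
  -- Conjugation with the dilation by s scales k and x by 1/s each, so s² = 2π turns 2πkx into kx,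
  -- and the prefactor 2 becomes 2/s = √(2/π).
  have hs2 : s * s = 2 * Real.pi := Real.mul_self_sqrt (by positivity)
  have e1 : ∀ x, 2 * Real.pi * (s⁻¹ * k) * x = k * (s * x) := by
    intro x; rw [← hs2]; field_simp
  have e2 : ∫ x, ((T (2 * Real.pi * (s⁻¹ * k) * x) : ℝ) : ℂ) •
      dilate V s sqrt_two_pi_pos f x ∂ν₀
      = ((√s : ℝ) : ℂ) • s⁻¹ • ∫ x, ((T (k * x) : ℝ) : ℂ) • f x ∂ν₀ := by
    have h1 := integral_comp_mul_left_Ioi (fun x => ((T (k * x) : ℝ) : ℂ) • f x) 0 hs0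
    rw [mul_zero] at h1
    rw [← h1, ← integral_smul]
    apply integral_congr_ae
    filter_upwards [coeFn_dilate s hs0 f] with x hx
    rw [hx, e1, smul_comm]
  rw [e2, ← Complex.coe_smul (s⁻¹), ← Complex.coe_smul (√(2 / Real.pi)), smul_smul, smul_smul,
    smul_smul]
  congr 1
  have e3 : √(s⁻¹) * √s = 1 := by
    rw [← Real.sqrt_mul (inv_nonneg.2 hs0.le), inv_mul_cancel₀ hs0.ne', Real.sqrt_one]
  have e4 : √(2 / Real.pi) = 2 * s⁻¹ := by
    have : s * √(2 / Real.pi) = 2 := by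
      rw [hs, ← Real.sqrt_mul (by positivity),
        show 2 * Real.pi * (2 / Real.pi) = 2 ^ 2 by field_simp, Real.sqrt_sq (by norm_num)]
    rw [eq_mul_inv_iff_mul_eq₀ hs0.ne', mul_comm, this]
  rw [e4]
  have : ((√s⁻¹ : ℝ) : ℂ) * ((√s : ℝ) : ℂ) = 1 := by rw [← Complex.ofReal_mul, e3]; simp
  push_cast
  linear_combination (2 * (s : ℂ)⁻¹) * this

lemma coeFn_cosT {f : Lp V 2 ν₀} (hf : Integrable f ν₀) : cosT V f =ᵐ[ν₀] fun k =>
    √(2 / Real.pi) • ∫ x, ((Real.cos (k * x) : ℝ) : ℂ) • f x ∂ν₀ := by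
  filter_upwards [coeFn_dilate (√(2 * Real.pi))⁻¹ (inv_pos.2 sqrt_two_pi_pos)
    (cosAux V (dilate V (√(2 * Real.pi)) sqrt_two_pi_pos f)),
    (quasiMeasurePreserving_mul (inv_pos.2 sqrt_two_pi_pos)).ae
      (coeFn_cosAux (integrable_dilate sqrt_two_pi_pos hf))] with k h1 h2
  simp only [cosT, ContinuousLinearMap.comp_apply]
  rw [h1, h2, integral_dilate_kernel]

lemma coeFn_sinT {f : Lp V 2 ν₀} (hf : Integrable f ν₀) : sinT V f =ᵐ[ν₀] fun k =>
    √(2 / Real.pi) • ∫ x, ((Real.sin (k * x) : ℝ) : ℂ) • f x ∂ν₀ := by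
  filter_upwards [coeFn_dilate (√(2 * Real.pi))⁻¹ (inv_pos.2 sqrt_two_pi_pos)
    (sinAux V (dilate V (√(2 * Real.pi)) sqrt_two_pi_pos f)),
    (quasiMeasurePreserving_mul (inv_pos.2 sqrt_two_pi_pos)).ae
      (coeFn_sinAux (integrable_dilate sqrt_two_pi_pos hf))] with k h1 h2
  simp only [sinT, ContinuousLinearMap.comp_apply]
  rw [h1, h2, integral_dilate_kernel]

end Fourier

/-! ### Vanishing weak derivatives, primitives and partial integration. -/

section WeakDerivatives

set_option linter.unusedSectionVars false

variable {V : Type*} [NormedAddCommGroup V] [NormedSpace ℝ V] [CompleteSpace V]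

/-- A test function on `(0, ∞)` vanishes outside of some `[a, b]` with `0 < a < b`. -/
lemma exists_Icc_of_tsupport_subset {φ : ℝ → ℝ} (hc : HasCompactSupport φ)
    (hs : tsupport φ ⊆ Ioi (0 : ℝ)) :
    ∃ a b : ℝ, 0 < a ∧ a < b ∧ ∀ x, x ∉ Icc a b → φ x = 0 := by
  rcases (tsupport φ).eq_empty_or_nonempty with h | h
  · refine ⟨1, 2, one_pos, one_lt_two, fun x _ => ?_⟩
    rw [tsupport_eq_empty_iff.1 h, Pi.zero_apply]
  · obtain ⟨a, ha, ha'⟩ := hc.isCompact.exists_isLeast h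
    obtain ⟨b, hb, hb'⟩ := hc.isCompact.exists_isGreatest h
    refine ⟨a, b + 1, hs ha, (ha' hb).trans_lt (lt_add_one b), fun x hx => ?_⟩
    apply image_eq_zero_of_notMem_tsupport
    intro hx'
    exact hx ⟨ha' hx', (hb' hx').trans (lt_add_one b).le⟩

/-- The fundamental lemma of du Bois-Reymond. -/
lemma ae_eq_const_of_weakDeriv_zero {f : ℝ → V} (hf : LocallyIntegrable f ν₀)
    (h : ∀ φ : ℝ → ℝ, ContDiff ℝ ∞ φ → HasCompactSupport φ → tsupport φ ⊆ Ioi (0 : ℝ) →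
      ∫ x in Ioi (0 : ℝ), deriv φ x • f x = 0) : ∃ c : V, f =ᵐ[ν₀] fun _ => c := by
  -- A reference test function φ₀ of integral 1, supported in [1, 3] and so away from 0. The
  -- constant will be ∫ φ₀ f.
  let β : ContDiffBump (2 : ℝ) := ⟨1 / 2, 1, by norm_num, by norm_num⟩
  let φ₀ : ℝ → ℝ := β.normed volume
  have hφ₀ : ContDiff ℝ ∞ φ₀ := β.contDiff_normed
  have hφ₀c : HasCompactSupport φ₀ := β.hasCompactSupport_normed
  have hφ₀s : tsupport φ₀ ⊆ Ioi (0 : ℝ) := by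
    rw [β.tsupport_normed_eq, Real.closedBall_eq_Icc]
    intro x hx
    have h1 : (2 : ℝ) - 1 ≤ x := hx.1
    simp only [mem_Ioi]; linarith
  have hφ₀i : ∫ x, φ₀ x = 1 := β.integral_normed
  have hint : ∀ φ : ℝ → ℝ, ContDiff ℝ ∞ φ → HasCompactSupport φ →
      Integrable (fun x => φ x • f x) ν₀ := fun φ hφ hc =>
    hf.integrable_smul_left_of_hasCompactSupport hφ.continuous hc
  set c : V := ∫ x in Ioi (0 : ℝ), φ₀ x • f x with hcdef
  refine ⟨c, ?_⟩
  have key : ∀ φ : ℝ → ℝ, ContDiff ℝ ∞ φ → HasCompactSupport φ → tsupport φ ⊆ Ioi (0 : ℝ) →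
      ∫ x in Ioi (0 : ℝ), φ x • f x = (∫ x, φ x) • c := by
    intro φ hφ hc hs
    set I : ℝ := ∫ x, φ x with hI
    set ψ : ℝ → ℝ := fun x => φ x - I * φ₀ x with hψdef
    have hψ : ContDiff ℝ ∞ ψ := hφ.sub (contDiff_const.mul hφ₀)
    have hφint : Integrable φ := hφ.continuous.integrable_of_hasCompactSupport hc
    have hφ₀int : Integrable φ₀ := hφ₀.continuous.integrable_of_hasCompactSupport hφ₀c
    have hψint : Integrable ψ := hφint.sub (hφ₀int.const_mul I)
    have hψ0 : ∫ x, ψ x = 0 := by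
      rw [hψdef, integral_sub hφint (hφ₀int.const_mul I), integral_const_mul, hφ₀i, mul_one,
        sub_self]
    obtain ⟨a, b, ha, hab, hφz⟩ := exists_Icc_of_tsupport_subset hc hs
    obtain ⟨a', b', ha', hab', hφ₀z⟩ := exists_Icc_of_tsupport_subset hφ₀c hφ₀s
    have hψz : ∀ x, x ∉ Icc (min a a') (max b b') → ψ x = 0 := by
      intro x hx
      have h1 : x ∉ Icc a b := fun h => hx ⟨(min_le_left _ _).trans h.1, h.2.trans (le_max_left _ _)⟩
      have h2 : x ∉ Icc a' b' :=
        fun h => hx ⟨(min_le_right _ _).trans h.1, h.2.trans (le_max_right _ _)⟩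
      simp [hψdef, hφz x h1, hφ₀z x h2]
    -- The function φ - (∫ φ) φ₀ has integral 0, so its primitive θ again has compact support in (0,
    -- ∞), and the hypothesis applies to θ.
    set θ : ℝ → ℝ := fun x => ∫ t in (0 : ℝ)..x, ψ t with hθdef
    have hθd : ∀ x, HasDerivAt θ (ψ x) x := fun x =>
      intervalIntegral.integral_hasDerivAt_right (hψ.continuous.intervalIntegrable _ _)
        (hψ.continuous.stronglyMeasurableAtFilter _ _) hψ.continuous.continuousAt
    have hderiv : deriv θ = ψ := funext fun x => (hθd x).deriv
    have hθ : ContDiff ℝ ∞ θ := contDiff_infty_iff_deriv.2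
      ⟨fun x => (hθd x).differentiableAt, by rw [hderiv]; exact hψ⟩
    have hm : 0 < min a a' := lt_min ha ha'
    have hθz : ∀ x, x ∉ Icc (min a a') (max b b') → θ x = 0 := by
      intro x hx
      rcases lt_or_ge x (min a a') with h1 | h1
      · apply intervalIntegral.integral_zero_ae
        refine ae_of_all _ fun t ht => hψz t fun ht' => ?_
        have : t ≤ max 0 x := ht.2
        have : max 0 x < min a a' := max_lt hm h1
        linarith [ht'.1]
      · have h2 : max b b' < x := by
          by_contra h2
          exact hx ⟨h1, not_lt.1 h2⟩
        have h3 : (0 : ℝ) ≤ x := hm.le.trans h1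
        rw [hθdef]
        simp only
        rw [intervalIntegral.integral_of_le h3]
        refine Eq.trans ?_ hψ0
        apply setIntegral_eq_integral_of_forall_compl_eq_zero
        intro t ht
        apply hψz
        intro ht'
        exact ht ⟨hm.trans_le ht'.1, ht'.2.trans h2.le⟩
    have hθs : tsupport θ ⊆ Icc (min a a') (max b b') := by
      apply closure_minimal _ isClosed_Icc
      intro x hx
      by_contra hx'
      exact hx (hθz x hx')
    have hθc : HasCompactSupport θ := HasCompactSupport.of_support_subset_isCompact isCompact_Icc
      ((subset_tsupport θ).trans hθs)
    have h0 := h θ hθ hθc (hθs.trans fun x hx => hm.trans_le hx.1)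
    rw [hderiv] at h0
    have h1 : ∫ x in Ioi (0 : ℝ), ψ x • f x
        = ∫ x in Ioi (0 : ℝ), (φ x • f x - I • (φ₀ x • f x)) := by
      congr 1; ext x
      rw [hψdef, sub_smul, mul_smul]
    have hi : Integrable (fun x => I • φ₀ x • f x) ν₀ := (hint φ₀ hφ₀ hφ₀c).smul I
    rw [h1, integral_sub (hint φ hφ hc) hi, integral_smul,
      sub_eq_zero] at h0
    exact h0
  have hloc : LocallyIntegrable (fun x => f x - c) ν₀ := hf.sub (locallyIntegrable_const c)
  have hz := isOpen_Ioi.ae_eq_zero_of_integral_contDiff_smul_eq_zero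
    (locallyIntegrableOn_of_locallyIntegrable_restrict hloc) (by
      intro φ hφ hc hs
      have hz : ∀ x, x ∉ Ioi (0 : ℝ) → φ x = 0 := fun x hx =>
        image_eq_zero_of_notMem_tsupport fun hx' => hx (hs hx')
      rw [← setIntegral_eq_integral_of_forall_compl_eq_zero
        (fun x hx => by rw [hz x hx, zero_smul])]
      simp_rw [smul_sub]
      have hφint : Integrable φ := hφ.continuous.integrable_of_hasCompactSupport hc
      rw [integral_sub (hint φ hφ hc) (hφint.restrict.smul_const c), key φ hφ hc hs,
        integral_smul_const, setIntegral_eq_integral_of_forall_compl_eq_zero hz, sub_self])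
  rw [Filter.EventuallyEq, ae_restrict_iff' measurableSet_Ioi]
  filter_upwards [hz] with x hx hx0
  exact sub_eq_zero.1 (hx hx0)

/-- The primitive `x ↦ ∫₀ˣ g`, extended by zero to the left. -/
noncomputable def prim (g : ℝ → V) (x : ℝ) : V := ∫ y in Ioc 0 x, g y

lemma prim_zero (g : ℝ → V) : prim g 0 = 0 := by simp [prim]

/-- Local integrability on the whole line for the restricted measure includes neighbourhoods of 0.
Hence integrability reaches down to the endpoint and `prim` may start there. -/
lemma integrableOn_Ioc_of_locallyIntegrable {g : ℝ → V} (hg : LocallyIntegrable g ν₀) (X : ℝ) :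
    IntegrableOn g (Ioc 0 X) := by
  have h1 := hg.integrableOn_isCompact (isCompact_Icc (a := (0 : ℝ)) (b := X))
  rw [IntegrableOn, Measure.restrict_restrict measurableSet_Icc] at h1
  exact IntegrableOn.mono_set h1 fun x hx => ⟨⟨hx.1.le, hx.2⟩, hx.1⟩

lemma continuous_prim {g : ℝ → V} (hg : LocallyIntegrable g ν₀) : Continuous (prim g) := by
  have hII : ∀ a b, IntervalIntegrable ((Ioi (0 : ℝ)).indicator g) volume a b := by
    intro a b
    rw [intervalIntegrable_iff, IntegrableOn, integrable_indicator_iff measurableSet_Ioi,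
      IntegrableOn, Measure.restrict_restrict measurableSet_Ioi]
    refine (integrableOn_Ioc_of_locallyIntegrable hg (max a b)).mono_set fun x hx => ⟨hx.1, ?_⟩
    exact hx.2.2
  convert intervalIntegral.continuous_primitive hII 0 using 1
  ext x
  rcases le_total 0 x with h | h
  · rw [intervalIntegral.integral_of_le h, prim]
    apply setIntegral_congr_fun measurableSet_Ioc
    intro y hy
    exact (indicator_of_mem (s := Ioi (0 : ℝ)) hy.1 g).symm
  · rw [prim, Ioc_eq_empty (not_lt.2 h), intervalIntegral.integral_zero_ae]
    · simp
    · refine ae_of_all _ fun t ht => indicator_of_notMem ?_ _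
      rw [uIoc_of_ge h] at ht
      exact not_lt.2 ht.2

/-- Partial integration for an absolutely continuous function. -/
lemma integral_deriv_smul_prim {g : ℝ → V} (hg : LocallyIntegrable g ν₀) {w w' : ℝ → ℝ}
    (hw : ∀ x, HasDerivAt w (w' x) x) (hw' : Continuous w') (X : ℝ) :
    ∫ x in Ioc 0 X, w' x • prim g x = w X • prim g X - ∫ y in Ioc 0 X, w y • g y := by
  have hgX := integrableOn_Ioc_of_locallyIntegrable hg X
  have hwc : Continuous w := continuous_iff_continuousAt.2 fun x => (hw x).continuousAt
  have hwg : IntegrableOn (fun y => w y • g y) (Ioc 0 X) := by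
    have h1 := hgX
    obtain ⟨C, hC⟩ := (isCompact_Icc (a := (0 : ℝ)) (b := X)).exists_bound_of_continuousOn
      hwc.continuousOn
    refine Integrable.bdd_smul h1 C hwc.aestronglyMeasurable ?_
    rw [ae_restrict_iff' measurableSet_Ioc]
    exact ae_of_all _ fun x hx => hC x ⟨hx.1.le, hx.2⟩
  -- Fubini on the triangle y ≤ x: integrating w'(x) g(y) over y first gives w' times the primitive,
  -- over x first gives (w(X) - w(y)) g(y).
  let S : Set (ℝ × ℝ) := {p | p.2 ≤ p.1}
  have hS : MeasurableSet S := measurableSet_le measurable_snd measurable_fst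
  let Φ : ℝ → ℝ → V := fun x y => S.indicator (fun p : ℝ × ℝ => w' p.1 • g p.2) (x, y)
  have hΦ : Integrable (Function.uncurry Φ)
      ((volume.restrict (Ioc 0 X)).prod (volume.restrict (Ioc 0 X))) := by
    have h1 : Integrable w' (volume.restrict (Ioc 0 X)) :=
      (hw'.integrableOn_Icc (a := 0) (b := X)).mono_set Ioc_subset_Icc_self
    exact (h1.smul_prod hgX).indicator hS
  have e1 : ∀ x ∈ Ioc 0 X, w' x • prim g x = ∫ y in Ioc 0 X, Φ x y := by
    intro x hx
    have h1 : ∀ y, Φ x y = (Iic x).indicator (fun y => w' x • g y) y := by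
      intro y
      by_cases h : y ≤ x
      · rw [indicator_of_mem (show y ∈ Iic x from h)]
        exact indicator_of_mem (s := S) (a := (x, y)) h _
      · rw [indicator_of_notMem (show y ∉ Iic x from h)]
        exact indicator_of_notMem (s := S) (a := (x, y)) h _
    simp_rw [h1]
    rw [integral_indicator measurableSet_Iic, Measure.restrict_restrict measurableSet_Iic,
      integral_smul, prim]
    congr 4
    ext y
    simp only [mem_Ioc, mem_inter_iff, mem_Iic]
    constructor
    · rintro ⟨h1, h2⟩; exact ⟨h2, h1, h2.trans hx.2⟩
    · rintro ⟨h1, h2, h3⟩; exact ⟨h2, h1⟩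
  have e2 : ∀ y ∈ Ioc 0 X, ∫ x in Ioc 0 X, Φ x y = (w X - w y) • g y := by
    intro y hy
    have h1 : ∀ x, Φ x y = (Ici y).indicator (fun x => w' x • g y) x := by
      intro x
      by_cases h : y ≤ x
      · rw [indicator_of_mem (show x ∈ Ici y from h)]
        exact indicator_of_mem (s := S) (a := (x, y)) h _
      · rw [indicator_of_notMem (show x ∉ Ici y from h)]
        exact indicator_of_notMem (s := S) (a := (x, y)) h _
    simp_rw [h1]
    have h2 : Ici y ∩ Ioc 0 X = Icc y X := by
      ext x
      simp only [mem_Ioc, mem_inter_iff, mem_Ici, mem_Icc]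
      constructor
      · rintro ⟨h1, h2, h3⟩; exact ⟨h1, h3⟩
      · rintro ⟨h1, h2⟩; exact ⟨h1, hy.1.trans_le h1, h2⟩
    rw [integral_indicator measurableSet_Ici, Measure.restrict_restrict measurableSet_Ici, h2,
      integral_smul_const, integral_Icc_eq_integral_Ioc,
      ← intervalIntegral.integral_of_le hy.2, intervalIntegral.integral_eq_sub_of_hasDerivAt
        (fun x _ => hw x) (hw'.intervalIntegrable _ _)]
  rw [setIntegral_congr_fun measurableSet_Ioc e1, integral_integral_swap hΦ,
    setIntegral_congr_fun measurableSet_Ioc e2]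
  simp_rw [sub_smul]
  have hi : IntegrableOn (fun y => w X • g y) (Ioc 0 X) := hgX.smul (w X)
  rw [integral_sub hi hwg, integral_smul, prim]

end WeakDerivatives

/-! ### Weakly differentiable functions as primitives; uniqueness of boundary values. -/

section Traces

variable {n : ℕ}

lemma locallyIntegrable_L2 (f : L2 n) : LocallyIntegrable f ν₀ :=
  (Lp.memLp f).locallyIntegrable (by norm_num)

/-- A function with a weak derivative is the primitive of this derivative. -/
lemma IsWeakDeriv.exists_prim {f g : L2 n} (h : IsWeakDeriv f g) :
    ∃ c, f =ᵐ[ν₀] fun x => c + prim g x := by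
  have hcp := continuous_prim (locallyIntegrable_L2 g)
  have hloc : LocallyIntegrable (fun x => f x - prim g x) ν₀ :=
    (locallyIntegrable_L2 f).sub hcp.locallyIntegrable
  -- The difference f - ∫₀ˣ g has weak derivative zero. The interval (0, b + 1] contains the support
  -- of φ, so no boundary terms remain.
  obtain ⟨c, hc⟩ := ae_eq_const_of_weakDeriv_zero hloc (by
    intro φ hφ hc hs
    have hd : Continuous (deriv φ) := hφ.continuous_deriv (by simp)
    have i1 := integrable_smul_lp hd hc.deriv f
    have i2 : Integrable (fun x => deriv φ x • prim g x) ν₀ :=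
      (hcp.locallyIntegrable (μ := ν₀)).integrable_smul_left_of_hasCompactSupport hd hc.deriv
    simp_rw [smul_sub]
    rw [integral_sub i1 i2, h φ hφ hc hs]
    obtain ⟨a, b, ha, hab, hz⟩ := exists_Icc_of_tsupport_subset hc hs
    have hz' : ∀ x, x ∉ Icc a b → deriv φ x = 0 := by
      intro x hx
      by_contra hne
      have h1 : x ∈ tsupport φ := support_deriv_subset hne
      have h2 : tsupport φ ⊆ Icc a b := closure_minimal
        (fun y hy => by by_contra hy'; exact hy (hz y hy')) isClosed_Icc
      exact hx (h2 h1)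
    have hb : (0 : ℝ) < b := ha.trans hab
    have e := integral_deriv_smul_prim (locallyIntegrable_L2 g) (w := φ) (w' := deriv φ)
      (fun x => (hφ.differentiable (by simp)).differentiableAt.hasDerivAt) hd (b + 1)
    rw [hz (b + 1) (fun h => by linarith [h.2]), zero_smul, zero_sub] at e
    have r : ∀ (η : ℝ → ℝ) (u : ℝ → EuclideanSpace ℂ (Fin n)), (∀ x, x ∉ Icc a b → η x = 0) →
        ∫ x in Ioc 0 (b + 1), η x • u x = ∫ x in Ioi 0, η x • u x := by
      intro η u hη
      symm
      apply setIntegral_eq_of_subset_of_forall_sdiff_eq_zero measurableSet_Ioi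
        (fun x hx => hx.1)
      intro x hx
      rw [hη x, zero_smul]
      intro hx'
      exact hx.2 ⟨hx.1, hx'.2.trans (by linarith)⟩
    rw [r _ _ hz, r _ _ hz'] at e
    rw [e, sub_self])
  refine ⟨c, ?_⟩
  filter_upwards [hc] with x hx
  rw [← hx, sub_add_cancel]

/-- Two functions continuous on [0, ∞) that agree almost everywhere agree everywhere on [0, ∞), in
particular at the null set {0}. -/
lemma HasTrace.unique_of_continuous {f : L2 n} {a : EuclideanSpace ℂ (Fin n)} (h : HasTrace f a)
    {u : ℝ → EuclideanSpace ℂ (Fin n)} (hu : Continuous u) (hf : f =ᵐ[ν₀] u) : a = u 0 := by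
  obtain ⟨v, hv, hfv, rfl⟩ := h
  have h1 : v =ᵐ[volume.restrict (Ici (0 : ℝ))] u := by
    rw [← Measure.restrict_congr_set Ioi_ae_eq_Ici]
    exact hfv.symm.trans hf
  refine Measure.eqOn_of_ae_eq h1 hv hu.continuousOn ?_ self_mem_Ici
  rw [interior_Ici, closure_Ioi]

lemma IsWeakDeriv.eq_trace_add_prim {f g : L2 n} (h : IsWeakDeriv f g)
    {a : EuclideanSpace ℂ (Fin n)} (ha : HasTrace f a) : f =ᵐ[ν₀] fun x => a + prim g x := by
  obtain ⟨c, hc⟩ := h.exists_prim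
  have := ha.unique_of_continuous
    (continuous_const.add (continuous_prim (locallyIntegrable_L2 g))) hc
  simp only [Pi.add_apply, prim_zero, add_zero] at this
  rwa [this]

end Traces

/-! ### Truncations, density of L¹ ∩ L², and constant matrices commuting with the transforms. -/

section Truncation

set_option linter.unusedSectionVars false

variable {V : Type*} [NormedAddCommGroup V] [InnerProductSpace ℂ V]

/-- The operator valued function `x ↦ g(x) · 1`. -/
noncomputable def scalarFun (V : Type*) [NormedAddCommGroup V] [InnerProductSpace ℂ V]
    {α : Type*} (g : α → ℂ) (x : α) : V →L[ℂ] V := g x • ContinuousLinearMap.id ℂ V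

lemma memLp_scalarFun {α : Type*} [MeasurableSpace α] {μ : Measure α} {g : α → ℂ}
    (hg : AEStronglyMeasurable g μ) (C : ℝ) (hC : ∀ x, ‖g x‖ ≤ C) :
    MemLp (scalarFun V g) ∞ μ := by
  refine memLp_top_of_bound (hg.smul_const _) C (ae_of_all _ fun x => ?_)
  rw [scalarFun, norm_smul]
  calc ‖g x‖ * ‖ContinuousLinearMap.id ℂ V‖ ≤ C * 1 := by
        gcongr
        · exact (norm_nonneg _).trans (hC x)
        · exact hC x
        · exact ContinuousLinearMap.norm_id_le
    _ = C := mul_one C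

lemma memLp_scalarFun_indicator {α : Type*} [MeasurableSpace α] (μ : Measure α) {S : Set α}
    (hS : MeasurableSet S) : MemLp (scalarFun V (S.indicator fun _ => (1 : ℂ))) ∞ μ := by
  refine memLp_scalarFun (stronglyMeasurable_const.indicator hS).aestronglyMeasurable 1 fun x => ?_
  by_cases h : x ∈ S <;> simp [h]

/-- Multiplication by the indicator function of a set. -/
noncomputable def cutoff {α : Type*} [MeasurableSpace α] {μ : Measure α} {S : Set α}
    (hS : MeasurableSet S) : Lp V 2 μ →L[ℂ] Lp V 2 μ :=
  mulOp _ (memLp_scalarFun_indicator μ hS)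

lemma coeFn_cutoff {α : Type*} [MeasurableSpace α] {μ : Measure α} {S : Set α}
    (hS : MeasurableSet S) (f : Lp V 2 μ) : cutoff hS f =ᵐ[μ] S.indicator f := by
  filter_upwards [coeFn_mulOp (memLp_scalarFun_indicator μ hS) f] with x hx
  rw [cutoff, hx, scalarFun]
  by_cases h : x ∈ S <;> simp [h]

lemma tendsto_cutoff {α ι : Type*} [MeasurableSpace α] {μ : Measure α} {l : Filter ι}
    [l.IsCountablyGenerated] {S : ι → Set α} (hS : ∀ i, MeasurableSet (S i))
    (h : ∀ᵐ x ∂μ, ∀ᶠ i in l, x ∈ S i) (f : Lp V 2 μ) :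
    Filter.Tendsto (fun i => cutoff (hS i) f) l (𝓝 f) := by
  have h1 : mulOp _ (memLp_scalarFun_indicator (V := V) μ MeasurableSet.univ) f = f := by
    apply Lp.ext
    filter_upwards [coeFn_mulOp (memLp_scalarFun_indicator μ MeasurableSet.univ) f] with x hx
    rw [hx]; simp [scalarFun]
  conv => enter [3]; rw [← h1]
  refine tendsto_mulOp _ _ 1 (fun i => ae_of_all _ fun x => ?_) ?_ f
  · rw [scalarFun, scalarFun, ← sub_smul, norm_smul]
    refine (mul_le_of_le_one_right (norm_nonneg _) ContinuousLinearMap.norm_id_le).trans ?_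
    by_cases h : x ∈ S i <;> simp [h]
  · filter_upwards [h] with x hx
    apply tendsto_const_nhds.congr'
    filter_upwards [hx] with i hi
    simp [scalarFun, hi]

lemma integrable_cutoff {S : Set ℝ} (hS : MeasurableSet S) {X : ℝ} (hX : S ⊆ Iic X)
    (f : Lp V 2 ν₀) : Integrable (cutoff hS f) ν₀ := by
  refine Integrable.congr ?_ (coeFn_cutoff hS f).symm
  rw [integrable_indicator_iff hS, IntegrableOn, Measure.restrict_restrict hS]
  have h1 : IsFiniteMeasure (volume.restrict (Ioc 0 X)) := inferInstance
  have h2 : S ∩ Ioi 0 ⊆ Ioc 0 X := fun x hx => ⟨hx.2, hX hx.1⟩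
  have h3 : MemLp f 2 (volume.restrict (Ioc 0 X)) :=
    (Lp.memLp f).mono_measure (Measure.restrict_mono Ioc_subset_Ioi_self le_rfl)
  exact (h3.integrable (by norm_num)).mono_measure (Measure.restrict_mono h2 le_rfl)

/-- The integral formulas hold pointwise for truncated functions only; this is how they pass to the
L² limit almost everywhere. -/
lemma exists_subseq_tendsto_ae {f : ℕ → Lp V 2 ν₀} {g : Lp V 2 ν₀}
    (h : Filter.Tendsto f Filter.atTop (𝓝 g)) : ∃ ns : ℕ → ℕ, StrictMono ns ∧
      ∀ᵐ x ∂ν₀, Filter.Tendsto (fun i => f (ns i) x) Filter.atTop (𝓝 (g x)) :=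
  (tendstoInMeasure_of_tendsto_Lp h).exists_seq_tendsto_ae

variable [CompleteSpace V]

/-- Application of a fixed operator to the values of a function. -/
noncomputable def constOp (M : V →L[ℂ] V) : Lp V 2 ν₀ →L[ℂ] Lp V 2 ν₀ :=
  ContinuousLinearMap.compLpL 2 ν₀ M

lemma coeFn_constOp (M : V →L[ℂ] V) (f : Lp V 2 ν₀) : constOp M f =ᵐ[ν₀] fun x => M (f x) :=
  ContinuousLinearMap.coeFn_compLpL M f

lemma tendsto_cutoff_Iic (f : Lp V 2 ν₀) : Filter.Tendsto
    (fun N : ℕ => cutoff (measurableSet_Iic (a := (N : ℝ))) f) Filter.atTop (𝓝 f) := by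
  refine tendsto_cutoff _ (ae_of_all _ fun x => ?_) f
  filter_upwards [Filter.eventually_ge_atTop ⌈x⌉₊] with N hN
  exact (Nat.le_ceil x).trans (by exact_mod_cast hN)

/-- The truncations of f to (0, N] are integrable and converge to f, so bounded operators can be
compared on L¹ ∩ L², where the transforms are integrals. -/
lemma eq_of_eq_on_integrable {S T : Lp V 2 ν₀ →L[ℂ] Lp V 2 ν₀}
    (h : ∀ f : Lp V 2 ν₀, Integrable f ν₀ → S f = T f) : S = T := by
  ext1 f
  have h1 := (S.continuous.tendsto f).comp (tendsto_cutoff_Iic f)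
  have h2 := (T.continuous.tendsto f).comp (tendsto_cutoff_Iic f)
  refine tendsto_nhds_unique h1 (h2.congr fun N => ?_)
  exact (h _ (integrable_cutoff _ subset_rfl f)).symm

lemma integrable_constOp (M : V →L[ℂ] V) {f : Lp V 2 ν₀} (hf : Integrable f ν₀) :
    Integrable (constOp M f) ν₀ :=
  (M.integrable_comp hf).congr (coeFn_constOp M f).symm

lemma cosT_constOp (M : V →L[ℂ] V) (f : Lp V 2 ν₀) :
    cosT V (constOp M f) = constOp M (cosT V f) := by
  refine DFunLike.congr_fun (eq_of_eq_on_integrable (S := cosT V ∘L constOp M)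
    (T := constOp M ∘L cosT V) fun f hf => ?_) f
  apply Lp.ext
  filter_upwards [coeFn_cosT (integrable_constOp M hf), coeFn_constOp M (cosT V f), coeFn_cosT hf]
    with k h1 h2 h3
  simp only [ContinuousLinearMap.comp_apply]
  rw [h1, h2, h3, ← Complex.coe_smul, ← Complex.coe_smul, map_smul,
    ← M.integral_comp_comm (integrable_smul_cos hf k)]
  congr 1
  apply integral_congr_ae
  filter_upwards [coeFn_constOp M f] with x hx
  rw [hx, map_smul]

lemma sinT_constOp (M : V →L[ℂ] V) (f : Lp V 2 ν₀) :
    sinT V (constOp M f) = constOp M (sinT V f) := by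
  refine DFunLike.congr_fun (eq_of_eq_on_integrable (S := sinT V ∘L constOp M)
    (T := constOp M ∘L sinT V) fun f hf => ?_) f
  apply Lp.ext
  filter_upwards [coeFn_sinT (integrable_constOp M hf), coeFn_constOp M (sinT V f), coeFn_sinT hf]
    with k h1 h2 h3
  simp only [ContinuousLinearMap.comp_apply]
  rw [h1, h2, h3, ← Complex.coe_smul, ← Complex.coe_smul, map_smul,
    ← M.integral_comp_comm (integrable_smul_sin hf k)]
  congr 1
  apply integral_congr_ae
  filter_upwards [coeFn_constOp M f] with x hx
  rw [hx, map_smul]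

end Truncation

/-! ### Cosine and sine transforms of weak derivatives. -/

section Derivatives

variable {n : ℕ}

/-- A square integrable function comes close to zero arbitrarily far out. -/
lemma exists_seq_norm_lt {f : L2 n} {u : ℝ → EuclideanSpace ℂ (Fin n)} (hu : f =ᵐ[ν₀] u) :
    ∃ X : ℕ → ℝ, (∀ m : ℕ, (m : ℝ) + 1 ≤ X m) ∧ ∀ m : ℕ, ‖u (X m)‖ < 1 / ((m : ℝ) + 1) := by
  have key : ∀ m : ℕ, ∃ x : ℝ, (m : ℝ) + 1 ≤ x ∧ ‖u x‖ < 1 / ((m : ℝ) + 1) := by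
    intro m
    -- Otherwise ‖f‖² ≥ ε² on a half line, a set of infinite measure, contrary to integrability.
    by_contra! hcon
    set ε : ℝ := 1 / ((m : ℝ) + 1) with hε
    have hε0 : 0 < ε := by positivity
    have h1 := (integrable_norm_sq f).measure_norm_ge_lt_top (ε := ε ^ 2) (by positivity)
    have h2 : ν₀ (Ici ((m : ℝ) + 1)) ≤ ν₀ {x | ε ^ 2 ≤ ‖‖f x‖ ^ 2‖} := by
      apply measure_mono_ae
      filter_upwards [hu] with x hx hx'
      change ε ^ 2 ≤ ‖‖f x‖ ^ 2‖
      rw [Real.norm_of_nonneg (sq_nonneg _), hx]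
      have := hcon x hx'
      gcongr
    have h3 : ν₀ (Ici ((m : ℝ) + 1)) = ⊤ := by
      rw [Measure.restrict_apply measurableSet_Ici, inter_eq_left.2, Real.volume_Ici]
      intro x hx
      have : (m : ℝ) + 1 ≤ x := hx
      have : (0 : ℝ) ≤ m := m.cast_nonneg
      simp only [mem_Ioi]; linarith
    rw [h3] at h2
    exact absurd (h2.trans_lt h1) (lt_irrefl _)
  choose X h1 h2 using key
  exact ⟨X, h1, h2⟩

/-- Partial integration on a finite interval. -/
lemma integral_deriv_smul_of_eq_prim {f g : L2 n} {c : EuclideanSpace ℂ (Fin n)}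
    (h : f =ᵐ[ν₀] fun x => c + prim g x) {w w' : ℝ → ℝ}
    (hw : ∀ x, HasDerivAt w (w' x) x) (hw' : Continuous w') {X : ℝ} (hX : 0 ≤ X) :
    ∫ x in Ioc 0 X, w' x • f x
      = w X • (c + prim g X) - w 0 • c - ∫ x in Ioc 0 X, w x • g x := by
  have hcp := continuous_prim (locallyIntegrable_L2 g)
  have h1 : ∫ x in Ioc 0 X, w' x • f x = ∫ x in Ioc 0 X, (w' x • c + w' x • prim g x) := by
    apply integral_congr_ae
    filter_upwards [ae_restrict_of_ae_restrict_of_subset Ioc_subset_Ioi_self h] with x hx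
    rw [hx, smul_add]
  have i1 : IntegrableOn w' (Ioc 0 X) :=
    (hw'.integrableOn_Icc (a := 0) (b := X)).mono_set Ioc_subset_Icc_self
  have i2 : IntegrableOn (fun x => w' x • prim g x) (Ioc 0 X) :=
    ((hw'.smul hcp).integrableOn_Icc (a := 0) (b := X)).mono_set Ioc_subset_Icc_self
  have i3 : IntegrableOn (fun x => w' x • c) (Ioc 0 X) := i1.smul_const c
  rw [h1, integral_add i3 i2, integral_smul_const,
    integral_deriv_smul_prim (locallyIntegrable_L2 g) hw hw' X,
    ← intervalIntegral.integral_of_le hX, intervalIntegral.integral_eq_sub_of_hasDerivAt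
        (fun x _ => hw x) (hw'.intervalIntegrable _ _), smul_add, sub_smul]
  abel

lemma integral_cutoff_Ioc (T : ℝ → ℝ) (f : L2 n) (X : ℝ) :
    ∫ x, ((T x : ℝ) : ℂ) • cutoff (measurableSet_Ioc (a := (0 : ℝ)) (b := X)) f x ∂ν₀
      = ∫ x in Ioc 0 X, T x • f x := by
  have h1 : ∫ x, ((T x : ℝ) : ℂ) • cutoff (measurableSet_Ioc (a := (0 : ℝ)) (b := X)) f x ∂ν₀
      = ∫ x, (Ioc 0 X).indicator (fun x => T x • f x) x ∂ν₀ := by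
    apply integral_congr_ae
    filter_upwards [coeFn_cutoff (measurableSet_Ioc (a := (0 : ℝ)) (b := X)) f] with x hx
    rw [hx]
    by_cases h : x ∈ Ioc 0 X
    · rw [indicator_of_mem h, indicator_of_mem h, Complex.coe_smul]
    · rw [indicator_of_notMem h, indicator_of_notMem h, smul_zero]
  rw [h1, integral_indicator measurableSet_Ioc, Measure.restrict_restrict measurableSet_Ioc,
    inter_eq_left.2 Ioc_subset_Ioi_self]

lemma tendsto_cutoff_Ioc {X : ℕ → ℝ} (hX : ∀ m : ℕ, (m : ℝ) + 1 ≤ X m) (f : L2 n) : Filter.Tendsto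
    (fun m => cutoff (measurableSet_Ioc (a := (0 : ℝ)) (b := X m)) f) Filter.atTop (𝓝 f) := by
  refine tendsto_cutoff _ ?_ f
  filter_upwards [ae_restrict_mem measurableSet_Ioi] with x hx
  filter_upwards [Filter.eventually_ge_atTop ⌈x⌉₊] with N hN
  refine ⟨hx, (Nat.le_ceil x).trans (le_trans ?_ (hX N))⟩
  have : ((⌈x⌉₊ : ℕ) : ℝ) ≤ N := by exact_mod_cast hN
  linarith

lemma exists_common_subseq {f g : ℕ → L2 n} {f' g' : L2 n}
    (hf : Filter.Tendsto f Filter.atTop (𝓝 f')) (hg : Filter.Tendsto g Filter.atTop (𝓝 g')) :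
    ∃ ns : ℕ → ℕ, StrictMono ns ∧ ∀ᵐ x ∂ν₀,
      Filter.Tendsto (fun i => f (ns i) x) Filter.atTop (𝓝 (f' x)) ∧
      Filter.Tendsto (fun i => g (ns i) x) Filter.atTop (𝓝 (g' x)) := by
  obtain ⟨ns, hns, h1⟩ := exists_subseq_tendsto_ae hf
  obtain ⟨ms, hms, h2⟩ := exists_subseq_tendsto_ae (hg.comp hns.tendsto_atTop)
  refine ⟨ns ∘ ms, hns.comp hms, ?_⟩
  filter_upwards [h1, h2] with x hx1 hx2
  exact ⟨hx1.comp hms.tendsto_atTop, hx2⟩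

lemma tendsto_bdd_smul_of_norm_lt {s : ℕ → ℝ} (hs : ∀ i, |s i| ≤ 1) {ns : ℕ → ℕ}
    (hns : StrictMono ns) {v : ℕ → EuclideanSpace ℂ (Fin n)}
    (hv : ∀ m : ℕ, ‖v m‖ < 1 / ((m : ℝ) + 1)) :
    Filter.Tendsto (fun i => s i • v (ns i)) Filter.atTop (𝓝 0) := by
  have h1 : Filter.Tendsto v Filter.atTop (𝓝 0) :=
    squeeze_zero_norm (fun m => (hv m).le) tendsto_one_div_add_atTop_nhds_zero_nat
  have h2 := h1.comp hns.tendsto_atTop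
  have h3 := h2.norm
  rw [norm_zero] at h3
  refine squeeze_zero_norm (fun i => ?_) h3
  rw [norm_smul, Real.norm_eq_abs]
  exact mul_le_of_le_one_left (norm_nonneg _) (hs i)

/-- `k C f = -S f'`. -/
lemma IsWeakDeriv.cosT {f g : L2 n} (h : IsWeakDeriv f g) :
    ∀ᵐ k ∂ν₀, k • HalfLine.cosT _ f k = -(sinT _ g k) := by
  obtain ⟨c, hc⟩ := h.exists_prim
  obtain ⟨X, hX, hu⟩ := exists_seq_norm_lt hc
  obtain ⟨ns, hns, hlim⟩ := exists_common_subseq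
    (((HalfLine.cosT _).continuous.tendsto f).comp (tendsto_cutoff_Ioc hX f))
    (((sinT _).continuous.tendsto g).comp (tendsto_cutoff_Ioc hX g))
  have e1 : ∀ᵐ k ∂ν₀, ∀ m, HalfLine.cosT _ (cutoff (measurableSet_Ioc (a := 0) (b := X m)) f) k
      = √(2 / Real.pi) • ∫ x in Ioc 0 (X m), Real.cos (k * x) • f x := by
    refine ae_all_iff.2 fun m => ?_
    filter_upwards [coeFn_cosT (integrable_cutoff (measurableSet_Ioc (a := 0) (b := X m))
      (fun x hx => hx.2) f)] with k hk
    rw [hk, integral_cutoff_Ioc (fun x => Real.cos (k * x))]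
  have e2 : ∀ᵐ k ∂ν₀, ∀ m, sinT _ (cutoff (measurableSet_Ioc (a := 0) (b := X m)) g) k
      = √(2 / Real.pi) • ∫ x in Ioc 0 (X m), Real.sin (k * x) • g x := by
    refine ae_all_iff.2 fun m => ?_
    filter_upwards [coeFn_sinT (integrable_cutoff (measurableSet_Ioc (a := 0) (b := X m))
      (fun x hx => hx.2) g)] with k hk
    rw [hk, integral_cutoff_Ioc (fun x => Real.sin (k * x))]
  filter_upwards [hlim, e1, e2] with k hk h1 h2
  have h3 := hk.1.const_smul k
  -- The boundary term at X_m vanishes in the limit because X_m was chosen with f(X_m) → 0; at 0 the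
  -- sine kills the other one.
  have h4 := tendsto_bdd_smul_of_norm_lt (fun i => Real.abs_sin_le_one (k * X (ns i))) hns hu
  have h5 := ((h4.const_smul (√(2 / Real.pi))).sub hk.2)
  rw [smul_zero, zero_sub] at h5
  refine tendsto_nhds_unique h3 (h5.congr fun i => ?_)
  have hpos : 0 ≤ X (ns i) := le_trans (Nat.cast_add_one_pos _).le (hX (ns i))
  have h6 := integral_deriv_smul_of_eq_prim hc (w := fun x => Real.sin (k * x))
    (w' := fun x => k * Real.cos (k * x)) (fun x => by
      have := ((hasDerivAt_id x).const_mul k).sin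
      simpa [mul_comm] using this) (by fun_prop) hpos
  simp only [mul_zero, Real.sin_zero, zero_smul, sub_zero, mul_smul, integral_smul] at h6
  simp only [Function.comp_apply]
  rw [h1, h2, smul_comm k, h6, smul_sub]

/-- `k S f = C f' + √(2/π) f(0)`. -/
lemma IsWeakDeriv.sinT {f g : L2 n} (h : IsWeakDeriv f g) {a : EuclideanSpace ℂ (Fin n)}
    (ha : HasTrace f a) :
    ∀ᵐ k ∂ν₀, k • HalfLine.sinT _ f k = HalfLine.cosT _ g k + √(2 / Real.pi) • a := by
  have hc := h.eq_trace_add_prim ha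
  obtain ⟨X, hX, hu⟩ := exists_seq_norm_lt hc
  obtain ⟨ns, hns, hlim⟩ := exists_common_subseq
    (((HalfLine.sinT _).continuous.tendsto f).comp (tendsto_cutoff_Ioc hX f))
    (((HalfLine.cosT _).continuous.tendsto g).comp (tendsto_cutoff_Ioc hX g))
  have e1 : ∀ᵐ k ∂ν₀, ∀ m, HalfLine.sinT _ (cutoff (measurableSet_Ioc (a := 0) (b := X m)) f) k
      = √(2 / Real.pi) • ∫ x in Ioc 0 (X m), Real.sin (k * x) • f x := by
    refine ae_all_iff.2 fun m => ?_
    filter_upwards [coeFn_sinT (integrable_cutoff (measurableSet_Ioc (a := 0) (b := X m))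
      (fun x hx => hx.2) f)] with k hk
    rw [hk, integral_cutoff_Ioc (fun x => Real.sin (k * x))]
  have e2 : ∀ᵐ k ∂ν₀, ∀ m, HalfLine.cosT _ (cutoff (measurableSet_Ioc (a := 0) (b := X m)) g) k
      = √(2 / Real.pi) • ∫ x in Ioc 0 (X m), Real.cos (k * x) • g x := by
    refine ae_all_iff.2 fun m => ?_
    filter_upwards [coeFn_cosT (integrable_cutoff (measurableSet_Ioc (a := 0) (b := X m))
      (fun x hx => hx.2) g)] with k hk
    rw [hk, integral_cutoff_Ioc (fun x => Real.cos (k * x))]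
  filter_upwards [hlim, e1, e2] with k hk h1 h2
  have h3 := hk.1.const_smul k
  have h4 := tendsto_bdd_smul_of_norm_lt (fun i => Real.abs_cos_le_one (k * X (ns i))) hns hu
  have h5 := (hk.2.sub (h4.const_smul (√(2 / Real.pi)))).add_const (√(2 / Real.pi) • a)
  rw [smul_zero, sub_zero] at h5
  refine tendsto_nhds_unique h3 (h5.congr fun i => ?_)
  have hpos : 0 ≤ X (ns i) := le_trans (Nat.cast_add_one_pos _).le (hX (ns i))
  -- The primitive -cos(kx) of k sin(kx) equals -1 at 0; this is where the boundary value f(0)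
  -- enters.
  have h6 := integral_deriv_smul_of_eq_prim hc (w := fun x => -Real.cos (k * x))
    (w' := fun x => k * Real.sin (k * x)) (fun x => by
      refine ((hasDerivAt_id x).const_mul k).cos.neg.congr_deriv ?_
      simp [mul_comm]) (by fun_prop) hpos
  simp only [mul_zero, Real.cos_zero, neg_smul, one_smul, sub_neg_eq_add, mul_smul, integral_smul,
    integral_neg] at h6
  simp only [Function.comp_apply]
  rw [h1, h2, smul_comm k, h6]
  module

end Derivatives

/-! ### Weak derivatives and boundary values of cosine and sine transforms. -/

section Inverse

variable {n : ℕ}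

/-- The element `x ↦ φ(x) w` of `L²` for a continuous function with compact support. -/
noncomputable def tens {φ : ℝ → ℝ} (hφ : Continuous φ) (hc : HasCompactSupport φ)
    (w : EuclideanSpace ℂ (Fin n)) : L2 n :=
  MemLp.toLp (μ := ν₀) (fun x => φ x • w) (by
    have h1 : Continuous fun x => φ x • w := hφ.smul continuous_const
    exact h1.memLp_of_hasCompactSupport hc.smul_right)

lemma coeFn_tens {φ : ℝ → ℝ} (hφ : Continuous φ) (hc : HasCompactSupport φ)
    (w : EuclideanSpace ℂ (Fin n)) : tens hφ hc w =ᵐ[ν₀] fun x => φ x • w :=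
  MemLp.coeFn_toLp _

lemma inner_tens {φ : ℝ → ℝ} (hφ : Continuous φ) (hc : HasCompactSupport φ)
    (w : EuclideanSpace ℂ (Fin n)) (f : L2 n) :
    ⟪tens hφ hc w, f⟫_ℂ = ⟪w, ∫ x in Ioi (0 : ℝ), φ x • f x⟫_ℂ := by
  rw [← integral_inner (integrable_smul_lp hφ hc f), L2.inner_def]
  apply integral_congr_ae
  filter_upwards [coeFn_tens hφ hc w] with x hx
  rw [hx, ← Complex.coe_smul, ← Complex.coe_smul, inner_smul_left, inner_smul_right,
    Complex.conj_ofReal]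

lemma isWeakDeriv_of_hasDerivAt {f g : L2 n} {u u' : ℝ → ℝ} {w : EuclideanSpace ℂ (Fin n)}
    (hu : ∀ x, HasDerivAt u (u' x) x) (hu' : Continuous u') (hf : f =ᵐ[ν₀] fun x => u x • w)
    (hg : g =ᵐ[ν₀] fun x => u' x • w) : IsWeakDeriv f g := by
  intro η hη hηc hηs
  have e1 : ∫ x in Ioi (0 : ℝ), deriv η x • f x = ∫ x in Ioi (0 : ℝ), (deriv η x * u x) • w := by
    apply integral_congr_ae
    filter_upwards [hf] with x hx
    rw [hx, smul_smul]
  have e2 : ∫ x in Ioi (0 : ℝ), η x • g x = ∫ x in Ioi (0 : ℝ), (η x * u' x) • w := by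
    apply integral_congr_ae
    filter_upwards [hg] with x hx
    rw [hx, smul_smul]
  have hz : ∀ x, x ∉ Ioi (0 : ℝ) → η x = 0 := fun x hx =>
    image_eq_zero_of_notMem_tsupport fun hx' => hx (hηs hx')
  have hz' : ∀ x, x ∉ Ioi (0 : ℝ) → deriv η x = 0 := fun x hx => by
    by_contra hne
    exact hx (hηs (support_deriv_subset hne))
  rw [e1, e2, integral_smul_const, integral_smul_const, ← neg_smul,
    setIntegral_eq_integral_of_forall_compl_eq_zero (fun x hx => by rw [hz' x hx, zero_mul]),
    setIntegral_eq_integral_of_forall_compl_eq_zero (fun x hx => by rw [hz x hx, zero_mul])]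
  congr 1
  have hdη : ∀ x, HasDerivAt η (deriv η x) x := fun x =>
    (hη.differentiable (by simp)).differentiableAt.hasDerivAt
  have c1 := hη.continuous
  have c2 := hη.continuous_deriv (by simp)
  have c3 : Continuous u := continuous_iff_continuousAt.2 fun x => (hu x).continuousAt
  have := integral_mul_deriv_eq_deriv_mul_of_integrable (fun x _ => hdη x) (fun x _ => hu x)
    ((c1.mul hu').integrable_of_hasCompactSupport hηc.mul_right)
    ((c2.mul c3).integrable_of_hasCompactSupport hηc.deriv.mul_right)
    ((c1.mul c3).integrable_of_hasCompactSupport hηc.mul_right)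
  rw [this, neg_neg]

lemma isWeakDeriv_tens {φ : ℝ → ℝ} (hφ : ContDiff ℝ ∞ φ) (hc : HasCompactSupport φ)
    (w : EuclideanSpace ℂ (Fin n)) :
    IsWeakDeriv (tens hφ.continuous hc w)
      (tens (hφ.continuous_deriv (by simp)) hc.deriv w) :=
  isWeakDeriv_of_hasDerivAt
    (fun x => (hφ.differentiable (by simp)).differentiableAt.hasDerivAt)
    (hφ.continuous_deriv (by simp)) (coeFn_tens _ _ _) (coeFn_tens _ _ _)

lemma hasTrace_tens {φ : ℝ → ℝ} (hφ : Continuous φ) (hc : HasCompactSupport φ)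
    (w : EuclideanSpace ℂ (Fin n)) : HasTrace (tens hφ hc w) (φ 0 • w) :=
  ⟨fun x => φ x • w, (hφ.smul continuous_const).continuousOn, coeFn_tens hφ hc w, rfl⟩

/-- Pairing with the L² vectors φ(x) w lets selfadjointness move C and S onto test functions, for
which the transform of the derivative is already known. -/
lemma isWeakDeriv_of_inner {f g : L2 n}
    (h : ∀ (φ : ℝ → ℝ) (hφ : ContDiff ℝ ∞ φ) (hc : HasCompactSupport φ),
      tsupport φ ⊆ Ioi (0 : ℝ) → ∀ w : EuclideanSpace ℂ (Fin n),
      ⟪tens (hφ.continuous_deriv (by simp)) hc.deriv w, f⟫_ℂ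
        = -⟪tens hφ.continuous hc w, g⟫_ℂ) : IsWeakDeriv f g := by
  intro φ hφ hc hs
  refine ext_inner_left ℂ fun w => ?_
  have := h φ hφ hc hs w
  rw [inner_tens, inner_tens] at this
  rw [this, inner_neg_right]

lemma zero_of_tsupport_subset {φ : ℝ → ℝ} (hs : tsupport φ ⊆ Ioi (0 : ℝ)) : φ 0 = 0 :=
  image_eq_zero_of_notMem_tsupport fun h => lt_irrefl (0 : ℝ) (hs h)

/-- `(C h)' = -S (k h)`. -/
lemma isWeakDeriv_cosT {h h' : L2 n} (hh : ∀ᵐ k ∂ν₀, h' k = k • h k) :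
    IsWeakDeriv (cosT _ h) (-sinT _ h') := by
  refine isWeakDeriv_of_inner fun φ hφ hc hs w => ?_
  -- This is k S φ = C φ' + √(2/π) φ(0), and φ(0) = 0 for a test function on (0, ∞). The claim is
  -- its dual.
  have key := (isWeakDeriv_tens hφ hc w).sinT (hasTrace_tens hφ.continuous hc w)
  rw [zero_of_tsupport_subset hs, zero_smul] at key
  rw [inner_neg_right, neg_neg, ← inner_cosT, ← inner_sinT, L2.inner_def, L2.inner_def]
  apply integral_congr_ae
  filter_upwards [key, hh] with k h1 h2
  rw [smul_zero, add_zero] at h1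
  rw [← h1, h2, ← Complex.coe_smul, ← Complex.coe_smul, inner_smul_left, inner_smul_right,
    Complex.conj_ofReal]

/-- `(S h)' = C (k h)`. -/
lemma isWeakDeriv_sinT {h h' : L2 n} (hh : ∀ᵐ k ∂ν₀, h' k = k • h k) :
    IsWeakDeriv (sinT _ h) (cosT _ h') := by
  refine isWeakDeriv_of_inner fun φ hφ hc hs w => ?_
  have key := (isWeakDeriv_tens hφ hc w).cosT
  rw [← inner_sinT, ← inner_cosT, L2.inner_def, L2.inner_def, ← integral_neg]
  apply integral_congr_ae
  filter_upwards [key, hh] with k h1 h2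
  rw [h2, ← neg_eq_iff_eq_neg.2 h1, ← Complex.coe_smul, ← Complex.coe_smul, inner_neg_left,
    inner_smul_left, inner_smul_right, Complex.conj_ofReal]

/-- With t = ‖h(k)‖, completing the square gives t ≤ (1 + k²) t² + (1 + k²)⁻¹/4, and both terms are
integrable. It makes the boundary values of C h and S h meaningful. -/
lemma integrable_of_mul {h h' : L2 n} (hh : ∀ᵐ k ∂ν₀, h' k = k • h k) : Integrable h ν₀ := by
  have h1 : Integrable (fun k : ℝ => (1 + k ^ 2)⁻¹ + (‖h k‖ ^ 2 + ‖h' k‖ ^ 2)) ν₀ :=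
    integrable_inv_one_add_sq.restrict.add ((integrable_norm_sq h).add (integrable_norm_sq h'))
  refine h1.mono' (Lp.memLp h).1 ?_
  filter_upwards [hh] with k hk
  have h2 : ‖h' k‖ ^ 2 = k ^ 2 * ‖h k‖ ^ 2 := by
    rw [hk, norm_smul, mul_pow, Real.norm_eq_abs, sq_abs]
  rw [h2]
  set t := ‖h k‖
  have h3 : 0 < 1 + k ^ 2 := by positivity
  have h4 : (1 + k ^ 2)⁻¹ * (1 + k ^ 2) = 1 := inv_mul_cancel₀ h3.ne'
  have h5 : 0 < (1 + k ^ 2)⁻¹ := inv_pos.2 h3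
  have h6 : 0 ≤ (1 + k ^ 2)⁻¹ * ((1 + k ^ 2) * t - 1 / 2) ^ 2 := by positivity
  have h7 : (1 + k ^ 2)⁻¹ * ((1 + k ^ 2) * t - 1 / 2) ^ 2
      = (t ^ 2 + k ^ 2 * t ^ 2) - t + (1 + k ^ 2)⁻¹ / 4 := by
    linear_combination ((1 + k ^ 2) * t ^ 2 - t) * h4
  linarith

/-- `(C h)(0) = √(2/π) ∫ h`. -/
lemma hasTrace_cosT {h : L2 n} (hh : Integrable h ν₀) :
    HasTrace (cosT _ h) (√(2 / Real.pi) • ∫ k, h k ∂ν₀) := by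
  refine ⟨fun x => √(2 / Real.pi) • ∫ k, ((Real.cos (x * k) : ℝ) : ℂ) • h k ∂ν₀, ?_,
    coeFn_cosT hh, by simp⟩
  apply Continuous.continuousOn
  have hcont : Continuous fun x : ℝ => ∫ k, ((Real.cos (x * k) : ℝ) : ℂ) • h k ∂ν₀ := ?_
  · fun_prop
  refine continuous_of_dominated (bound := fun k => ‖h k‖)
    (fun x => (integrable_smul_cos hh x).1) (fun x => ae_of_all _ fun k => ?_) hh.norm
    (ae_of_all _ fun k => by fun_prop)
  rw [norm_smul, Complex.norm_real]
  exact mul_le_of_le_one_left (norm_nonneg _) (Real.abs_cos_le_one _)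

/-- `(S h)(0) = 0`. -/
lemma hasTrace_sinT {h : L2 n} (hh : Integrable h ν₀) : HasTrace (sinT _ h) 0 := by
  refine ⟨fun x => √(2 / Real.pi) • ∫ k, ((Real.sin (x * k) : ℝ) : ℂ) • h k ∂ν₀, ?_,
    coeFn_sinT hh, by simp⟩
  apply Continuous.continuousOn
  have hcont : Continuous fun x : ℝ => ∫ k, ((Real.sin (x * k) : ℝ) : ℂ) • h k ∂ν₀ := ?_
  · fun_prop
  refine continuous_of_dominated (bound := fun k => ‖h k‖)
    (fun x => (integrable_smul_sin hh x).1) (fun x => ae_of_all _ fun k => ?_) hh.norm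
    (ae_of_all _ fun k => by fun_prop)
  rw [norm_smul, Complex.norm_real]
  exact mul_le_of_le_one_left (norm_nonneg _) (Real.abs_sin_le_one _)

/-- `k C S h = -S C (k h)`. -/
lemma mul_cosT_sinT {h h' : L2 n} (hh : ∀ᵐ k ∂ν₀, h' k = k • h k) :
    ∀ᵐ k ∂ν₀, k • cosT _ (sinT _ h) k = -(sinT _ (cosT _ h') k) :=
  (isWeakDeriv_sinT hh).cosT

end Inverse

/-! ### The coefficient matrices c(k), s(k) and the generalized Fourier map. -/

section Matrices

variable {n : ℕ}

lemma act_mul (M N : Matrix (Fin n) (Fin n) ℂ) (v : EuclideanSpace ℂ (Fin n)) :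
    act (M * N) v = act M (act N v) := by simp [act, map_mul]

lemma act_one (v : EuclideanSpace ℂ (Fin n)) : act (1 : Matrix (Fin n) (Fin n) ℂ) v = v := by
  simp [act, map_one]

lemma act_add_left (M N : Matrix (Fin n) (Fin n) ℂ) (v : EuclideanSpace ℂ (Fin n)) :
    act (M + N) v = act M v + act N v := by simp [act, map_add]

lemma act_smul_left (c : ℂ) (M : Matrix (Fin n) (Fin n) ℂ) (v : EuclideanSpace ℂ (Fin n)) :
    act (c • M) v = c • act M v := by simp [act, map_smul]

lemma inner_act (M : Matrix (Fin n) (Fin n) ℂ) (v w : EuclideanSpace ℂ (Fin n)) :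
    ⟪act M v, w⟫_ℂ = ⟪v, act Mᴴ w⟫_ℂ := by
  have h : Matrix.toEuclideanCLM (n := Fin n) (𝕜 := ℂ) Mᴴ
      = ContinuousLinearMap.adjoint (Matrix.toEuclideanCLM (n := Fin n) (𝕜 := ℂ) M) := by
    rw [← Matrix.star_eq_conjTranspose, map_star]; rfl
  rw [act, act, h, ContinuousLinearMap.adjoint_inner_right]

lemma continuous_toEuclideanCLM : Continuous (fun M : Matrix (Fin n) (Fin n) ℂ =>
    (Matrix.toEuclideanCLM (n := Fin n) (𝕜 := ℂ) M)) :=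
  LinearMap.continuous_of_finiteDimensional
    { toFun := fun M : Matrix (Fin n) (Fin n) ℂ => Matrix.toEuclideanCLM (n := Fin n) (𝕜 := ℂ) M
      map_add' := map_add _
      map_smul' := map_smul _ }

/-- The multiplier given by a matrix valued function. -/
noncomputable def matFun (M : ℝ → Matrix (Fin n) (Fin n) ℂ) (k : ℝ) :
    EuclideanSpace ℂ (Fin n) →L[ℂ] EuclideanSpace ℂ (Fin n) :=
  Matrix.toEuclideanCLM (n := Fin n) (𝕜 := ℂ) (M k)

lemma memLp_matFun {M : ℝ → Matrix (Fin n) (Fin n) ℂ} (hM : ContinuousOn M (Ioi 0)) (C : ℝ)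
    (hC : 0 ≤ C) (hb : ∀ k, 0 < k → ∀ v, ‖act (M k) v‖ ≤ C * ‖v‖) : MemLp (matFun M) ∞ ν₀ := by
  refine memLp_top_of_bound ((continuous_toEuclideanCLM.comp_continuousOn hM).aestronglyMeasurable
    measurableSet_Ioi) C ?_
  filter_upwards [ae_restrict_mem measurableSet_Ioi] with k hk
  exact ContinuousLinearMap.opNorm_le_bound _ hC (hb k hk)

/-- J⁻¹ by itself may be unbounded near k = 0, when B is singular. On an interval [a, b] with a > 0
continuity and compactness bound it. -/
lemma memLp_matFun_indicator {M : ℝ → Matrix (Fin n) (Fin n) ℂ} (hM : ContinuousOn M (Ioi 0))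
    {a : ℝ} (ha : 0 < a) (b : ℝ) : MemLp (matFun ((Icc a b).indicator M)) ∞ ν₀ := by
  have hc : ContinuousOn (matFun M) (Ioi 0) := continuous_toEuclideanCLM.comp_continuousOn hM
  have hs : Icc a b ⊆ Ioi 0 := fun x hx => ha.trans_le hx.1
  have h1 : matFun ((Icc a b).indicator M) = (Icc a b).indicator (matFun M) := by
    ext1 k
    by_cases h : k ∈ Icc a b
    · simp only [matFun, indicator_of_mem h]
    · simp only [matFun, indicator_of_notMem h, map_zero]
  obtain ⟨C, hC⟩ := isCompact_Icc.exists_bound_of_continuousOn (hc.mono hs)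
  rw [h1]
  refine memLp_top_of_bound ((hc.aestronglyMeasurable measurableSet_Ioi).indicator
    measurableSet_Icc) (max C 0) (ae_of_all _ fun k => ?_)
  by_cases h : k ∈ Icc a b
  · rw [indicator_of_mem h]; exact (hC k h).trans (le_max_left _ _)
  · rw [indicator_of_notMem h, norm_zero]; exact le_max_right _ _

variable (A B : Matrix (Fin n) (Fin n) ℂ) (σ : ℝ)

/-- The coefficient of `cos(kx)` in the physical solution. -/
noncomputable def cosCoeff (k : ℝ) : Matrix (Fin n) (Fin n) ℂ :=
  (Complex.I * σ * k) • (A * (jost A B (-σ * k))⁻¹)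

/-- The coefficient of `sin(kx)` in the physical solution. -/
noncomputable def sinCoeff (k : ℝ) : Matrix (Fin n) (Fin n) ℂ :=
  (Complex.I * σ) • (B * (jost A B (-σ * k))⁻¹)

lemma mul_sinc (k x : ℝ) : k * (x * Real.sinc (k * x)) = Real.sin (k * x) := by
  by_cases h : k * x = 0
  · rw [h, Real.sin_zero, ← mul_assoc, h, zero_mul]
  · rw [Real.sinc_of_ne_zero h, ← mul_assoc, mul_div_cancel₀ _ h]

variable {A B σ}

/-- Cosine and sinc are even, so the sign affects only the prefactor and J. The factor k of the
prefactor turns x sinc(kx) into sin(kx), which leaves a sine coefficient without k. -/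
lemma physicalSolSigned_eq (hσ : σ = 1 ∨ σ = -1) (k x : ℝ) :
    physicalSolSigned A B σ k x = ((Real.cos (k * x) : ℝ) : ℂ) • cosCoeff A B σ k
      + ((Real.sin (k * x) : ℝ) : ℂ) • sinCoeff A B σ k := by
  have h1 : Real.cos (-σ * k * x) = Real.cos (k * x) := by
    rcases hσ with rfl | rfl <;> simp
  have h2 : Real.sinc (-σ * k * x) = Real.sinc (k * x) := by
    rcases hσ with rfl | rfl <;> simp [Real.sinc_neg]
  have h3 : ((Real.sin (k * x) : ℝ) : ℂ) = k * ((x * Real.sinc (k * x) : ℝ) : ℂ) := by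
    rw [← mul_sinc]; push_cast; ring
  rw [physicalSolSigned, physicalSol, regularSol, h1, h2, h3, cosCoeff, sinCoeff, add_mul,
    smul_add, Matrix.smul_mul, Matrix.smul_mul, smul_smul, smul_smul, smul_smul, smul_smul]
  congr 2 <;> · push_cast; ring

variable (hAB : -(Bᴴ * A) + Aᴴ * B = 0) (hpos : (Aᴴ * A + Bᴴ * B).PosDef)
  (hσ : σ = 1 ∨ σ = -1)

include hAB in
lemma conj_mul_comm : Aᴴ * B = Bᴴ * A := by
  rw [neg_add_eq_zero] at hAB; exact hAB.symm

include hσ in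
lemma sq_sign : (σ : ℂ) * σ = 1 := by
  rcases hσ with rfl | rfl <;> simp

include hAB hσ in
-- With J = B + iσkA the mixed terms are iσk(B†A - A†B), which is zero by the condition on A and B.
lemma jost_conj_mul_self (k : ℝ) :
    (jost A B (-σ * k))ᴴ * jost A B (-σ * k) = Bᴴ * B + ((k : ℂ) ^ 2) • (Aᴴ * A) := by
  have hs := sq_sign hσ
  have h := conj_mul_comm hAB
  have e : jost A B (-σ * k) = B + (Complex.I * σ * k) • A := by
    rw [jost, sub_eq_add_neg, ← neg_smul]; congr 2; push_cast; ring
  have e2 : star (Complex.I * σ * k) = -(Complex.I * σ * k) := by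
    simp
  rw [e, Matrix.conjTranspose_add, Matrix.conjTranspose_smul, e2, add_mul, mul_add, mul_add,
    Matrix.smul_mul, Matrix.smul_mul, Matrix.mul_smul, Matrix.mul_smul, h, smul_smul, neg_smul]
  have e3 : -(Complex.I * σ * k) * (Complex.I * σ * k) = (k : ℂ) ^ 2 := by
    linear_combination (-(σ * σ * k ^ 2 : ℂ)) * Complex.I_mul_I + (k : ℂ) ^ 2 * hs
  rw [e3]
  abel

include hAB hpos hσ in
-- For m = min(1, k²) > 0 the matrix J†J = B†B + k²A†A is bounded below by m(A†A + B†B), which is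
-- positive definite.
lemma isUnit_det_jost {k : ℝ} (hk : k ≠ 0) : IsUnit (jost A B (-σ * k)).det := by
  have h1 : (Bᴴ * B + ((k : ℂ) ^ 2) • (Aᴴ * A)).PosDef := by
    set m : ℝ := min 1 (k ^ 2) with hm
    have hm0 : 0 < m := lt_min one_pos (by positivity)
    have e : Bᴴ * B + ((k : ℂ) ^ 2) • (Aᴴ * A) = (m : ℂ) • (Aᴴ * A + Bᴴ * B)
        + (((1 - m : ℝ) : ℂ) • (Bᴴ * B) + ((k ^ 2 - m : ℝ) : ℂ) • (Aᴴ * A)) := by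
      push_cast; module
    rw [e]
    have p1 : (0 : ℂ) < (m : ℂ) := by exact_mod_cast hm0
    have p2 : (0 : ℂ) ≤ ((1 - m : ℝ) : ℂ) := by
      have : 0 ≤ 1 - m := sub_nonneg.2 (min_le_left _ _)
      exact_mod_cast this
    have p3 : (0 : ℂ) ≤ ((k ^ 2 - m : ℝ) : ℂ) := by
      have : 0 ≤ k ^ 2 - m := sub_nonneg.2 (min_le_right _ _)
      exact_mod_cast this
    exact (hpos.smul p1).add_posSemidef
      (((Matrix.posSemidef_conjTranspose_mul_self B).smul p2).add
        ((Matrix.posSemidef_conjTranspose_mul_self A).smul p3))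
  rw [← jost_conj_mul_self hAB hσ] at h1
  have h2 := h1.isUnit
  rw [Matrix.isUnit_iff_isUnit_det, Matrix.det_mul] at h2
  exact isUnit_of_mul_isUnit_right h2

include hAB hpos hσ in
lemma continuousOn_jost_inv : ContinuousOn (fun k : ℝ => (jost A B (-σ * k))⁻¹) (Ioi 0) := by
  have hc : Continuous (fun k : ℝ => jost A B (-σ * k)) := by
    unfold jost
    have h1 : Continuous fun k : ℝ => Complex.I * ((-σ * k : ℝ) : ℂ) := by fun_prop
    exact continuous_const.sub (h1.smul continuous_const)
  simp only [Matrix.inv_def, Ring.inverse_eq_inv']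
  refine ContinuousOn.smul (ContinuousOn.inv₀ hc.matrix_det.continuousOn fun k hk => ?_)
    hc.matrix_adjugate.continuousOn
  exact (isUnit_det_jost hAB hpos hσ (ne_of_gt hk)).ne_zero

include hAB hpos hσ in
-- The left side is (J⁻¹)†(k²A†A + B†B)J⁻¹, and the inner matrix is J†J.
lemma coeff_isometry {k : ℝ} (hk : k ≠ 0) :
    (cosCoeff A B σ k)ᴴ * cosCoeff A B σ k + (sinCoeff A B σ k)ᴴ * sinCoeff A B σ k = 1 := by
  have hs := sq_sign hσ
  have hu := isUnit_det_jost hAB hpos hσ hk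
  have hJ := jost_conj_mul_self hAB hσ k
  set J := jost A B (-σ * k) with hJdef
  have e1 : star (Complex.I * σ * k) * (Complex.I * σ * k) = (k : ℂ) ^ 2 := by
    simp only [star_mul', RCLike.star_def, Complex.conj_I, Complex.conj_ofReal]
    linear_combination (-(σ * σ * k ^ 2 : ℂ)) * Complex.I_mul_I + (k : ℂ) ^ 2 * hs
  have e2 : star (Complex.I * (σ : ℂ)) * (Complex.I * σ) = 1 := by
    simp only [star_mul', RCLike.star_def, Complex.conj_I, Complex.conj_ofReal]
    linear_combination (-(σ * σ : ℂ)) * Complex.I_mul_I + hs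
  rw [cosCoeff, sinCoeff, ← hJdef, Matrix.conjTranspose_smul, Matrix.conjTranspose_smul,
    Matrix.smul_mul, Matrix.smul_mul, Matrix.mul_smul, Matrix.mul_smul, smul_smul, smul_smul,
    e1, e2, one_smul, Matrix.conjTranspose_mul, Matrix.conjTranspose_mul]
  calc ((k : ℂ) ^ 2) • ((J⁻¹)ᴴ * Aᴴ * (A * J⁻¹)) + (J⁻¹)ᴴ * Bᴴ * (B * J⁻¹)
      = (J⁻¹)ᴴ * (Bᴴ * B + ((k : ℂ) ^ 2) • (Aᴴ * A)) * J⁻¹ := by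
        simp only [mul_add, add_mul, Matrix.mul_smul, Matrix.smul_mul, Matrix.mul_assoc]
        abel
    _ = 1 := by
        rw [← hJ, ← Matrix.mul_assoc, ← Matrix.conjTranspose_mul, Matrix.mul_nonsing_inv _ hu,
          Matrix.conjTranspose_one, Matrix.one_mul, Matrix.mul_nonsing_inv _ hu]

include hAB hpos hσ in
-- Each coefficient is thus a contraction uniformly in k, although J⁻¹ need not be bounded near 0;
-- so both define bounded multipliers.
lemma norm_coeff_sq {k : ℝ} (hk : k ≠ 0) (v : EuclideanSpace ℂ (Fin n)) :
    ‖act (cosCoeff A B σ k) v‖ ^ 2 + ‖act (sinCoeff A B σ k) v‖ ^ 2 = ‖v‖ ^ 2 := by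
  have h := coeff_isometry hAB hpos hσ hk
  have h1 : ⟪v, act ((cosCoeff A B σ k)ᴴ * cosCoeff A B σ k
      + (sinCoeff A B σ k)ᴴ * sinCoeff A B σ k) v⟫_ℂ = ⟪v, v⟫_ℂ := by rw [h, act_one]
  rw [act_add_left, act_mul, act_mul, inner_add_right, ← inner_act, ← inner_act,
    inner_self_eq_norm_sq_to_K, inner_self_eq_norm_sq_to_K, inner_self_eq_norm_sq_to_K] at h1
  exact_mod_cast h1

lemma norm_act_conjTranspose_le {M : Matrix (Fin n) (Fin n) ℂ} (h : ∀ v, ‖act M v‖ ≤ ‖v‖)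
    (v : EuclideanSpace ℂ (Fin n)) : ‖act Mᴴ v‖ ≤ ‖v‖ := by
  have h1 : ‖act Mᴴ v‖ ^ 2 ≤ ‖act Mᴴ v‖ * ‖v‖ := by
    have h2 : ⟪act Mᴴ v, act Mᴴ v⟫_ℂ = ⟪act M (act Mᴴ v), v⟫_ℂ := by
      rw [inner_act M]
    have h3 : (((‖act Mᴴ v‖ ^ 2 : ℝ)) : ℂ) = ⟪act M (act Mᴴ v), v⟫_ℂ := by
      rw [← h2, inner_self_eq_norm_sq_to_K]; norm_cast
    have h4 := norm_inner_le_norm (𝕜 := ℂ) (act M (act Mᴴ v)) v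
    rw [← h3, Complex.norm_real, Real.norm_of_nonneg (sq_nonneg _)] at h4
    exact h4.trans (by gcongr; exact h _)
  rcases eq_or_lt_of_le (norm_nonneg (act Mᴴ v)) with h0 | h0
  · rw [← h0]; exact norm_nonneg _
  · rw [sq] at h1
    exact le_of_mul_le_mul_left h1 h0

include hAB hpos hσ in
lemma norm_cosCoeff_le {k : ℝ} (hk : k ≠ 0) (v : EuclideanSpace ℂ (Fin n)) :
    ‖act (cosCoeff A B σ k) v‖ ≤ ‖v‖ := by
  have := norm_coeff_sq hAB hpos hσ hk v
  refine (sq_le_sq₀ (norm_nonneg _) (norm_nonneg _)).1 ?_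
  linarith [sq_nonneg ‖act (sinCoeff A B σ k) v‖]

include hAB hpos hσ in
lemma norm_sinCoeff_le {k : ℝ} (hk : k ≠ 0) (v : EuclideanSpace ℂ (Fin n)) :
    ‖act (sinCoeff A B σ k) v‖ ≤ ‖v‖ := by
  have := norm_coeff_sq hAB hpos hσ hk v
  refine (sq_le_sq₀ (norm_nonneg _) (norm_nonneg _)).1 ?_
  linarith [sq_nonneg ‖act (cosCoeff A B σ k) v‖]

include hAB hpos hσ in
lemma continuousOn_cosCoeff : ContinuousOn (cosCoeff A B σ) (Ioi 0) := by
  have h1 : Continuous fun k : ℝ => Complex.I * σ * k := by fun_prop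
  exact h1.continuousOn.smul
    (continuousOn_const.mul (continuousOn_jost_inv hAB hpos hσ))

include hAB hpos hσ in
lemma continuousOn_sinCoeff : ContinuousOn (sinCoeff A B σ) (Ioi 0) := by
  exact (continuousOn_const (c := Complex.I * (σ : ℂ))).smul
    (continuousOn_const.mul (continuousOn_jost_inv hAB hpos hσ))

include hAB hpos hσ in
lemma memLp_cosCoeff : MemLp (matFun (cosCoeff A B σ)) ∞ ν₀ :=
  memLp_matFun (continuousOn_cosCoeff hAB hpos hσ) 1 zero_le_one fun _ hk v => by
    rw [one_mul]; exact norm_cosCoeff_le hAB hpos hσ hk.ne' v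

include hAB hpos hσ in
lemma memLp_sinCoeff : MemLp (matFun (sinCoeff A B σ)) ∞ ν₀ :=
  memLp_matFun (continuousOn_sinCoeff hAB hpos hσ) 1 zero_le_one fun _ hk v => by
    rw [one_mul]; exact norm_sinCoeff_le hAB hpos hσ hk.ne' v

include hAB hpos hσ in
lemma memLp_cosCoeff_conj : MemLp (matFun fun k => (cosCoeff A B σ k)ᴴ) ∞ ν₀ :=
  memLp_matFun (continuous_id.matrix_conjTranspose.comp_continuousOn
    (continuousOn_cosCoeff hAB hpos hσ)) 1 zero_le_one fun _ hk v => by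
    rw [one_mul]; exact norm_act_conjTranspose_le (norm_cosCoeff_le hAB hpos hσ hk.ne') v

include hAB hpos hσ in
lemma memLp_sinCoeff_conj : MemLp (matFun fun k => (sinCoeff A B σ k)ᴴ) ∞ ν₀ :=
  memLp_matFun (continuous_id.matrix_conjTranspose.comp_continuousOn
    (continuousOn_sinCoeff hAB hpos hσ)) 1 zero_le_one fun _ hk v => by
    rw [one_mul]; exact norm_act_conjTranspose_le (norm_sinCoeff_le hAB hpos hσ hk.ne') v

/-! ### The generalized Fourier maps -/

/-- The generalized Fourier map. -/
noncomputable def fourierMap : L2 n →L[ℂ] L2 n :=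
  mulOp _ (memLp_cosCoeff_conj hAB hpos hσ) ∘L cosT _
    + mulOp _ (memLp_sinCoeff_conj hAB hpos hσ) ∘L sinT _

/-- The adjoint of the generalized Fourier map. -/
noncomputable def fourierAdj : L2 n →L[ℂ] L2 n :=
  cosT _ ∘L mulOp _ (memLp_cosCoeff hAB hpos hσ)
    + sinT _ ∘L mulOp _ (memLp_sinCoeff hAB hpos hσ)

lemma coeFn_fourierMap (f : L2 n) : fourierMap hAB hpos hσ f =ᵐ[ν₀] fun k =>
    act (cosCoeff A B σ k)ᴴ (cosT _ f k) + act (sinCoeff A B σ k)ᴴ (sinT _ f k) := by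
  filter_upwards [coeFn_mulOp (memLp_cosCoeff_conj hAB hpos hσ) (cosT _ f),
    coeFn_mulOp (memLp_sinCoeff_conj hAB hpos hσ) (sinT _ f),
    Lp.coeFn_add (mulOp _ (memLp_cosCoeff_conj hAB hpos hσ) (cosT _ f))
      (mulOp _ (memLp_sinCoeff_conj hAB hpos hσ) (sinT _ f))] with k h1 h2 h3
  exact h3.trans (congrArg₂ (· + ·) h1 h2)

lemma fourierAdj_apply (f : L2 n) : fourierAdj hAB hpos hσ f
    = cosT _ (mulOp _ (memLp_cosCoeff hAB hpos hσ) f)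
      + sinT _ (mulOp _ (memLp_sinCoeff hAB hpos hσ) f) := rfl

lemma adjoint_fourierMap :
    ContinuousLinearMap.adjoint (fourierMap hAB hpos hσ) = fourierAdj hAB hpos hσ := by
  symm
  rw [ContinuousLinearMap.eq_adjoint_iff]
  intro f g
  rw [fourierAdj_apply, inner_add_left, inner_cosT, inner_sinT,
    inner_mulOp (memLp_cosCoeff hAB hpos hσ) (memLp_cosCoeff_conj hAB hpos hσ)
      (ae_of_all _ fun k => inner_act _),
    inner_mulOp (memLp_sinCoeff hAB hpos hσ) (memLp_sinCoeff_conj hAB hpos hσ)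
      (ae_of_all _ fun k => inner_act _), ← inner_add_right]
  rfl

lemma isFourierMap_fourierMap : IsFourierMap A B σ (fourierMap hAB hpos hσ) := by
  intro f hf
  filter_upwards [coeFn_fourierMap hAB hpos hσ f, coeFn_cosT hf, coeFn_sinT hf] with k h1 h2 h3
  rw [h1, h2, h3, ← Complex.coe_smul, ← Complex.coe_smul, ← Complex.coe_smul, act, act, map_smul,
    map_smul, ← smul_add, ← ContinuousLinearMap.integral_comp_comm _ (integrable_smul_cos hf k),
    ← ContinuousLinearMap.integral_comp_comm _ (integrable_smul_sin hf k),
    ← integral_add (ContinuousLinearMap.integrable_comp _ (integrable_smul_cos hf k))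
      (ContinuousLinearMap.integrable_comp _ (integrable_smul_sin hf k))]
  congr 2
  ext1 x
  rw [physicalSolSigned_eq hσ, Matrix.conjTranspose_add, Matrix.conjTranspose_smul,
    Matrix.conjTranspose_smul, act_add_left, act_smul_left, act_smul_left, map_smul, map_smul,
    RCLike.star_def, Complex.conj_ofReal, Complex.conj_ofReal]

lemma integrable_mulOp {M : ℝ → EuclideanSpace ℂ (Fin n) →L[ℂ] EuclideanSpace ℂ (Fin n)}
    (hM : MemLp M ∞ ν₀) {f : L2 n} (hf : Integrable f ν₀) : Integrable (mulOp M hM f) ν₀ := by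
  refine Integrable.congr ?_ (coeFn_mulOp hM f).symm
  have h1 : MemLp f 1 ν₀ := memLp_one_iff_integrable.2 hf
  exact memLp_one_iff_integrable.1
    ((ContinuousLinearMap.id ℂ (EuclideanSpace ℂ (Fin n) →L[ℂ] EuclideanSpace ℂ (Fin n))).memLp_of_bilin
      1 hM h1)

lemma coeFn_fourierAdj_of_integrable {f : L2 n} (hf : Integrable f ν₀) :
    fourierAdj hAB hpos hσ f =ᵐ[ν₀] fun x =>
      √(2 / Real.pi) • ∫ k in Ioi (0 : ℝ), act (physicalSolSigned A B σ k x) (f k) := by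
  have i1 := integrable_mulOp (memLp_cosCoeff hAB hpos hσ) hf
  have i2 := integrable_mulOp (memLp_sinCoeff hAB hpos hσ) hf
  filter_upwards [Lp.coeFn_add (cosT _ (mulOp _ (memLp_cosCoeff hAB hpos hσ) f))
    (sinT _ (mulOp _ (memLp_sinCoeff hAB hpos hσ) f)), coeFn_cosT i1, coeFn_sinT i2]
    with x h1 h2 h3
  rw [fourierAdj_apply, h1, Pi.add_apply, h2, h3, ← smul_add,
    ← integral_add (integrable_smul_cos i1 x) (integrable_smul_sin i2 x)]
  congr 1
  apply integral_congr_ae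
  filter_upwards [coeFn_mulOp (memLp_cosCoeff hAB hpos hσ) f,
    coeFn_mulOp (memLp_sinCoeff hAB hpos hσ) f] with k h4 h5
  rw [h4, h5, physicalSolSigned_eq hσ, act_add_left, act_smul_left, act_smul_left, mul_comm x k]
  rfl

end Matrices

/-! ### F F† = 1, and F intertwines H with multiplication by k². -/

section Intertwining

variable {n : ℕ} {A B : Matrix (Fin n) (Fin n) ℂ} {σ : ℝ}
  (hAB : -(Bᴴ * A) + Aᴴ * B = 0) (hpos : (Aᴴ * A + Bᴴ * B).PosDef) (hσ : σ = 1 ∨ σ = -1)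

lemma cosCoeff_conj (k : ℝ) : (cosCoeff A B σ k)ᴴ
    = (-(Complex.I * σ * k)) • (((jost A B (-σ * k))⁻¹)ᴴ * Aᴴ) := by
  rw [cosCoeff, Matrix.conjTranspose_smul, Matrix.conjTranspose_mul]
  congr 1
  simp

lemma sinCoeff_conj (k : ℝ) : (sinCoeff A B σ k)ᴴ
    = (-(Complex.I * σ)) • (((jost A B (-σ * k))⁻¹)ᴴ * Bᴴ) := by
  rw [sinCoeff, Matrix.conjTranspose_smul, Matrix.conjTranspose_mul]
  congr 1
  simp

/-- The Fourier map in terms of the cosine and sine transforms. -/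
lemma coeFn_fourierMap' (f : L2 n) : fourierMap hAB hpos hσ f =ᵐ[ν₀] fun k =>
    (-(Complex.I * σ)) • act ((jost A B (-σ * k))⁻¹)ᴴ
      (act Aᴴ ((k : ℂ) • cosT _ f k) + act Bᴴ (sinT _ f k)) := by
  filter_upwards [coeFn_fourierMap hAB hpos hσ f] with k hk
  rw [hk, cosCoeff_conj, sinCoeff_conj, act_smul_left, act_smul_left, act_mul, act_mul]
  simp only [act, map_smul, map_add, smul_add, smul_smul]
  congr 2
  ring

/-- Constant matrices commute with C and S, so k C S u = -S C v leaves (-M†N + N†M) S C v, and this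
vanishes. It is the cancellation of the cross terms in F F†. -/
lemma matrix_cross_eq_zero {M N : Matrix (Fin n) (Fin n) ℂ} (h : Mᴴ * N = Nᴴ * M)
    {u v : L2 n} (huv : ∀ᵐ k ∂ν₀, v k = k • u k) :
    ∀ᵐ k : ℝ ∂ν₀, act Mᴴ ((k : ℂ) • cosT _ (sinT _ (constOp (Matrix.toEuclideanCLM (n := Fin n)
        (𝕜 := ℂ) N) u)) k)
      + act Nᴴ (sinT _ (cosT _ (constOp (Matrix.toEuclideanCLM (n := Fin n) (𝕜 := ℂ) M) v)) k)
        = 0 := by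
  rw [sinT_constOp, cosT_constOp, cosT_constOp, sinT_constOp]
  filter_upwards [mul_cosT_sinT huv,
    coeFn_constOp (Matrix.toEuclideanCLM (n := Fin n) (𝕜 := ℂ) N) (cosT _ (sinT _ u)),
    coeFn_constOp (Matrix.toEuclideanCLM (n := Fin n) (𝕜 := ℂ) M) (sinT _ (cosT _ v))]
    with k h1 h2 h3
  rw [h2, h3, ← map_smul, Complex.coe_smul, h1, map_neg, act, map_neg]
  change -(act Mᴴ (act N _)) + act Nᴴ (act M _) = 0
  rw [← act_mul, ← act_mul, h, neg_add_cancel]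

/-- `F F† = 1`. -/
lemma fourierMap_fourierAdj (f : L2 n) :
    fourierMap hAB hpos hσ (fourierAdj hAB hpos hσ f) = f := by
  -- For f supported in [a, b] both u = J⁻¹f and v = k J⁻¹f are square integrable, and c f = iσ A v,
  -- s f = iσ B u. Without the cutoff J⁻¹f need not be in L².
  have key : ∀ (a b : ℝ), 0 < a → ∀ f : L2 n,
      fourierMap hAB hpos hσ (fourierAdj hAB hpos hσ (cutoff (measurableSet_Icc (a := a) (b := b)) f))
        = cutoff (measurableSet_Icc (a := a) (b := b)) f := by
    intro a b ha f
    set fN := cutoff (measurableSet_Icc (a := a) (b := b)) f with hfN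
    have hJc := continuousOn_jost_inv hAB hpos hσ
    have hkJc : ContinuousOn (fun k : ℝ => (k : ℂ) • (jost A B (-σ * k))⁻¹) (Ioi 0) :=
      (Complex.continuous_ofReal.continuousOn).smul hJc
    have m1 := memLp_matFun_indicator hJc ha b
    have m2 := memLp_matFun_indicator hkJc ha b
    set u : L2 n := mulOp _ m1 f with hu
    set v : L2 n := mulOp _ m2 f with hv
    have hu' : ∀ᵐ k ∂ν₀, u k = act (jost A B (-σ * k))⁻¹ (fN k) := by
      filter_upwards [coeFn_mulOp m1 f, coeFn_cutoff (measurableSet_Icc (a := a) (b := b)) f]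
        with k h1 h2
      rw [hu, h1, hfN, h2]
      by_cases h : k ∈ Icc a b
      · simp only [matFun, indicator_of_mem h]
      · simp only [matFun, indicator_of_notMem h, map_zero]; simp
    have hv' : ∀ᵐ k ∂ν₀, v k = k • u k := by
      filter_upwards [coeFn_mulOp m2 f, coeFn_mulOp m1 f] with k h1 h2
      rw [hu, hv, h1, h2]
      by_cases h : k ∈ Icc a b
      · simp only [matFun, indicator_of_mem h]
        exact (act_smul_left (k : ℂ) _ _).trans (Complex.coe_smul k _)
      · simp only [matFun, indicator_of_notMem h, map_zero]; simp
    have eS : mulOp _ (memLp_sinCoeff hAB hpos hσ) fN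
        = (Complex.I * σ : ℂ) • constOp (Matrix.toEuclideanCLM (n := Fin n) (𝕜 := ℂ) B) u := by
      apply Lp.ext
      filter_upwards [coeFn_mulOp (memLp_sinCoeff hAB hpos hσ) fN, hu',
        coeFn_constOp (Matrix.toEuclideanCLM (n := Fin n) (𝕜 := ℂ) B) u,
        Lp.coeFn_smul (Complex.I * σ : ℂ)
          (constOp (Matrix.toEuclideanCLM (n := Fin n) (𝕜 := ℂ) B) u)] with k h1 h2 h3 h4
      rw [h1, h4, Pi.smul_apply, h3, h2]
      change act (sinCoeff A B σ k) _ = _ • act B _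
      rw [sinCoeff, act_smul_left, act_mul]
    have eC : mulOp _ (memLp_cosCoeff hAB hpos hσ) fN
        = (Complex.I * σ : ℂ) • constOp (Matrix.toEuclideanCLM (n := Fin n) (𝕜 := ℂ) A) v := by
      apply Lp.ext
      filter_upwards [coeFn_mulOp (memLp_cosCoeff hAB hpos hσ) fN, hu', hv',
        coeFn_constOp (Matrix.toEuclideanCLM (n := Fin n) (𝕜 := ℂ) A) v,
        Lp.coeFn_smul (Complex.I * σ : ℂ)
          (constOp (Matrix.toEuclideanCLM (n := Fin n) (𝕜 := ℂ) A) v)] with k h1 h2 h5 h3 h4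
      rw [h1, h4, Pi.smul_apply, h3, h5, h2, ← Complex.coe_smul, map_smul, smul_smul]
      change act (cosCoeff A B σ k) _ = _ • act A _
      rw [cosCoeff, act_smul_left, act_mul]
    have hcross := matrix_cross_eq_zero (conj_mul_comm hAB) hv'
    set hS := mulOp _ (memLp_sinCoeff hAB hpos hσ) fN with hS_def
    set hC := mulOp _ (memLp_cosCoeff hAB hpos hσ) fN with hC_def
    have ecos : cosT _ (fourierAdj hAB hpos hσ fN) = hC + cosT _ (sinT _ hS) := by
      rw [fourierAdj_apply, map_add, cosT_cosT]
    have esin : sinT _ (fourierAdj hAB hpos hσ fN) = sinT _ (cosT _ hC) + hS := by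
      rw [fourierAdj_apply, map_add, sinT_sinT]
    apply Lp.ext
    have z1 : cosT _ (sinT _ hS) = (Complex.I * σ : ℂ) • cosT _ (sinT _
        (constOp (Matrix.toEuclideanCLM (n := Fin n) (𝕜 := ℂ) B) u)) := by
      rw [eS, map_smul, map_smul]
    have z2 : sinT _ (cosT _ hC) = (Complex.I * σ : ℂ) • sinT _ (cosT _
        (constOp (Matrix.toEuclideanCLM (n := Fin n) (𝕜 := ℂ) A) v)) := by
      rw [eC, map_smul, map_smul]
    filter_upwards [coeFn_fourierMap hAB hpos hσ (fourierAdj hAB hpos hσ fN), hcross,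
      Lp.coeFn_add hC (cosT _ (sinT _ hS)), Lp.coeFn_add (sinT _ (cosT _ hC)) hS,
      coeFn_mulOp (memLp_sinCoeff hAB hpos hσ) fN, coeFn_mulOp (memLp_cosCoeff hAB hpos hσ) fN,
      Lp.coeFn_smul (Complex.I * σ : ℂ) (cosT _ (sinT _
        (constOp (Matrix.toEuclideanCLM (n := Fin n) (𝕜 := ℂ) B) u))),
      Lp.coeFn_smul (Complex.I * σ : ℂ) (sinT _ (cosT _
        (constOp (Matrix.toEuclideanCLM (n := Fin n) (𝕜 := ℂ) A) v))),
      ae_restrict_mem measurableSet_Ioi] with k h1 h2 h3 h4 h5 h6 h7 h8 hk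
    rw [h1, ecos, esin, h3, h4, Pi.add_apply, Pi.add_apply, z1, z2, h7, h8, hC_def, hS_def, h5, h6,
      Pi.smul_apply, Pi.smul_apply]
    change act (cosCoeff A B σ k)ᴴ (act (cosCoeff A B σ k) (fN k) + _)
      + act (sinCoeff A B σ k)ᴴ (_ + act (sinCoeff A B σ k) (fN k)) = fN k
    have hiso := coeff_isometry hAB hpos hσ (k := k) (ne_of_gt hk)
    have h9 : act (cosCoeff A B σ k)ᴴ (act (cosCoeff A B σ k) (fN k))
        + act (sinCoeff A B σ k)ᴴ (act (sinCoeff A B σ k) (fN k)) = fN k := by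
      rw [← act_mul, ← act_mul, ← act_add_left, hiso, act_one]
    set p := cosT (EuclideanSpace ℂ (Fin n)) (sinT _
        (constOp (Matrix.toEuclideanCLM (n := Fin n) (𝕜 := ℂ) B) u)) k with hp
    set q := sinT (EuclideanSpace ℂ (Fin n)) (cosT _
        (constOp (Matrix.toEuclideanCLM (n := Fin n) (𝕜 := ℂ) A) v)) k with hq
    -- The common factor (J⁻¹)† of c† and s† can be taken out, which leaves k A†CS(Bu) + B†SC(Av) =
    -- 0 from `hcross`.
    have h10 : act (cosCoeff A B σ k)ᴴ ((Complex.I * σ : ℂ) • p)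
        + act (sinCoeff A B σ k)ᴴ ((Complex.I * σ : ℂ) • q) = 0 := by
      have : act (cosCoeff A B σ k)ᴴ ((Complex.I * σ : ℂ) • p)
        + act (sinCoeff A B σ k)ᴴ ((Complex.I * σ : ℂ) • q)
        = (-(Complex.I * σ) * (Complex.I * σ) : ℂ) • act ((jost A B (-σ * k))⁻¹)ᴴ
          (act Aᴴ ((k : ℂ) • p) + act Bᴴ q) := by
        rw [cosCoeff_conj, sinCoeff_conj, act_smul_left, act_smul_left, act_mul, act_mul]
        simp only [act, map_smul, map_add, smul_add, smul_smul]
        congr 2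
        ring
      rw [this, h2]
      simp [act]
    have h11 := congrArg₂ (· + ·) h9 h10
    simp only [act, map_add, add_zero] at h11 ⊢
    refine Eq.trans ?_ h11
    abel
  -- The intervals [1/(N+1), N+1] exhaust (0, ∞), and both sides are continuous in f.
  have hX : ∀ᵐ x ∂ν₀, ∀ᶠ N : ℕ in Filter.atTop, x ∈ Icc (1 / ((N : ℝ) + 1)) ((N : ℝ) + 1) := by
    filter_upwards [ae_restrict_mem measurableSet_Ioi] with x hx
    have e1 := tendsto_one_div_add_atTop_nhds_zero_nat (𝕜 := ℝ) |>.eventually_le_const hx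
    filter_upwards [e1, Filter.eventually_ge_atTop ⌈x⌉₊] with N h1 h2
    refine ⟨h1, (Nat.le_ceil x).trans ?_⟩
    have : ((⌈x⌉₊ : ℕ) : ℝ) ≤ N := by exact_mod_cast h2
    linarith
  have hlim := tendsto_cutoff (fun N : ℕ => measurableSet_Icc (a := 1 / ((N : ℝ) + 1))
    (b := (N : ℝ) + 1)) hX f
  have h1 := (((fourierMap hAB hpos hσ).comp (fourierAdj hAB hpos hσ)).continuous.tendsto f).comp
    hlim
  refine tendsto_nhds_unique h1 (hlim.congr fun N => ?_)
  exact (key _ _ (by positivity) f).symm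

/-- `F H = k² F` on the domain of `H`. -/
lemma fourierMap_hamRel {ψ χ : L2 n} (h : HamRel A B ψ χ) :
    ∀ᵐ k ∂ν₀, fourierMap hAB hpos hσ χ k = -((k : ℂ) ^ 2 • fourierMap hAB hpos hσ ψ k) := by
  obtain ⟨ψ', h1, h2, a, b, ha, hb, hab⟩ := h
  filter_upwards [coeFn_fourierMap' hAB hpos hσ ψ, coeFn_fourierMap' hAB hpos hσ χ, h1.cosT,
    h1.sinT ha, h2.cosT, h2.sinT hb] with k e1 e2 d1 d2 d3 d4
  rw [e1, e2, smul_comm, ← smul_neg]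
  congr 1
  simp only [act]
  rw [← map_smul, ← map_neg]
  congr 1
  set r : ℂ := ((√(2 / Real.pi) : ℝ) : ℂ) with hr
  rw [← Complex.coe_smul] at d1 d3
  rw [← Complex.coe_smul, ← Complex.coe_smul, ← hr] at d2 d4
  -- Two partial integrations each. The boundary values a = ψ(0) and b = ψ'(0) enter the sum as k
  -- r(B†a - A†b), which the boundary condition annihilates.
  have f1 : (k : ℂ) ^ 2 • ((k : ℂ) • cosT _ ψ k) = -((k : ℂ) • (cosT _ χ k + r • b)) := by
    rw [d1, sq, mul_smul, smul_neg, d4, smul_neg]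
  have f2 : (k : ℂ) ^ 2 • (sinT _ ψ k) = -(sinT _ χ k) + (k : ℂ) • r • a := by
    rw [sq, mul_smul, d2, smul_add, d3]
  have f3 : act Aᴴ b = act Bᴴ a := (neg_add_eq_zero.1 hab).symm
  rw [smul_add, ← map_smul, f1, ← map_smul, f2]
  simp only [act] at f3
  simp only [map_neg, map_add, map_smul, smul_add, f3]
  abel

/-- From |k| ≤ 1 + k²: the intermediate function k f is needed because two derivatives are taken one
at a time. -/
lemma exists_mul_L2 {f g : L2 n} (h : ∀ᵐ k ∂ν₀, g k = (k : ℂ) ^ 2 • f k) :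
    ∃ f' : L2 n, (∀ᵐ k ∂ν₀, f' k = k • f k) ∧ ∀ᵐ k ∂ν₀, g k = k • f' k := by
  have hm : MemLp (fun k : ℝ => k • f k) 2 ν₀ := by
    refine MemLp.mono' ((Lp.memLp f).norm.add (Lp.memLp g).norm)
      (continuous_id.aestronglyMeasurable.smul (Lp.memLp f).1) ?_
    filter_upwards [h] with k hk
    rw [Pi.add_apply, hk, norm_smul, norm_smul, norm_pow, Complex.norm_real, Real.norm_eq_abs]
    nlinarith [norm_nonneg (f k), sq_nonneg (|k| - 1), abs_nonneg k]
  refine ⟨hm.toLp _, hm.coeFn_toLp, ?_⟩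
  filter_upwards [h, hm.coeFn_toLp] with k h1 h2
  rw [h1, h2, smul_smul, ← Complex.coe_smul]
  congr 1
  push_cast; ring

lemma ae_mulOp_smul {M : ℝ → EuclideanSpace ℂ (Fin n) →L[ℂ] EuclideanSpace ℂ (Fin n)}
    (hM : MemLp M ∞ ν₀) {f f' : L2 n} (h : ∀ᵐ k ∂ν₀, f' k = k • f k) :
    ∀ᵐ k ∂ν₀, mulOp M hM f' k = k • mulOp M hM f k := by
  filter_upwards [h, coeFn_mulOp hM f, coeFn_mulOp hM f'] with k h1 h2 h3
  rw [h3, h2, h1, ← Complex.coe_smul, map_smul, Complex.coe_smul]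

lemma IsWeakDeriv.neg {f g : L2 n} (h : IsWeakDeriv f g) : IsWeakDeriv (-f) (-g) := by
  simpa using h.smul (-1 : ℂ)

/-- `H F† = F† k²`. -/
lemma hamRel_fourierAdj {f g : L2 n} (h : ∀ᵐ k ∂ν₀, g k = (k : ℂ) ^ 2 • f k) :
    HamRel A B (fourierAdj hAB hpos hσ f) (-fourierAdj hAB hpos hσ g) := by
  obtain ⟨f', hf', hg⟩ := exists_mul_L2 h
  have mC := memLp_cosCoeff hAB hpos hσ
  have mS := memLp_sinCoeff hAB hpos hσ
  have c1 := ae_mulOp_smul mC hf'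
  have c2 := ae_mulOp_smul mC hg
  have s1 := ae_mulOp_smul mS hf'
  have s2 := ae_mulOp_smul mS hg
  refine ⟨-sinT _ (mulOp _ mC f') + cosT _ (mulOp _ mS f'),
    (isWeakDeriv_cosT c1).add (isWeakDeriv_sinT s1), ?_,
    √(2 / Real.pi) • (∫ k, mulOp _ mC f k ∂ν₀) + 0,
    (-1 : ℂ) • (0 : EuclideanSpace ℂ (Fin n)) + √(2 / Real.pi) • (∫ k, mulOp _ mS f' k ∂ν₀),
    (hasTrace_cosT (integrable_of_mul c1)).add (hasTrace_sinT (integrable_of_mul s1)), ?_, ?_⟩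
  · have := (isWeakDeriv_sinT c2).neg.add (isWeakDeriv_cosT s2)
    rwa [← neg_add] at this
  · have := ((hasTrace_sinT (integrable_of_mul c2)).smul (-1 : ℂ)).add
      (hasTrace_cosT (integrable_of_mul s2))
    rwa [neg_one_smul] at this
  -- The boundary values are ∫ c f and ∫ k s f up to the same factor, so the boundary condition
  -- follows under the integral from B†c = k A†s, that is, from B†A = A†B.
  · rw [add_zero, smul_zero, zero_add, neg_add_eq_zero, ← Complex.coe_smul, ← Complex.coe_smul,
      act, act, map_smul, map_smul, ← ContinuousLinearMap.integral_comp_comm _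
      (integrable_of_mul c1), ← ContinuousLinearMap.integral_comp_comm _ (integrable_of_mul s2)]
    congr 1
    apply integral_congr_ae
    filter_upwards [coeFn_mulOp mC f, coeFn_mulOp mS f, s1] with k h1 h2 h3
    rw [h3, h1, h2]
    change act Bᴴ (act (cosCoeff A B σ k) (f k)) = act Aᴴ (k • act (sinCoeff A B σ k) (f k))
    rw [cosCoeff, sinCoeff, act_smul_left, act_smul_left, act_mul, act_mul, ← Complex.coe_smul,
      smul_smul]
    have e : ∀ w, act Bᴴ (act A w) = act Aᴴ (act B w) := fun w => by
      rw [← act_mul, ← act_mul, conj_mul_comm hAB]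
    simp only [act, map_smul] at e ⊢
    rw [e]
    congr 1
    ring

end Intertwining

/-! ### Simultaneous diagonalization of the pair A, B. -/

section Diagonalization

variable {n : ℕ} {A B : Matrix (Fin n) (Fin n) ℂ}
  (hAB : -(Bᴴ * A) + Aᴴ * B = 0) (hpos : (Aᴴ * A + Bᴴ * B).PosDef)

include hAB hpos in
-- The polynomial det(zA + B) is nonzero at z = -i, where it is det J(1); so it cannot vanish at all
-- real z.
lemma exists_real_det_ne_zero : ∃ t : ℝ, ((t : ℂ) • A + B).det ≠ 0 := by
  by_contra! hcon
  let P : Matrix (Fin n) (Fin n) (Polynomial ℂ) :=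
    (Polynomial.X : Polynomial ℂ) • A.map Polynomial.C + B.map Polynomial.C
  have hev : ∀ z : ℂ, P.det.eval z = (z • A + B).det := by
    intro z
    have h := RingHom.map_det (Polynomial.evalRingHom z) P
    rw [Polynomial.coe_evalRingHom] at h
    rw [h]
    congr 1
    ext i j
    simp [P]
    ring
  have hP : P.det = 0 := by
    apply Polynomial.eq_zero_of_infinite_isRoot
    refine ((Set.infinite_range_of_injective Complex.ofReal_injective)).mono ?_
    rintro _ ⟨t, rfl⟩
    change P.det.eval _ = 0
    rw [hev, hcon]
  have h1 := hev (-Complex.I)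
  rw [hP, Polynomial.eval_zero] at h1
  have h2 := isUnit_det_jost hAB hpos (σ := -1) (Or.inr rfl) (k := 1) one_ne_zero
  rw [jost] at h2
  refine h2.ne_zero ?_
  rw [h1]
  congr 1
  simp [sub_eq_add_neg, add_comm]

include hAB hpos in
/-- The boundary condition is diagonal in a suitable orthonormal basis. -/
lemma exists_diagonalization :
    ∃ (v : OrthonormalBasis (Fin n) ℂ (EuclideanSpace ℂ (Fin n)))
      (w : Fin n → EuclideanSpace ℂ (Fin n)) (α β : Fin n → ℝ),
      ∀ j, act A (w j) = (α j : ℂ) • v j ∧ act B (w j) = (β j : ℂ) • v j ∧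
        (α j ≠ 0 ∨ β j ≠ 0) := by
  obtain ⟨t, ht⟩ := exists_real_det_ne_zero hAB hpos
  -- A rotation of the pair (A, B) that makes one member invertible and keeps C†D = D†C. Then D C⁻¹
  -- is Hermitian; v is its eigenbasis and w_j = C⁻¹v_j. Solving back for A and B gives α_j and β_j.
  set C : Matrix (Fin n) (Fin n) ℂ := (t : ℂ) • A + B with hC
  set D : Matrix (Fin n) (Fin n) ℂ := (t : ℂ) • B - A with hD
  have hcomm := conj_mul_comm hAB
  have hCu : IsUnit C.det := ht.isUnit
  have hCD : Cᴴ * D = Dᴴ * C := by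
    simp only [hC, hD, Matrix.conjTranspose_add, Matrix.conjTranspose_sub,
      Matrix.conjTranspose_smul, add_mul, mul_sub, sub_mul, mul_add, Matrix.smul_mul,
      Matrix.mul_smul, hcomm, Complex.star_def, Complex.conj_ofReal]
    abel
  have hK : (D * C⁻¹).IsHermitian := by
    have h1 : Cᴴ * (C⁻¹)ᴴ = 1 := by
      rw [← Matrix.conjTranspose_mul, Matrix.nonsing_inv_mul C hCu, Matrix.conjTranspose_one]
    have h2 : (C⁻¹)ᴴ * Cᴴ = 1 := by
      rw [← Matrix.conjTranspose_mul, Matrix.mul_nonsing_inv C hCu, Matrix.conjTranspose_one]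
    rw [Matrix.IsHermitian, Matrix.conjTranspose_mul]
    calc (C⁻¹)ᴴ * Dᴴ = (C⁻¹)ᴴ * (Dᴴ * C) * C⁻¹ := by
          rw [mul_assoc, mul_assoc, Matrix.mul_nonsing_inv C hCu, mul_one]
      _ = D * C⁻¹ := by rw [← hCD, ← mul_assoc, h2, one_mul]
  have ht1 : ((t : ℂ) ^ 2 + 1) ≠ 0 := by
    have : ((t ^ 2 + 1 : ℝ) : ℂ) ≠ 0 := Complex.ofReal_ne_zero.2 (by positivity)
    simpa using this
  have ht2 : t ^ 2 + 1 ≠ 0 := by positivity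
  refine ⟨hK.eigenvectorBasis, fun j => act C⁻¹ (hK.eigenvectorBasis j),
    fun j => (t - hK.eigenvalues j) / (t ^ 2 + 1),
    fun j => (1 + t * hK.eigenvalues j) / (t ^ 2 + 1), fun j => ?_⟩
  have hCw : act C (act C⁻¹ (hK.eigenvectorBasis j)) = hK.eigenvectorBasis j := by
    rw [← act_mul, Matrix.mul_nonsing_inv C hCu, act_one]
  have hDw : act D (act C⁻¹ (hK.eigenvectorBasis j))
      = (hK.eigenvalues j : ℂ) • hK.eigenvectorBasis j := by
    rw [← act_mul]
    have := hK.mulVec_eigenvectorBasis j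
    ext i
    rw [act, Matrix.ofLp_toEuclideanCLM, this]
    simp
  have hA : A = ((t : ℂ) ^ 2 + 1)⁻¹ • ((t : ℂ) • C + (-1 : ℂ) • D) := by
    rw [eq_inv_smul_iff₀ ht1, hC, hD]
    module
  have hB : B = ((t : ℂ) ^ 2 + 1)⁻¹ • (C + (t : ℂ) • D) := by
    rw [eq_inv_smul_iff₀ ht1, hC, hD]
    module
  refine ⟨?_, ?_, ?_⟩
  · conv_lhs => rw [hA]
    rw [act_smul_left, act_add_left, act_smul_left, act_smul_left, hCw, hDw]
    push_cast
    module
  · conv_lhs => rw [hB]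
    rw [act_smul_left, act_add_left, act_smul_left, hCw, hDw]
    push_cast
    module
  -- If both vanished, the eigenvalue would be t and 1 + t² = 0.
  · by_contra! h
    have h1 : t - hK.eigenvalues j = 0 := by
      simpa [ht2] using h.1
    have h2 : 1 + t * hK.eigenvalues j = 0 := by
      simpa [ht2] using h.2
    rw [← sub_eq_zero.1 h1] at h2
    nlinarith

end Diagonalization

/-! ### Decaying exponentials and the equation f' = κf. -/

section Exponentials

variable {n : ℕ}

lemma memLp_exp_smul {κ : ℝ} (hκ : κ < 0) (v : EuclideanSpace ℂ (Fin n)) :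
    MemLp (fun x : ℝ => Real.exp (κ * x) • v) 2 ν₀ := by
  have h1 : MemLp (fun x : ℝ => Real.exp (κ * x)) 2 ν₀ := by
    rw [memLp_two_iff_integrable_sq (by fun_prop)]
    have := integrableOn_exp_mul_Ioi (a := 2 * κ) (by linarith) 0
    refine this.congr (Filter.Eventually.of_forall fun x => ?_)
    change Real.exp (2 * κ * x) = Real.exp (κ * x) ^ 2
    rw [← Real.exp_nat_mul]
    congr 1
    push_cast
    ring
  have h2 : MemLp (fun _ : ℝ => v) ∞ ν₀ := memLp_top_const v
  exact h2.smul h1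

/-- The function `x ↦ exp(κx) v` for `κ < 0`. -/
noncomputable def expL2 {κ : ℝ} (hκ : κ < 0) (v : EuclideanSpace ℂ (Fin n)) : L2 n :=
  (memLp_exp_smul hκ v).toLp _

lemma coeFn_expL2 {κ : ℝ} (hκ : κ < 0) (v : EuclideanSpace ℂ (Fin n)) :
    expL2 hκ v =ᵐ[ν₀] fun x => Real.exp (κ * x) • v := MemLp.coeFn_toLp _

lemma hasDerivAt_exp_mul (κ x : ℝ) :
    HasDerivAt (fun x => Real.exp (κ * x)) (κ * Real.exp (κ * x)) x := by
  have := ((hasDerivAt_id x).const_mul κ).exp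
  simpa [mul_comm] using this

lemma isWeakDeriv_expL2 {κ : ℝ} (hκ : κ < 0) (v : EuclideanSpace ℂ (Fin n)) :
    IsWeakDeriv (expL2 hκ v) ((κ : ℂ) • expL2 hκ v) := by
  refine isWeakDeriv_of_hasDerivAt (fun x => hasDerivAt_exp_mul κ x) (by fun_prop)
    (coeFn_expL2 hκ v) ?_
  filter_upwards [Lp.coeFn_smul (κ : ℂ) (expL2 hκ v), coeFn_expL2 hκ v] with x h1 h2
  rw [h1, Pi.smul_apply, h2, Complex.coe_smul, smul_smul]

lemma hasTrace_expL2 {κ : ℝ} (hκ : κ < 0) (v : EuclideanSpace ℂ (Fin n)) :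
    HasTrace (expL2 hκ v) v :=
  ⟨fun x => Real.exp (κ * x) • v, by fun_prop, coeFn_expL2 hκ v, by simp⟩

lemma hamRel_expL2 {A B : Matrix (Fin n) (Fin n) ℂ} {κ : ℝ} (hκ : κ < 0)
    {v : EuclideanSpace ℂ (Fin n)} (hv : act Bᴴ v = (κ : ℂ) • act Aᴴ v) :
    HamRel A B (expL2 hκ v) (((κ ^ 2 : ℝ) : ℂ) • expL2 hκ v) := by
  refine ⟨(κ : ℂ) • expL2 hκ v, isWeakDeriv_expL2 hκ v, ?_, v, (κ : ℂ) • v, hasTrace_expL2 hκ v,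
    (hasTrace_expL2 hκ v).smul _, ?_⟩
  · have := (isWeakDeriv_expL2 hκ v).smul (κ : ℂ)
    rw [smul_smul] at this
    rwa [Complex.ofReal_pow, sq]
  · rw [hv]
    simp only [act, map_smul]
    abel

lemma volume_Ioi_ne_zero : ν₀ ≠ 0 := by
  rw [Ne, Measure.restrict_eq_zero]
  simp

lemma ae_Ioi_neBot : (ae ν₀).NeBot := ae_neBot.2 volume_Ioi_ne_zero

lemma expL2_ne_zero {κ : ℝ} (hκ : κ < 0) {v : EuclideanSpace ℂ (Fin n)} (hv : v ≠ 0) :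
    expL2 hκ v ≠ 0 := by
  intro h
  have h1 := coeFn_expL2 hκ v
  rw [h] at h1
  have := ae_Ioi_neBot
  obtain ⟨x, hx1, hx2⟩ := (h1.and (Lp.coeFn_zero (EuclideanSpace ℂ (Fin n)) 2 ν₀)).exists
  rw [hx2] at hx1
  have := smul_eq_zero.1 hx1.symm
  simp [hv, Real.exp_ne_zero] at this

lemma inner_expL2 {κ κ' : ℝ} (hκ : κ < 0) (hκ' : κ' < 0) {v v' : EuclideanSpace ℂ (Fin n)}
    (h : ⟪v, v'⟫_ℂ = 0) : ⟪expL2 hκ v, expL2 hκ' v'⟫_ℂ = 0 := by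
  rw [L2.inner_def]
  refine integral_eq_zero_of_ae ?_
  filter_upwards [coeFn_expL2 hκ v, coeFn_expL2 hκ' v'] with x h1 h2
  rw [h1, h2, ← Complex.coe_smul, ← Complex.coe_smul, inner_smul_left, inner_smul_right, h]
  simp

lemma IsWeakDeriv.constOp {f g : L2 n} (h : IsWeakDeriv f g)
    (T : EuclideanSpace ℂ (Fin n) →L[ℂ] EuclideanSpace ℂ (Fin n)) :
    IsWeakDeriv (constOp T f) (constOp T g) := by
  have key : ∀ φ : ℝ → ℝ, Continuous φ → HasCompactSupport φ → ∀ f : L2 n,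
      ∫ x in Ioi (0 : ℝ), φ x • HalfLine.constOp T f x = T (∫ x in Ioi (0 : ℝ), φ x • f x) := by
    intro φ hφ hc f
    rw [← T.integral_comp_comm (integrable_smul_lp hφ hc f)]
    apply integral_congr_ae
    filter_upwards [coeFn_constOp T f] with x hx
    rw [hx, ← Complex.coe_smul, ← Complex.coe_smul, map_smul]
  intro φ hφ hc hs
  rw [key _ (hφ.continuous_deriv (by simp)) hc.deriv, key _ hφ.continuous hc, h φ hφ hc hs, map_neg]

/-- The solutions of `f' = κ f`. -/
lemma IsWeakDeriv.eq_exp {f : L2 n} {κ : ℝ} (h : IsWeakDeriv f ((κ : ℂ) • f)) :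
    ∃ c : EuclideanSpace ℂ (Fin n), f =ᵐ[ν₀] fun x => Real.exp (κ * x) • c := by
  have hloc : LocallyIntegrable (fun x => Real.exp (-κ * x) • f x) ν₀ := by
    have h1 := locallyIntegrable_L2 f
    intro x
    obtain ⟨s, hs, hi⟩ := h1 x
    obtain ⟨r, hr, hrs⟩ := Metric.nhds_basis_closedBall.mem_iff.1 hs
    refine ⟨Metric.closedBall x r, Metric.closedBall_mem_nhds x hr, ?_⟩
    exact (hi.mono_set hrs).continuousOn_smul (by fun_prop) (isCompact_closedBall x r)
  -- The function exp(-κx) f has weak derivative zero, as seen by inserting φ exp(-κx) as a test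
  -- function into f' = κf.
  obtain ⟨c, hc⟩ := ae_eq_const_of_weakDeriv_zero hloc (by
    intro φ hφ hc hs
    have hd : ∀ x, deriv (fun x => φ x * Real.exp (-κ * x)) x
        = deriv φ x * Real.exp (-κ * x) - κ * (φ x * Real.exp (-κ * x)) := by
      intro x
      have h1 : HasDerivAt φ (deriv φ x) x :=
        (hφ.differentiable (by simp)).differentiableAt.hasDerivAt
      rw [(h1.fun_mul (hasDerivAt_exp_mul (-κ) x)).deriv]
      ring
    have hη : ContDiff ℝ ∞ (fun x => φ x * Real.exp (-κ * x)) := by fun_prop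
    have hηc : HasCompactSupport (fun x => φ x * Real.exp (-κ * x)) := hc.mul_right
    have := h _ hη hηc ((tsupport_mul_subset_left).trans hs)
    have e1 : ∫ x in Ioi (0 : ℝ), (φ x * Real.exp (-κ * x)) • ((κ : ℂ) • f : L2 n) x
        = κ • ∫ x in Ioi (0 : ℝ), (φ x * Real.exp (-κ * x)) • f x := by
      rw [← integral_smul]
      apply integral_congr_ae
      filter_upwards [Lp.coeFn_smul (κ : ℂ) f] with x hx
      rw [hx, Pi.smul_apply, Complex.coe_smul, smul_comm]
    have i1 := integrable_smul_lp hη.continuous hηc f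
    have i2 : Integrable (fun x => (deriv φ x * Real.exp (-κ * x)) • f x) ν₀ :=
      integrable_smul_lp (((hφ.continuous_deriv (by simp))).mul (by fun_prop))
        hc.deriv.mul_right f
    have i3 : Integrable (fun x => κ • ((φ x * Real.exp (-κ * x)) • f x)) ν₀ := i1.smul κ
    simp_rw [hd, sub_smul, mul_smul κ] at this
    rw [integral_sub i2 i3, e1, integral_smul, sub_eq_neg_self] at this
    simp_rw [smul_smul]
    exact this)
  refine ⟨c, ?_⟩
  filter_upwards [hc] with x hx
  rw [← hx, smul_smul, ← Real.exp_add]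
  simp

/-- For κ ≥ 0 and x > 0 one has ‖f(x)‖ ≥ ‖c‖, and nonzero constants are not integrable on a half
line. -/
lemma eq_zero_of_eq_exp {f : L2 n} {κ : ℝ} (hκ : 0 ≤ κ) {c : EuclideanSpace ℂ (Fin n)}
    (h : f =ᵐ[ν₀] fun x => Real.exp (κ * x) • c) : c = 0 := by
  have h1 : Integrable (fun _ : ℝ => ‖c‖ ^ 2) ν₀ := by
    refine (integrable_norm_sq f).mono aestronglyMeasurable_const ?_
    filter_upwards [h, ae_restrict_mem measurableSet_Ioi] with x hx hx0
    have hx0' : (0 : ℝ) < x := hx0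
    have : 1 ≤ Real.exp (κ * x) := Real.one_le_exp (by positivity)
    rw [norm_pow, norm_norm, norm_pow, norm_norm, hx, norm_smul, Real.norm_eq_abs,
      abs_of_pos (Real.exp_pos _)]
    gcongr
    nlinarith [norm_nonneg c]
  rw [integrable_const_iff] at h1
  rcases h1 with h1 | h1
  · simpa using h1
  · have := h1.measure_univ_lt_top
    simp at this

end Exponentials

/-! ### The kernel of F and the bound states. -/

section Kernel

variable {n : ℕ} {A B : Matrix (Fin n) (Fin n) ℂ} {σ : ℝ}
  (hAB : -(Bᴴ * A) + Aᴴ * B = 0) (hpos : (Aᴴ * A + Bᴴ * B).PosDef) (hσ : σ = 1 ∨ σ = -1)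

/-- Multiplying F ψ = 0 by J† leaves k C(A†ψ) = -S(B†ψ). Then (C h)' = -S(k h) with h = C(A†ψ),
together with C² = S² = 1, gives the claim. No regularity of ψ itself is assumed. -/
lemma isWeakDeriv_of_fourierMap_eq_zero {ψ : L2 n} (h : fourierMap hAB hpos hσ ψ = 0) :
    IsWeakDeriv (constOp (Matrix.toEuclideanCLM (n := Fin n) (𝕜 := ℂ) Aᴴ) ψ)
      (constOp (Matrix.toEuclideanCLM (n := Fin n) (𝕜 := ℂ) Bᴴ) ψ) := by
  have h1 := coeFn_fourierMap' hAB hpos hσ ψ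
  rw [h] at h1
  have key : ∀ᵐ k ∂ν₀, (-sinT _ (constOp (Matrix.toEuclideanCLM (n := Fin n) (𝕜 := ℂ) Bᴴ) ψ) : L2 n) k
      = k • cosT _ (constOp (Matrix.toEuclideanCLM (n := Fin n) (𝕜 := ℂ) Aᴴ) ψ) k := by
    rw [sinT_constOp, cosT_constOp]
    filter_upwards [h1, Lp.coeFn_zero (EuclideanSpace ℂ (Fin n)) 2 ν₀,
      Lp.coeFn_neg (constOp (Matrix.toEuclideanCLM (n := Fin n) (𝕜 := ℂ) Bᴴ) (sinT _ ψ)),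
      coeFn_constOp (Matrix.toEuclideanCLM (n := Fin n) (𝕜 := ℂ) Bᴴ) (sinT _ ψ),
      coeFn_constOp (Matrix.toEuclideanCLM (n := Fin n) (𝕜 := ℂ) Aᴴ) (cosT _ ψ),
      ae_restrict_mem measurableSet_Ioi] with k e1 e2 e3 e4 e5 hk
    rw [e3, Pi.neg_apply, e4, e5]
    rw [e2, Pi.zero_apply, eq_comm, smul_eq_zero] at e1
    have hσ0 : -(Complex.I * (σ : ℂ)) ≠ 0 := by
      rcases hσ with rfl | rfl <;> simp
    have e6 := e1.resolve_left hσ0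
    have hu := isUnit_det_jost hAB hpos hσ (ne_of_gt hk)
    have e7 := congrArg (act (jost A B (-σ * k))ᴴ) e6
    rw [← act_mul, ← Matrix.conjTranspose_mul, Matrix.nonsing_inv_mul _ hu,
      Matrix.conjTranspose_one, act_one] at e7
    simp only [act, map_smul, map_zero] at e7
    rw [← Complex.coe_smul, neg_eq_iff_add_eq_zero, add_comm, e7]
  have := isWeakDeriv_cosT key
  simpa using this

lemma coeFn_sum_L2 {ι : Type*} [Fintype ι] (f : ι → L2 n) :
    (∑ j, f j : L2 n) =ᵐ[ν₀] fun x => ∑ j, f j x := by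
  have := Lp.coeFn_finsetSum Finset.univ f
  filter_upwards [this] with x hx
  rw [hx, Finset.sum_apply]

lemma sum_inner_smul_L2 (v : OrthonormalBasis (Fin n) ℂ (EuclideanSpace ℂ (Fin n))) (ψ : L2 n) :
    ∑ j, constOp ((innerSL ℂ (v j)).smulRight (v j)) ψ = ψ := by
  apply Lp.ext
  have h1 : ∀ᵐ x ∂ν₀, ∀ j, constOp ((innerSL ℂ (v j)).smulRight (v j)) ψ x
      = ⟪v j, ψ x⟫_ℂ • v j := by
    rw [ae_all_iff]
    intro j
    filter_upwards [coeFn_constOp ((innerSL ℂ (v j)).smulRight (v j)) ψ] with x hx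
    rw [hx]
    simp
  filter_upwards [h1, coeFn_sum_L2 (fun j => constOp ((innerSL ℂ (v j)).smulRight (v j)) ψ)]
    with x h1 h2
  rw [h2]
  simp_rw [h1]
  exact v.sum_repr' (ψ x)

include hAB hpos in
/-- The bound states of `H`. Together they span the kernels of both Fourier maps. -/
lemma exists_boundStates : ∃ (ι : Type) (_ : Fintype ι) (lam : ι → ℝ) (e : ι → L2 n),
    Fintype.card ι ≤ n ∧ Orthonormal ℂ e ∧ (∀ i, lam i < 0) ∧
    (∀ i, HamRel A B (e i) (-((lam i : ℂ) • e i))) ∧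
    ∀ (σ : ℝ) (hσ : σ = 1 ∨ σ = -1) (ψ : L2 n), fourierMap hAB hpos hσ ψ = 0 →
      ψ ∈ Submodule.span ℂ (range e) := by
  obtain ⟨v, w, α, β, hvw⟩ := exists_diagonalization hAB hpos
  have hv0 : ∀ j, v j ≠ 0 := fun j => v.orthonormal.ne_zero j
  -- One bound state for each j with α_j ≠ 0 and decay rate κ = β_j/α_j < 0; hence at most n.
  let b : {j : Fin n // α j ≠ 0 ∧ β j / α j < 0} → L2 n := fun i => expL2 i.2.2 (v i.1)
  have hb0 : ∀ i, (‖b i‖ : ℂ) ≠ 0 := fun i =>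
    Complex.ofReal_ne_zero.2 (norm_ne_zero_iff.2 (expL2_ne_zero i.2.2 (hv0 i.1)))
  classical
  refine ⟨{j : Fin n // α j ≠ 0 ∧ β j / α j < 0}, inferInstance, fun i => -(β i.1 / α i.1) ^ 2,
    fun i => (‖b i‖ : ℂ)⁻¹ • b i, ?_, ⟨?_, ?_⟩, ?_, ?_, ?_⟩
  · exact (Fintype.card_subtype_le _).trans (Fintype.card_fin n).le
  · intro i
    rw [norm_smul, norm_inv, Complex.norm_real, norm_norm, inv_mul_cancel₀]
    exact_mod_cast hb0 i
  · intro i j hij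
    have hij' : i.1 ≠ j.1 := fun h => hij (Subtype.ext h)
    change ⟪(‖b i‖ : ℂ)⁻¹ • b i, (‖b j‖ : ℂ)⁻¹ • b j⟫_ℂ = 0
    rw [inner_smul_left, inner_smul_right,
      inner_expL2 i.2.2 j.2.2 (v.orthonormal.2 hij'), mul_zero, mul_zero]
  · intro i
    exact neg_neg_of_pos (sq_pos_iff.2 i.2.2.ne)
  · intro i
    -- Applying B†A = A†B to w_j gives α_j B†v_j = β_j A†v_j, the boundary condition for exp(κx)
    -- v_j.
    have hbc : act Bᴴ (v i.1) = ((β i.1 / α i.1 : ℝ) : ℂ) • act Aᴴ (v i.1) := by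
      have hα : (α i.1 : ℂ) ≠ 0 := Complex.ofReal_ne_zero.2 i.2.1
      have h1 : (α i.1 : ℂ) • act Bᴴ (v i.1) = (β i.1 : ℂ) • act Aᴴ (v i.1) := by
        have e1 : act Bᴴ (act A (w i.1)) = act Aᴴ (act B (w i.1)) := by
          rw [← act_mul, ← act_mul, conj_mul_comm hAB]
        rw [(hvw i.1).1, (hvw i.1).2.1] at e1
        simpa only [act, map_smul] using e1
      rw [Complex.ofReal_div, div_eq_inv_mul, mul_smul, ← h1, smul_smul, inv_mul_cancel₀ hα,
        one_smul]
    have h1 := (hamRel_expL2 i.2.2 hbc).smul ((‖b i‖ : ℂ)⁻¹)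
    convert h1 using 1
    rw [← neg_smul, smul_smul, smul_smul]
    congr 1
    push_cast
    ring
  · intro σ hσ ψ hψ
    have hw := isWeakDeriv_of_fourierMap_eq_zero hAB hpos hσ hψ
    rw [← sum_inner_smul_L2 v ψ]
    refine Submodule.sum_mem _ fun j _ => ?_
    set p := constOp ((innerSL ℂ (v j)).smulRight (v j)) ψ with hp
    -- Pairing with w_j gives ⟨w_j, M†ψ⟩ = ⟨M w_j, ψ⟩ = c⟨v_j, ψ⟩, so the matrix equation (A†ψ)' =
    -- B†ψ decouples into α_j p' = β_j p.
    have hcomp : ∀ (M : Matrix (Fin n) (Fin n) ℂ) (c : ℝ), act M (w j) = (c : ℂ) • v j →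
        constOp ((innerSL ℂ (w j)).smulRight (v j))
          (constOp (Matrix.toEuclideanCLM (n := Fin n) (𝕜 := ℂ) Mᴴ) ψ) = (c : ℂ) • p := by
      intro M c hM
      apply Lp.ext
      filter_upwards [Lp.coeFn_smul (c : ℂ) p, coeFn_constOp ((innerSL ℂ (v j)).smulRight (v j)) ψ,
        coeFn_constOp ((innerSL ℂ (w j)).smulRight (v j))
          (constOp (Matrix.toEuclideanCLM (n := Fin n) (𝕜 := ℂ) Mᴴ) ψ),
        coeFn_constOp (Matrix.toEuclideanCLM (n := Fin n) (𝕜 := ℂ) Mᴴ) ψ] with x h1 h2 h3 h4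
      rw [h1, h3, h4, Pi.smul_apply, h2]
      simp only [ContinuousLinearMap.smulRight_apply, innerSL_apply_apply]
      rw [← inner_act, hM, inner_smul_left, Complex.conj_ofReal, smul_smul]
    have hwp := hw.constOp ((innerSL ℂ (w j)).smulRight (v j))
    rw [hcomp A _ (hvw j).1, hcomp B _ (hvw j).2.1] at hwp
    by_cases hα : α j = 0
    · have hβ : (β j : ℂ) ≠ 0 := Complex.ofReal_ne_zero.2 ((hvw j).2.2.resolve_left (by simpa))
      rw [hα, Complex.ofReal_zero, zero_smul] at hwp
      have h0 : IsWeakDeriv (0 : L2 n) 0 := by simpa using hwp.smul 0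
      have := (smul_eq_zero.1 (hwp.unique h0)).resolve_left hβ
      rw [this]
      exact Submodule.zero_mem _
    · have hα' : (α j : ℂ) ≠ 0 := Complex.ofReal_ne_zero.2 hα
      have hk : IsWeakDeriv p (((β j / α j : ℝ) : ℂ) • p) := by
        have := hwp.smul ((α j : ℂ)⁻¹)
        rw [smul_smul, smul_smul, inv_mul_cancel₀ hα', one_smul] at this
        rwa [Complex.ofReal_div, div_eq_inv_mul]
      obtain ⟨c, hc⟩ := hk.eq_exp
      rcases le_or_gt 0 (β j / α j) with hκ | hκ
      · have hc0 := eq_zero_of_eq_exp hκ hc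
        have : p = 0 := by
          apply Lp.ext
          filter_upwards [hc, Lp.coeFn_zero (EuclideanSpace ℂ (Fin n)) 2 ν₀] with x h1 h2
          rw [h1, h2, hc0, smul_zero, Pi.zero_apply]
        rw [this]
        exact Submodule.zero_mem _
      -- The values of p lie almost everywhere on the line spanned by v_j; one such point x with
      -- p(x) = exp(κx) c puts c on this line.
      · obtain ⟨s, rfl⟩ : ∃ s : ℂ, c = s • v j := by
          have := ae_Ioi_neBot
          obtain ⟨x, h1, h2⟩ :=
            (hc.and (coeFn_constOp ((innerSL ℂ (v j)).smulRight (v j)) ψ)).exists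
          rw [← hp, h1] at h2
          simp only [ContinuousLinearMap.smulRight_apply, innerSL_apply_apply] at h2
          refine ⟨(Real.exp (β j / α j * x) : ℂ)⁻¹ * ⟪v j, ψ x⟫_ℂ, ?_⟩
          rw [mul_smul, ← h2, ← Complex.coe_smul, smul_smul, inv_mul_cancel₀, one_smul]
          exact Complex.ofReal_ne_zero.2 (Real.exp_ne_zero _)
        let i : {j : Fin n // α j ≠ 0 ∧ β j / α j < 0} := ⟨j, hα, hκ⟩
        have hpe : p = (s * ‖b i‖) • ((‖b i‖ : ℂ)⁻¹ • b i) := by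
          rw [smul_smul, mul_assoc, mul_inv_cancel₀ (hb0 i), mul_one]
          apply Lp.ext
          filter_upwards [hc, Lp.coeFn_smul s (b i), coeFn_expL2 hκ (v j)] with x h1 h2 h3
          rw [h1, h2, Pi.smul_apply, smul_comm]
          exact congrArg (s • ·) h3.symm
        rw [hpe]
        exact Submodule.smul_mem _ _ (Submodule.subset_span ⟨i, rfl⟩)

end Kernel

/-! ### Indicator functions as projectors, and their countable additivity. -/

section Cutoff

variable {α V : Type*} [MeasurableSpace α] {μ : Measure α} [NormedAddCommGroup V]
  [InnerProductSpace ℂ V]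

lemma cutoff_congr {S S' : Set α} (hS : MeasurableSet S) (hS' : MeasurableSet S') (h : S = S')
    (f : Lp V 2 μ) : cutoff hS f = cutoff hS' f := by
  subst h
  rfl

lemma cutoff_cutoff {S : Set α} (hS : MeasurableSet S) (f : Lp V 2 μ) :
    cutoff hS (cutoff hS f) = cutoff hS f := by
  apply Lp.ext
  filter_upwards [coeFn_cutoff hS (cutoff hS f), coeFn_cutoff hS f] with x h1 h2
  rw [h1]
  by_cases hx : x ∈ S
  · rw [indicator_of_mem hx]
  · rw [indicator_of_notMem hx, h2, indicator_of_notMem hx]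

lemma inner_cutoff [CompleteSpace V] {S : Set α} (hS : MeasurableSet S) (f g : Lp V 2 μ) :
    ⟪cutoff hS f, g⟫_ℂ = ⟪f, cutoff hS g⟫_ℂ := by
  refine inner_mulOp _ _ (ae_of_all _ fun x v w => ?_) f g
  by_cases h : x ∈ S <;> simp [scalarFun, h]

lemma cutoff_eq_self {S : Set α} (hS : MeasurableSet S) (h : ∀ᵐ x ∂μ, x ∈ S) (f : Lp V 2 μ) :
    cutoff hS f = f := by
  apply Lp.ext
  filter_upwards [coeFn_cutoff hS f, h] with x h1 h2
  rw [h1, indicator_of_mem h2]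

lemma cutoff_eq_zero {S : Set α} (hS : MeasurableSet S) (h : ∀ᵐ x ∂μ, x ∉ S) (f : Lp V 2 μ) :
    cutoff hS f = 0 := by
  apply Lp.ext
  filter_upwards [coeFn_cutoff hS f, h, Lp.coeFn_zero V 2 μ] with x h1 h2 h3
  rw [h1, indicator_of_notMem h2, h3, Pi.zero_apply]

lemma hasSum_cutoff {S : ℕ → Set α} (hS : ∀ i, MeasurableSet (S i))
    (hd : Pairwise (Function.onFun Disjoint S)) (f : Lp V 2 μ) :
    HasSum (fun i => cutoff (hS i) f) (cutoff (MeasurableSet.iUnion hS) f) := by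
  -- A partial sum over s is the cutoff to ⋃_{i ∈ s} S_i of the function already cut to ⋃ S_i.
  -- Adding the complement of ⋃ S_i changes nothing there and makes the sets exhaust the space, so
  -- `tendsto_cutoff` applies.
  have hT : ∀ s : Finset ℕ, MeasurableSet ((⋃ i ∈ s, S i) ∪ (⋃ i, S i)ᶜ) := fun s =>
    (s.measurableSet_biUnion fun i _ => hS i).union (MeasurableSet.iUnion hS).compl
  have h := tendsto_cutoff (l := Filter.atTop) (μ := μ) hT (ae_of_all _ fun x => by
    by_cases hx : x ∈ ⋃ i, S i
    · obtain ⟨i, hi⟩ := mem_iUnion.1 hx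
      filter_upwards [Filter.eventually_ge_atTop {i}] with s hs
      exact Or.inl (mem_biUnion (hs (Finset.mem_singleton_self i)) hi)
    · exact Filter.Eventually.of_forall fun s => Or.inr hx) (cutoff (MeasurableSet.iUnion hS) f)
  refine h.congr fun s => ?_
  apply Lp.ext
  have h1 : ∀ᵐ x ∂μ, ∀ i, cutoff (hS i) f x = (S i).indicator f x := by
    rw [ae_all_iff]
    exact fun i => coeFn_cutoff (hS i) f
  filter_upwards [h1, coeFn_cutoff (hT s) (cutoff (MeasurableSet.iUnion hS) f),
    coeFn_cutoff (MeasurableSet.iUnion hS) f,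
    Lp.coeFn_finsetSum s (fun i => cutoff (hS i) f)] with x e1 e2 e3 e4
  rw [e4, e2, Finset.sum_apply]
  simp_rw [e1]
  rw [← Finset.indicator_biUnion_apply s S (fun i _ j _ hij => hd hij)]
  by_cases hx : x ∈ ⋃ i ∈ s, S i
  · have hx' : x ∈ ⋃ i, S i := iUnion₂_subset_iUnion _ _ hx
    rw [indicator_of_mem hx, indicator_of_mem (mem_union_left _ hx), e3, indicator_of_mem hx']
  · rw [indicator_of_notMem hx]
    by_cases hx' : x ∈ ⋃ i, S i
    · have hn : x ∉ (⋃ i ∈ s, S i) ∪ (⋃ i, S i)ᶜ := fun h => h.elim hx fun h => h hx'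
      rw [indicator_of_notMem hn]
    · rw [indicator_of_mem (mem_union_right _ hx'), e3, indicator_of_notMem hx']

lemma ofReal_norm_sq (f : Lp V 2 μ) : ENNReal.ofReal (‖f‖ ^ 2) = ∫⁻ x, ‖f x‖ₑ ^ 2 ∂μ := by
  rw [norm_sq_eq_integral, ofReal_integral_eq_lintegral_ofReal (integrable_norm_sq f)
    (ae_of_all _ fun x => sq_nonneg _)]
  congr 1
  ext x
  rw [ENNReal.ofReal_pow (norm_nonneg _), ofReal_norm]

lemma ofReal_norm_cutoff_sq {S : Set α} (hS : MeasurableSet S) (f : Lp V 2 μ) :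
    ENNReal.ofReal (‖cutoff hS f‖ ^ 2) = ∫⁻ x in S, ‖f x‖ₑ ^ 2 ∂μ := by
  rw [ofReal_norm_sq, ← lintegral_indicator hS]
  apply lintegral_congr_ae
  filter_upwards [coeFn_cutoff hS f] with x hx
  rw [hx]
  by_cases h : x ∈ S <;> simp [h]

end Cutoff

/-! ### Spectral theory of an operator equivalent to k² plus a finite diagonal matrix. -/

section Diagonal

variable {n : ℕ} {ι : Type} [Fintype ι]

/-- `F` maps the orthogonal complement of the eigenvectors `e` isometrically onto `L²` and turns
the operator `T` into multiplication by `k²`. -/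
structure Diagonalizes (T : L2 n →ₗ.[ℂ] L2 n) (F : L2 n →L[ℂ] L2 n) (lam : ι → ℝ)
    (e : ι → L2 n) : Prop where
  map_adjoint : ∀ f, F (ContinuousLinearMap.adjoint F f) = f
  orthonormal : Orthonormal ℂ e
  lam_neg : ∀ i, lam i < 0
  map_e : ∀ i, F (e i) = 0
  ker_le : ∀ ψ, F ψ = 0 → ψ ∈ Submodule.span ℂ (range e)
  apply_e : ∀ i, ∃ h : e i ∈ T.domain, T ⟨e i, h⟩ = (lam i : ℂ) • e i
  map_apply : ∀ ψ : T.domain, ∀ᵐ k : ℝ ∂ν₀, F (T ψ) k = (k : ℂ) ^ 2 • F ψ k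
  apply_adjoint : ∀ f g : L2 n, (∀ᵐ k : ℝ ∂ν₀, g k = (k : ℂ) ^ 2 • f k) →
    ∃ h : ContinuousLinearMap.adjoint F f ∈ T.domain,
      T ⟨ContinuousLinearMap.adjoint F f, h⟩ = ContinuousLinearMap.adjoint F g

namespace Diagonalizes

variable {T : L2 n →ₗ.[ℂ] L2 n} {F : L2 n →L[ℂ] L2 n} {lam : ι → ℝ} {e : ι → L2 n}

local notation "F†" => ContinuousLinearMap.adjoint F

omit [Fintype ι] in
lemma inner_e_adjoint (hD : Diagonalizes T F lam e) (i : ι) (f : L2 n) : ⟪e i, F† f⟫_ℂ = 0 := by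
  rw [ContinuousLinearMap.adjoint_inner_right, hD.map_e, inner_zero_left]

/-- As F F† = 1, the vector ψ - F†Fψ is in the kernel of F, hence a combination of the e_i. Its
coefficients are ⟨e_i, ψ⟩ because the range of F† is orthogonal to every e_i. -/
lemma decomp (hD : Diagonalizes T F lam e) (ψ : L2 n) : ψ = F† (F ψ) + ∑ i, ⟪e i, ψ⟫_ℂ • e i := by
  have h1 : F (ψ - F† (F ψ)) = 0 := by rw [map_sub, hD.map_adjoint, sub_self]
  obtain ⟨c, hc⟩ := (Submodule.mem_span_range_iff_exists_fun ℂ).1 (hD.ker_le _ h1)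
  have h2 : ∀ i, ⟪e i, ψ⟫_ℂ = c i := by
    intro i
    have := hD.orthonormal.inner_right_fintype c i
    rwa [hc, inner_sub_right, hD.inner_e_adjoint, sub_zero] at this
  simp_rw [h2]
  rw [hc]
  abel

lemma ext (hD : Diagonalizes T F lam e) {ψ φ : L2 n} (h : F ψ = F φ)
    (h' : ∀ i, ⟪e i, ψ⟫_ℂ = ⟪e i, φ⟫_ℂ) : ψ = φ := by
  rw [hD.decomp ψ, hD.decomp φ, h]
  simp_rw [h']

lemma map_adjoint_add_sum (hD : Diagonalizes T F lam e) (f : L2 n) (c : ι → ℂ) :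
    F (F† f + ∑ i, c i • e i) = f := by
  simp [hD.map_adjoint, hD.map_e]

lemma inner_e_adjoint_add_sum (hD : Diagonalizes T F lam e) (f : L2 n) (c : ι → ℂ) (i : ι) :
    ⟪e i, F† f + ∑ i, c i • e i⟫_ℂ = c i := by
  rw [inner_add_right, hD.inner_e_adjoint, zero_add, hD.orthonormal.inner_right_fintype]

lemma inner_eq (hD : Diagonalizes T F lam e) (φ ψ : L2 n) :
    ⟪φ, ψ⟫_ℂ = ⟪F φ, F ψ⟫_ℂ + ∑ i, ⟪φ, e i⟫_ℂ * ⟪e i, ψ⟫_ℂ := by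
  conv_lhs => rw [hD.decomp ψ]
  rw [inner_add_right, ContinuousLinearMap.adjoint_inner_right, inner_sum]
  congr 1
  refine Finset.sum_congr rfl fun i _ => ?_
  rw [inner_smul_right, mul_comm]

lemma norm_sq_eq (hD : Diagonalizes T F lam e) (ψ : L2 n) :
    ‖ψ‖ ^ 2 = ‖F ψ‖ ^ 2 + ∑ i, ‖⟪e i, ψ⟫_ℂ‖ ^ 2 := by
  have h := hD.inner_eq ψ ψ
  simp_rw [inner_self_eq_norm_sq_to_K] at h
  have h2 : ∀ i, ⟪ψ, e i⟫_ℂ * ⟪e i, ψ⟫_ℂ = ((‖⟪e i, ψ⟫_ℂ‖ ^ 2 : ℝ) : ℂ) := by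
    intro i
    rw [← inner_conj_symm ψ (e i), Complex.conj_mul']
    push_cast
    rfl
  simp_rw [h2] at h
  simp only [Complex.coe_algebraMap] at h
  exact_mod_cast h

/-- The graph of the operator in the diagonalization. -/
lemma graph_iff (hD : Diagonalizes T F lam e) (ψ χ : L2 n) :
    (∃ h : ψ ∈ T.domain, T ⟨ψ, h⟩ = χ) ↔
      (∀ᵐ k : ℝ ∂ν₀, F χ k = (k : ℂ) ^ 2 • F ψ k) ∧ ∀ i, ⟪e i, χ⟫_ℂ = lam i * ⟪e i, ψ⟫_ℂ := by
  -- Each summand of the decomposition of ψ is in the domain, so T ψ is computed by linearity.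
  have main : ∀ ψ χ : L2 n, (∀ᵐ k : ℝ ∂ν₀, F χ k = (k : ℂ) ^ 2 • F ψ k) →
      ∃ h : ψ ∈ T.domain, T ⟨ψ, h⟩ = F† (F χ) + ∑ i, (lam i * ⟪e i, ψ⟫_ℂ) • e i := by
    intro ψ χ h1
    obtain ⟨d1, t1⟩ := hD.apply_adjoint _ _ h1
    choose d2 t2 using hD.apply_e
    let x : T.domain := ⟨F† (F ψ), d1⟩ + ∑ i, ⟪e i, ψ⟫_ℂ • (⟨e i, d2 i⟩ : T.domain)
    have hx : (x : L2 n) = ψ := by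
      conv_rhs => rw [hD.decomp ψ]
      simp [x]
    have hTx : T x = F† (F χ) + ∑ i, (lam i * ⟪e i, ψ⟫_ℂ) • e i := by
      change T.toFun x = _
      rw [map_add, map_sum]
      congr 1
      refine Finset.sum_congr rfl fun i _ => ?_
      rw [map_smul, mul_comm, mul_smul]
      exact congrArg _ (t2 i)
    refine ⟨hx ▸ x.2, ?_⟩
    rw [← hTx]
    congr 1
    exact Subtype.ext hx.symm
  constructor
  · rintro ⟨h, rfl⟩
    have h1 := hD.map_apply ⟨ψ, h⟩
    refine ⟨h1, fun i => ?_⟩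
    -- The components ⟨e_i, Tψ⟩ are read off from this formula; symmetry of T is not presupposed.
    obtain ⟨_, h2⟩ := main ψ _ h1
    rw [h2, hD.inner_e_adjoint_add_sum _ (fun i => lam i * ⟪e i, ψ⟫_ℂ)]
  · rintro ⟨h1, h2⟩
    obtain ⟨h, h3⟩ := main ψ χ h1
    refine ⟨h, h3.trans ?_⟩
    conv_rhs => rw [hD.decomp χ]
    simp_rw [h2]

lemma measurableSet_sq {O : Set ℝ} (hO : MeasurableSet O) : MeasurableSet {k : ℝ | k ^ 2 ∈ O} :=
  (by fun_prop : Measurable fun k : ℝ => k ^ 2) hO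

open Classical in
variable (F lam e) in
/-- The spectral projector of a Borel set. -/
noncomputable def specProj (O : Set ℝ) : L2 n →L[ℂ] L2 n :=
  if hO : MeasurableSet O then
    F† ∘L cutoff (measurableSet_sq hO) ∘L F
      + ∑ i, (if lam i ∈ O then (1 : ℂ) else 0) • (innerSL ℂ (e i)).smulRight (e i)
  else 0

open Classical in
lemma specProj_apply {O : Set ℝ} (hO : MeasurableSet O) (ψ : L2 n) : specProj F lam e O ψ =
    F† (cutoff (measurableSet_sq hO) (F ψ))
      + ∑ i, ((if lam i ∈ O then (1 : ℂ) else 0) * ⟪e i, ψ⟫_ℂ) • e i := by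
  rw [specProj, dif_pos hO]
  simp only [add_apply, sum_apply, smul_apply, ContinuousLinearMap.comp_apply,
    ContinuousLinearMap.smulRight_apply, innerSL_apply_apply, mul_smul]

lemma map_specProj (hD : Diagonalizes T F lam e) {O : Set ℝ} (hO : MeasurableSet O) (ψ : L2 n) :
    F (specProj F lam e O ψ) = cutoff (measurableSet_sq hO) (F ψ) := by
  rw [specProj_apply hO, hD.map_adjoint_add_sum]

open Classical in
lemma inner_e_specProj (hD : Diagonalizes T F lam e) {O : Set ℝ} (hO : MeasurableSet O)
    (ψ : L2 n) (i : ι) :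
    ⟪e i, specProj F lam e O ψ⟫_ℂ = (if lam i ∈ O then (1 : ℂ) else 0) * ⟪e i, ψ⟫_ℂ := by
  rw [specProj_apply hO, hD.inner_e_adjoint_add_sum _
    (fun i => (if lam i ∈ O then (1 : ℂ) else 0) * ⟪e i, ψ⟫_ℂ)]

lemma isStarProjection_specProj (hD : Diagonalizes T F lam e) {O : Set ℝ} (hO : MeasurableSet O) :
    IsStarProjection (specProj F lam e O) := by
  classical
  constructor
  · ext1 ψ
    change specProj F lam e O (specProj F lam e O ψ) = specProj F lam e O ψ
    apply hD.ext
    · rw [hD.map_specProj hO, hD.map_specProj hO, cutoff_cutoff]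
    · intro i
      rw [hD.inner_e_specProj hO, hD.inner_e_specProj hO]
      split_ifs <;> simp
  · rw [ContinuousLinearMap.isSelfAdjoint_iff', eq_comm, ContinuousLinearMap.eq_adjoint_iff]
    intro ψ φ
    rw [hD.inner_eq (specProj F lam e O ψ) φ, hD.inner_eq ψ (specProj F lam e O φ),
      hD.map_specProj hO, hD.map_specProj hO, inner_cutoff]
    congr 1
    refine Finset.sum_congr rfl fun i _ => ?_
    rw [hD.inner_e_specProj hO, ← inner_conj_symm _ (e i), hD.inner_e_specProj hO, map_mul,
      inner_conj_symm]
    split_ifs <;> simp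

lemma specProj_univ (hD : Diagonalizes T F lam e) : specProj F lam e univ = 1 := by
  classical
  ext1 ψ
  change specProj F lam e univ ψ = ψ
  apply hD.ext
  · rw [hD.map_specProj MeasurableSet.univ, cutoff_eq_self]
    exact ae_of_all _ fun k => mem_univ _
  · intro i
    rw [hD.inner_e_specProj MeasurableSet.univ, if_pos (mem_univ _), one_mul]

lemma hasSum_specProj {O : ℕ → Set ℝ} (hO : ∀ i, MeasurableSet (O i))
    (hd : Pairwise (Function.onFun Disjoint O)) (ψ : L2 n) :
    HasSum (fun i => specProj F lam e (O i) ψ) (specProj F lam e (⋃ i, O i) ψ) := by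
  classical
  simp_rw [specProj_apply (hO _)]
  rw [specProj_apply (MeasurableSet.iUnion hO)]
  refine HasSum.add ?_ ?_
  · have h1 := hasSum_cutoff (fun i => measurableSet_sq (hO i)) (fun i j hij =>
      Disjoint.preimage (fun k : ℝ => k ^ 2) (hd hij)) (F ψ)
    rw [cutoff_congr _ (MeasurableSet.iUnion fun i => measurableSet_sq (hO i)) (by ext; simp)]
    exact h1.mapL F†
  · have key : ∀ i, HasSum (fun j => if lam i ∈ O j then (1 : ℂ) else 0)
        (if lam i ∈ ⋃ j, O j then (1 : ℂ) else 0) := by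
      intro i
      by_cases h : lam i ∈ ⋃ j, O j
      · rw [if_pos h]
        obtain ⟨j, hj⟩ := mem_iUnion.1 h
        have := hasSum_single (f := fun j => if lam i ∈ O j then (1 : ℂ) else 0) j (by
          intro j' hj'
          exact if_neg fun h' => (disjoint_left.1 (hd hj') h' hj))
        simpa [hj] using this
      · rw [if_neg h]
        have : ∀ j, lam i ∉ O j := fun j hj => h (mem_iUnion.2 ⟨j, hj⟩)
        simp only [this, if_false]
        exact hasSum_zero
    refine hasSum_sum fun i _ => ?_
    have h1 := (key i).mul_right ⟪e i, ψ⟫_ℂ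
    have h2 := h1.mapL (ContinuousLinearMap.toSpanSingleton ℂ (e i))
    simpa only [ContinuousLinearMap.toSpanSingleton_apply] using h2

/-- The spectral resolution of a diagonalized operator. -/
noncomputable def pvm (hD : Diagonalizes T F lam e) : ProjValuedMeasure (L2 n) where
  proj := specProj F lam e
  isStarProjection _ hO := hD.isStarProjection_specProj hO
  proj_univ := hD.specProj_univ
  hasSum_iUnion _ hO hd ψ := hasSum_specProj hO hd ψ

/-! ### The spectral measures -/

/-- Parseval splits ‖E(O)ψ‖² into the integral of ‖Fψ‖² over {k² ∈ O} and the weights of the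
eigenvalues in O. Integrals against the spectral measure thereby become integrals over k and finite
sums. -/
lemma measure_pvm (hD : Diagonalizes T F lam e) (ψ : L2 n) : hD.pvm.measure ψ =
    (Measure.withDensity ν₀ (fun k => ‖F ψ k‖ₑ ^ 2)).map (fun k => k ^ 2)
      + ∑ i, ENNReal.ofReal (‖⟪e i, ψ⟫_ℂ‖ ^ 2) • Measure.dirac (lam i) := by
  classical
  ext O hO
  rw [hD.pvm.measure_apply ψ hO, Measure.add_apply, Measure.map_apply (by fun_prop) hO,
    withDensity_apply _ (show MeasurableSet ((fun k : ℝ => k ^ 2) ⁻¹' O) from measurableSet_sq hO), Measure.finsetSum_apply]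
  change ENNReal.ofReal (‖specProj F lam e O ψ‖ ^ 2) = _
  rw [hD.norm_sq_eq, hD.map_specProj hO, ENNReal.ofReal_add (sq_nonneg _)
    (Finset.sum_nonneg fun i _ => sq_nonneg _), ofReal_norm_cutoff_sq,
    ENNReal.ofReal_sum_of_nonneg fun i _ => sq_nonneg _]
  congr 1
  refine Finset.sum_congr rfl fun i _ => ?_
  rw [hD.inner_e_specProj hO, Measure.smul_apply, Measure.dirac_apply' _ hO, smul_eq_mul]
  by_cases h : lam i ∈ O <;> simp [h]

lemma mem_domain_iff (hD : Diagonalizes T F lam e) (ψ : L2 n) :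
    ψ ∈ T.domain ↔ MemLp (fun k : ℝ => (k : ℂ) ^ 2 • F ψ k) 2 ν₀ := by
  constructor
  · intro h
    exact (memLp_congr_ae (hD.map_apply ⟨ψ, h⟩)).1 (Lp.memLp _)
  · intro h
    have h1 := (hD.graph_iff ψ (F† (h.toLp _) + ∑ i, (lam i * ⟪e i, ψ⟫_ℂ) • e i)).2 ⟨by
      rw [hD.map_adjoint_add_sum _ (fun i => lam i * ⟪e i, ψ⟫_ℂ)]
      exact h.coeFn_toLp, fun i => by
      rw [hD.inner_e_adjoint_add_sum _ (fun i => lam i * ⟪e i, ψ⟫_ℂ)]⟩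
    exact h1.1

lemma aemeasurable_density (f : L2 n) : AEMeasurable (fun k => ‖f k‖ₑ ^ 2) ν₀ :=
  (Lp.memLp f).1.enorm.pow_const 2

lemma lintegral_sq_measure_pvm (hD : Diagonalizes T F lam e) (ψ : L2 n) :
    ∫⁻ t, ENNReal.ofReal (t ^ 2) ∂(hD.pvm.measure ψ) = ∫⁻ k : ℝ, ‖(k : ℂ) ^ 2 • F ψ k‖ₑ ^ 2 ∂ν₀
      + ∑ i, ENNReal.ofReal (‖⟪e i, ψ⟫_ℂ‖ ^ 2) * ENNReal.ofReal (lam i ^ 2) := by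
  have hm : Measurable fun t : ℝ => ENNReal.ofReal (t ^ 2) := by fun_prop
  have hq : Measurable fun k : ℝ => k ^ 2 := by fun_prop
  have hm' : Measurable fun k : ℝ => ENNReal.ofReal ((k ^ 2) ^ 2) := by fun_prop
  rw [hD.measure_pvm, lintegral_add_measure, lintegral_map hm hq, lintegral_finsetSum_measure,
    lintegral_withDensity_eq_lintegral_mul₀ (aemeasurable_density _) hm'.aemeasurable]
  congr 1
  · refine lintegral_congr fun k => ?_
    rw [Pi.mul_apply, enorm_smul, mul_pow, mul_comm]
    congr 1
    rw [← ofReal_norm, ← ENNReal.ofReal_pow (norm_nonneg _)]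
    congr 1
    simp
  · refine Finset.sum_congr rfl fun i _ => ?_
    rw [lintegral_smul_measure, lintegral_dirac' _ hm, smul_eq_mul]

lemma lintegral_sq_lt_top_iff {f : ℝ → EuclideanSpace ℂ (Fin n)}
    (hf : AEStronglyMeasurable f ν₀) : ∫⁻ k, ‖f k‖ₑ ^ 2 ∂ν₀ < ⊤ ↔ MemLp f 2 ν₀ := by
  have h := eLpNorm_lt_top_iff_lintegral_rpow_enorm_lt_top (f := f) (μ := ν₀) (p := 2)
    two_ne_zero ENNReal.ofNat_ne_top
  simp only [ENNReal.toReal_ofNat, ENNReal.rpow_ofNat] at h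
  rw [← h]
  exact ⟨fun h => ⟨hf, h⟩, fun h => h.2⟩

lemma isSpectralResolution_pvm (hD : Diagonalizes T F lam e) : hD.pvm.IsSpectralResolution T := by
  refine ⟨fun ψ => ?_, fun ψ => ?_⟩
  · have hfin : ∑ i, ENNReal.ofReal (‖⟪e i, ψ⟫_ℂ‖ ^ 2) * ENNReal.ofReal (lam i ^ 2) < ⊤ :=
      ENNReal.sum_lt_top.2 fun i _ => ENNReal.mul_lt_top ENNReal.ofReal_lt_top ENNReal.ofReal_lt_top
    have hsm : AEStronglyMeasurable (fun k : ℝ => (k : ℂ) ^ 2 • F ψ k) ν₀ := by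
      have : Continuous fun k : ℝ => (k : ℂ) ^ 2 := by fun_prop
      exact this.aestronglyMeasurable.smul (Lp.memLp (F ψ)).1
    rw [hD.mem_domain_iff, hD.lintegral_sq_measure_pvm, ENNReal.add_lt_top,
      lintegral_sq_lt_top_iff hsm]
    exact ⟨fun h => ⟨h, hfin⟩, fun h => h.1⟩
  · obtain ⟨h1, h2⟩ := (hD.graph_iff ψ (T ψ)).1 ⟨ψ.2, rfl⟩
    have hq : Measurable fun k : ℝ => k ^ 2 := by fun_prop
    have hre : ∀ᵐ k : ℝ ∂ν₀, ⟪F ψ k, F (T ψ) k⟫_ℂ = ((‖F ψ k‖ ^ 2 * k ^ 2 : ℝ) : ℂ) := by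
      filter_upwards [h1] with k hk
      rw [hk, inner_smul_right, inner_self_eq_norm_sq_to_K]
      simp [mul_comm]
    have hint : Integrable (fun k : ℝ => ‖F ψ k‖ ^ 2 * k ^ 2) ν₀ := by
      have := (L2.integrable_inner (𝕜 := ℂ) (F ψ) (F (T ψ))).congr hre
      have h3 : Integrable (fun k : ℝ => ((‖F ψ k‖ ^ 2 * k ^ 2 : ℝ) : ℂ).re) ν₀ := this.re
      simpa only [Complex.ofReal_re] using h3
    have hdens : ∀ᵐ k ∂ν₀, (‖F ψ k‖ₑ ^ 2) < ⊤ := ae_of_all _ fun k => by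
      exact ENNReal.pow_lt_top enorm_lt_top
    have htr : ∀ k, (‖F ψ k‖ₑ ^ 2).toReal = ‖F ψ k‖ ^ 2 := fun k => by
      rw [ENNReal.toReal_pow, toReal_enorm]
    have hid : AEStronglyMeasurable (fun t : ℝ => t)
        ((Measure.withDensity ν₀ (fun k => ‖F ψ k‖ₑ ^ 2)).map (fun k => k ^ 2)) :=
      aestronglyMeasurable_id
    have i1 : Integrable (fun t : ℝ => t)
        ((Measure.withDensity ν₀ (fun k => ‖F ψ k‖ₑ ^ 2)).map (fun k => k ^ 2)) := by
      rw [integrable_map_measure hid hq.aemeasurable,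
        integrable_withDensity_iff_integrable_smul₀' (aemeasurable_density _) hdens]
      simpa only [htr, Function.comp_def, smul_eq_mul] using hint
    have i2 : ∀ i ∈ Finset.univ, Integrable (fun t : ℝ => t)
        (ENNReal.ofReal (‖⟪e i, (ψ : L2 n)⟫_ℂ‖ ^ 2) • Measure.dirac (lam i)) := fun i _ =>
      (integrable_dirac (by simp)).smul_measure ENNReal.ofReal_ne_top
    rw [hD.measure_pvm, integral_add_measure i1 (integrable_finsetSum_measure.2 i2),
      integral_finsetSum_measure i2,
      integral_map hq.aemeasurable hid,
      integral_withDensity_eq_integral_toReal_smul₀ (aemeasurable_density _) hdens,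
      hD.inner_eq, L2.inner_def, integral_congr_ae hre, integral_complex_ofReal]
    simp only [htr, smul_eq_mul]
    push_cast
    congr 1
    refine Finset.sum_congr rfl fun i _ => ?_
    rw [h2, integral_smul_measure, integral_dirac, ENNReal.toReal_ofReal (sq_nonneg _),
      ← inner_conj_symm _ (e i)]
    simp only [smul_eq_mul]
    push_cast
    rw [← Complex.conj_mul']
    ring

/-- The positive k with k² ∈ O form the image of O ∩ (0, ∞) under the square root, which is
differentiable there and so preserves null sets. -/
lemma ae_sq_notMem {O : Set ℝ} (h0 : volume (O ∩ Ici 0) = 0) :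
    ∀ᵐ k ∂ν₀, k ^ 2 ∉ O := by
  have h1 : volume (Real.sqrt '' (O ∩ Ioi 0)) = 0 := by
    refine addHaar_image_eq_zero_of_differentiableOn_of_addHaar_eq_zero volume
      (fun x hx => ?_) (measure_mono_null (by gcongr; exact Ioi_subset_Ici_self) h0)
    exact ((Real.hasDerivAt_sqrt (ne_of_gt hx.2)).differentiableAt).differentiableWithinAt
  rw [ae_restrict_iff' measurableSet_Ioi, ae_iff]
  refine measure_mono_null (fun k hk => ?_) h1
  simp only [mem_ofPred_eq, not_forall, not_not] at hk
  obtain ⟨hk0, hk⟩ := hk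
  have hk0' : (0 : ℝ) < k := hk0
  exact ⟨k ^ 2, ⟨hk, by simpa using pow_pos hk0' 2⟩, Real.sqrt_sq hk0'.le⟩

lemma absolutelyContinuous_restrict (hD : Diagonalizes T F lam e) (ψ : L2 n) :
    (hD.pvm.measure ψ).restrict (Ici 0) ≪ volume := by
  refine Measure.AbsolutelyContinuous.mk fun O hO h0 => ?_
  have hO' := hO.inter (measurableSet_Ici (a := (0 : ℝ)))
  rw [Measure.restrict_apply hO, hD.pvm.measure_apply ψ hO', ENNReal.ofReal_eq_zero]
  refine le_of_eq ?_
  rw [sq_eq_zero_iff, norm_eq_zero]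
  change specProj F lam e _ ψ = 0
  classical
  apply hD.ext
  · rw [hD.map_specProj hO', map_zero]
    exact cutoff_eq_zero _ (ae_sq_notMem (measure_mono_null (by
      intro x hx; exact hx.1.1) h0)) _
  · intro i
    rw [hD.inner_e_specProj hO', if_neg, zero_mul, inner_zero_right]
    -- The atoms sit at the negative λ_i, outside [0, ∞).
    exact fun h => absurd (hD.lam_neg i) (not_lt.2 h.2)

lemma mem_acSubspace_iff (hD : Diagonalizes T F lam e) (ψ : L2 n) :
    ψ ∈ hD.pvm.acSubspace ↔ ∀ i, ⟪e i, ψ⟫_ℂ = 0 := by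
  classical
  change hD.pvm.measure ψ ≪ volume ↔ _
  rw [ProjValuedMeasure.absolutelyContinuous_iff]
  change (∀ O, MeasurableSet O → volume O = 0 → specProj F lam e O ψ = 0) ↔ _
  constructor
  · intro h i
    -- The null set {λ_i} detects the component along e_i.
    have h1 := h {lam i} (measurableSet_singleton _) (by simp)
    have h2 := hD.inner_e_specProj (measurableSet_singleton (lam i)) ψ i
    rw [h1, inner_zero_right, if_pos (mem_singleton _), one_mul] at h2
    exact h2.symm
  · intro h O hO h0
    apply hD.ext
    · rw [hD.map_specProj hO, map_zero]
      exact cutoff_eq_zero _ (ae_sq_notMem (measure_mono_null inter_subset_left h0)) _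
    · intro i
      rw [hD.inner_e_specProj hO, h, mul_zero, inner_zero_right]

/-- All maps that diagonalize an operator with the same eigenvectors have the same initial
subspace. -/
lemma isPartialIsometry {F' : L2 n →L[ℂ] L2 n} (hD : Diagonalizes T F lam e)
    (hD' : Diagonalizes T F' lam e) : IsPartialIsometry F' hD.pvm.acSubspace ⊤ := by
  refine ⟨fun ψ hψ => ?_, fun ψ hψ => ?_, ?_⟩
  · rw [hD.mem_acSubspace_iff] at hψ
    have h := hD'.norm_sq_eq ψ
    simp only [hψ, norm_zero, zero_pow two_ne_zero, Finset.sum_const_zero, add_zero] at h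
    exact ((pow_left_inj₀ (norm_nonneg _) (norm_nonneg _) two_ne_zero).1 h).symm
  -- The range of F'† lies in the subspace of absolute continuity, so ‖F'ψ‖² = ⟨F'†F'ψ, ψ⟩ = 0 for ψ
  -- orthogonal to it.
  · have h1 : ContinuousLinearMap.adjoint F' (F' ψ) ∈ hD.pvm.acSubspace :=
      (hD.mem_acSubspace_iff _).2 fun i => hD'.inner_e_adjoint i _
    have h2 := hψ _ h1
    rw [ContinuousLinearMap.adjoint_inner_left] at h2
    exact inner_self_eq_zero.1 h2
  · rw [LinearMap.range_eq_top]
    exact fun f => ⟨_, hD'.map_adjoint f⟩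

/-! ### Eigenspaces and spectrum -/

lemma map_eq_zero_of_mem_eigenspace (hD : Diagonalizes T F lam e) {t : ℝ} {ψ : L2 n}
    (hψ : ψ ∈ eigenspace T (t : ℂ)) : F ψ = 0 := by
  obtain ⟨h1, -⟩ := (hD.graph_iff ψ ((t : ℂ) • ψ)).1 hψ
  rw [map_smul] at h1
  apply Lp.ext
  -- From (k² - t)Fψ = 0: for k > 0 the factor vanishes at most at k = √t, a null set. For t < 0 the
  -- root is 0 by convention, which does no harm.
  have hne : ∀ᵐ k ∂ν₀, k ≠ √t := ae_restrict_of_ae (Measure.ae_ne volume _)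
  filter_upwards [h1, Lp.coeFn_smul (t : ℂ) (F ψ), hne, ae_restrict_mem measurableSet_Ioi,
    Lp.coeFn_zero (EuclideanSpace ℂ (Fin n)) 2 ν₀] with k e1 e2 e3 hk e4
  rw [e2, Pi.smul_apply, ← sub_eq_zero, ← sub_smul] at e1
  rw [e4, Pi.zero_apply]
  refine (smul_eq_zero.1 e1).resolve_left fun h => e3 ?_
  have h2 : t = k ^ 2 := by exact_mod_cast sub_eq_zero.1 h
  rw [h2, Real.sqrt_sq (le_of_lt hk)]

lemma eigenspace_eq_bot (hD : Diagonalizes T F lam e) {t : ℝ} (ht : t ∉ range lam) :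
    eigenspace T (t : ℂ) = ⊥ := by
  rw [Submodule.eq_bot_iff]
  intro ψ hψ
  obtain ⟨-, h2⟩ := (hD.graph_iff ψ ((t : ℂ) • ψ)).1 hψ
  apply hD.ext
  · rw [hD.map_eq_zero_of_mem_eigenspace hψ, map_zero]
  · intro i
    have h3 := h2 i
    rw [inner_smul_right, ← sub_eq_zero, ← sub_mul] at h3
    rw [inner_zero_right]
    refine (mul_eq_zero.1 h3).resolve_left fun h => ht ⟨i, ?_⟩
    exact_mod_cast (sub_eq_zero.1 h).symm

omit [Fintype ι] in
lemma eigenspace_ne_bot (hD : Diagonalizes T F lam e) (i : ι) :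
    eigenspace T (lam i : ℂ) ≠ ⊥ := by
  intro h
  have h1 : e i ∈ eigenspace T (lam i : ℂ) := hD.apply_e i
  rw [h, Submodule.mem_bot] at h1
  exact hD.orthonormal.ne_zero i h1

/-- Every eigenspace is contained in the kernel of F, which the e_i span. -/
lemma rank_eigenspace_le (hD : Diagonalizes T F lam e) (t : ℝ) :
    Module.rank ℂ (eigenspace T (t : ℂ)) ≤ Fintype.card ι := by
  refine (Submodule.rank_mono fun ψ hψ =>
    hD.ker_le ψ (hD.map_eq_zero_of_mem_eigenspace hψ)).trans ?_
  refine (rank_span_le _).trans (Cardinal.mk_range_le.trans ?_)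
  rw [Cardinal.mk_fintype]

lemma setOf_neg_eigenvalues (hD : Diagonalizes T F lam e) :
    {t : ℝ | t < 0 ∧ eigenspace T (t : ℂ) ≠ ⊥} = range lam := by
  ext t
  constructor
  · rintro ⟨-, h⟩
    by_contra ht
    exact h (hD.eigenspace_eq_bot ht)
  · rintro ⟨i, rfl⟩
    exact ⟨hD.lam_neg i, hD.eigenspace_ne_bot i⟩

omit [Fintype ι] in
lemma notMem_resolventSet_of_eigenvalue (hD : Diagonalizes T F lam e) (i : ι) :
    (lam i : ℂ) ∉ resolventSet T := by
  rintro ⟨R, -, hR⟩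
  obtain ⟨h, h1⟩ := hD.apply_e i
  have h2 := hR ⟨e i, h⟩
  rw [h1, sub_self, map_zero] at h2
  exact hD.orthonormal.ne_zero i h2.symm

/-- Approximate eigenvectors at every point of the half line. -/
lemma exists_approx (hD : Diagonalizes T F lam e) (hn : 0 < n) {s : ℝ} (hs : 0 ≤ s) {ε : ℝ}
    (hε : 0 < ε) : ∃ ψ : T.domain, (ψ : L2 n) ≠ 0 ∧
      ‖T ψ - ((s ^ 2 : ℝ) : ℂ) • (ψ : L2 n)‖ ≤ ε * ‖(ψ : L2 n)‖ := by
  obtain ⟨δ, hδ, hδε⟩ : ∃ δ > 0, (s + δ) ^ 2 - s ^ 2 ≤ ε := by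
    -- For δ ≤ 1, (s + δ)² - s² = δ(2s + δ) ≤ δ(2s + 1). The approximate eigenvector is F† of a
    -- constant vector on (s, s + δ), where k² differs from s² by at most ε.
    refine ⟨min 1 (ε / (2 * s + 1)), by positivity, ?_⟩
    set δ := min 1 (ε / (2 * s + 1)) with hδ
    have h1 : δ ≤ 1 := min_le_left _ _
    have h2 : δ * (2 * s + 1) ≤ ε := (le_div_iff₀ (by positivity)).1 (min_le_right _ _)
    have h3 : 0 < δ := by positivity
    nlinarith
  let v : EuclideanSpace ℂ (Fin n) := EuclideanSpace.single ⟨0, hn⟩ 1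
  have hv : v ≠ 0 := by
    rw [← norm_ne_zero_iff]
    simp [v]
  let S : Set ℝ := Ioo s (s + δ)
  have hS : MeasurableSet S := measurableSet_Ioo
  have hS0 : ν₀ S ≠ 0 := by
    have hsub : S ⊆ Ioi 0 := fun x hx => lt_of_le_of_lt hs hx.1
    rw [Measure.restrict_eq_self _ hsub]
    simp [S, hδ]
  have hfin : ν₀ S ≠ ⊤ := ne_of_lt ((Measure.restrict_apply_le _ _).trans_lt (by simp [S]))
  let f : L2 n := indicatorConstLp 2 hS hfin v
  have hf : f =ᵐ[ν₀] S.indicator fun _ => v := indicatorConstLp_coeFn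
  have hf0 : ‖f‖ ≠ 0 := by
    rw [norm_indicatorConstLp (by norm_num) (by norm_num)]
    refine mul_ne_zero (norm_ne_zero_iff.2 hv) ?_
    rw [measureReal_def]
    refine (Real.rpow_pos_of_pos (ENNReal.toReal_pos hS0 hfin) _).ne'
  have hb : ∀ᵐ k : ℝ ∂ν₀, ‖(k : ℂ) ^ 2 • f k - ((s ^ 2 : ℝ) : ℂ) • f k‖ ≤ ε * ‖f k‖ := by
    filter_upwards [hf] with k hk
    rw [hk]
    by_cases hkS : k ∈ S
    · rw [← sub_smul, norm_smul]
      gcongr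
      rw [← Complex.ofReal_pow, ← Complex.ofReal_sub, Complex.norm_real, Real.norm_eq_abs,
        abs_of_nonneg (by nlinarith [hkS.1])]
      nlinarith [hkS.1, hkS.2]
    · simp [hkS]
  have hm : MemLp (fun k : ℝ => (k : ℂ) ^ 2 • f k) 2 ν₀ := by
    have hc : Continuous fun k : ℝ => (k : ℂ) ^ 2 := by fun_prop
    refine MemLp.of_le_mul (c := ε + s ^ 2) (Lp.memLp f)
      (hc.aestronglyMeasurable.smul (Lp.memLp f).1) ?_
    filter_upwards [hb] with k hk
    have h1 : ‖((s ^ 2 : ℝ) : ℂ) • f k‖ = s ^ 2 * ‖f k‖ := by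
      rw [norm_smul, Complex.norm_real, Real.norm_of_nonneg (sq_nonneg s)]
    have h2 := norm_le_norm_sub_add ((k : ℂ) ^ 2 • f k) (((s ^ 2 : ℝ) : ℂ) • f k)
    rw [h1] at h2
    linarith
  obtain ⟨h, hT⟩ := hD.apply_adjoint f (hm.toLp _) hm.coeFn_toLp
  have hiso : ∀ g : L2 n, ‖F† g‖ = ‖g‖ := by
    intro g
    have := hD.norm_sq_eq (F† g)
    simp only [hD.inner_e_adjoint, hD.map_adjoint, norm_zero, zero_pow two_ne_zero,
      Finset.sum_const_zero, add_zero] at this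
    exact (pow_left_inj₀ (norm_nonneg _) (norm_nonneg _) two_ne_zero).1 this
  refine ⟨⟨F† f, h⟩, ?_, ?_⟩
  · rw [← norm_ne_zero_iff]
    exact (hiso f).symm ▸ hf0
  · rw [hT]
    change ‖F† (hm.toLp _) - ((s ^ 2 : ℝ) : ℂ) • F† f‖ ≤ ε * ‖F† f‖
    rw [← map_smul, ← map_sub, hiso, hiso]
    refine Lp.norm_le_mul_norm_of_ae_le_mul ?_
    filter_upwards [hb, hm.coeFn_toLp, Lp.coeFn_sub (hm.toLp _) (((s ^ 2 : ℝ) : ℂ) • f),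
      Lp.coeFn_smul ((s ^ 2 : ℝ) : ℂ) f] with k e1 e2 e3 e4
    rw [e3, Pi.sub_apply, e2, e4, Pi.smul_apply]
    exact e1

lemma notMem_resolventSet_of_nonneg (hD : Diagonalizes T F lam e) (hn : 0 < n) {t : ℝ}
    (ht : 0 ≤ t) : (t : ℂ) ∉ resolventSet T := by
  rintro ⟨R, -, hR⟩
  -- With this ε a bounded inverse R would give ‖ψ‖ ≤ ‖ψ‖/2.
  obtain ⟨ψ, h0, h1⟩ := hD.exists_approx hn (Real.sqrt_nonneg t)
    (ε := 1 / (2 * (‖R‖ + 1))) (by positivity)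
  rw [Real.sq_sqrt ht] at h1
  have h2 := R.le_opNorm (T ψ - (t : ℂ) • (ψ : L2 n))
  rw [hR ψ] at h2
  have h3 : 0 < ‖(ψ : L2 n)‖ := norm_pos_iff.2 h0
  have h4 : ‖R‖ * ‖T ψ - (t : ℂ) • (ψ : L2 n)‖
      ≤ (‖R‖ + 1) * (1 / (2 * (‖R‖ + 1)) * ‖(ψ : L2 n)‖) := by
    gcongr
    linarith
  have h5 : (‖R‖ + 1) * (1 / (2 * (‖R‖ + 1)) * ‖(ψ : L2 n)‖) = ‖(ψ : L2 n)‖ / 2 := by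
    field_simp
  linarith

lemma mem_resolventSet (hD : Diagonalizes T F lam e) {z : ℂ}
    (hz : z ∉ Complex.ofReal '' (range lam ∪ Ici 0)) : z ∈ resolventSet T := by
  -- A ball around z misses the closed set [0, ∞), so (k² - z)⁻¹ is bounded by 1/δ.
  obtain ⟨δ, hδ, hb⟩ : ∃ δ > 0, ∀ k : ℝ, δ ≤ ‖(k : ℂ) ^ 2 - z‖ := by
    have hcl : IsClosed (Complex.ofReal '' Ici (0 : ℝ)) :=
      Complex.isometry_ofReal.isClosedEmbedding.isClosedMap _ isClosed_Ici
    have hz' : z ∈ (Complex.ofReal '' Ici (0 : ℝ))ᶜ := fun h =>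
      hz (image_mono subset_union_right h)
    obtain ⟨δ, hδ, hball⟩ := Metric.isOpen_iff.1 hcl.isOpen_compl z hz'
    refine ⟨δ, hδ, fun k => ?_⟩
    by_contra! h
    have hk : (k : ℂ) ^ 2 ∈ Metric.ball z δ := by rwa [Metric.mem_ball, dist_eq_norm]
    exact hball hk ⟨k ^ 2, sq_nonneg k, by push_cast; rfl⟩
  have hne : ∀ k : ℝ, (k : ℂ) ^ 2 - z ≠ 0 := fun k => norm_pos_iff.1 (hδ.trans_le (hb k))
  have hlam : ∀ i, (lam i : ℂ) - z ≠ 0 := fun i h =>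
    hz ⟨lam i, Or.inl ⟨i, rfl⟩, sub_eq_zero.1 h⟩
  have hM : MemLp (scalarFun (EuclideanSpace ℂ (Fin n)) fun k : ℝ => ((k : ℂ) ^ 2 - z)⁻¹) ∞ ν₀ := by
    refine memLp_scalarFun ?_ δ⁻¹ fun k => ?_
    · have : Continuous fun k : ℝ => ((k : ℂ) ^ 2 - z)⁻¹ :=
        Continuous.inv₀ (by fun_prop) hne
      exact this.aestronglyMeasurable
    · rw [norm_inv]
      exact inv_anti₀ hδ (hb k)
  -- The resolvent is (k² - z)⁻¹ on the range of F† and (λ_i - z)⁻¹ on each e_i.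
  let R : L2 n →L[ℂ] L2 n := F† ∘L mulOp _ hM ∘L F
      + ∑ i, ((lam i : ℂ) - z)⁻¹ • (innerSL ℂ (e i)).smulRight (e i)
  have hR : ∀ ψ, R ψ = F† (mulOp _ hM (F ψ)) + ∑ i, (((lam i : ℂ) - z)⁻¹ * ⟪e i, ψ⟫_ℂ) • e i := by
    intro ψ
    simp only [R, add_apply, sum_apply, smul_apply, ContinuousLinearMap.comp_apply,
      ContinuousLinearMap.smulRight_apply, innerSL_apply_apply, mul_smul]
  have hFR : ∀ ψ, F (R ψ) = mulOp _ hM (F ψ) := fun ψ => by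
    rw [hR, hD.map_adjoint_add_sum _ (fun i => ((lam i : ℂ) - z)⁻¹ * ⟪e i, ψ⟫_ℂ)]
  have heR : ∀ ψ i, ⟪e i, R ψ⟫_ℂ = ((lam i : ℂ) - z)⁻¹ * ⟪e i, ψ⟫_ℂ := fun ψ i => by
    rw [hR, hD.inner_e_adjoint_add_sum _ (fun i => ((lam i : ℂ) - z)⁻¹ * ⟪e i, ψ⟫_ℂ)]
  refine ⟨R, fun ψ => ?_, fun ψ => ?_⟩
  · have h1 : ∀ᵐ k : ℝ ∂ν₀, F (ψ + z • R ψ) k = (k : ℂ) ^ 2 • F (R ψ) k := by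
      rw [map_add, map_smul, hFR]
      filter_upwards [coeFn_mulOp hM (F ψ), Lp.coeFn_add (F ψ) (z • mulOp _ hM (F ψ)),
        Lp.coeFn_smul z (mulOp _ hM (F ψ))] with k e1 e2 e3
      rw [e2, Pi.add_apply, e3, Pi.smul_apply, e1, scalarFun, smul_apply,
        ContinuousLinearMap.id_apply, ← eq_sub_iff_add_eq, ← sub_smul, smul_smul,
        mul_inv_cancel₀ (hne k), one_smul]
    have h2 : ∀ i, ⟪e i, ψ + z • R ψ⟫_ℂ = lam i * ⟪e i, R ψ⟫_ℂ := fun i => by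
      rw [inner_add_right, inner_smul_right, heR, ← eq_sub_iff_add_eq, ← sub_mul, ← mul_assoc,
        mul_inv_cancel₀ (hlam i), one_mul]
    obtain ⟨h, hT⟩ := (hD.graph_iff (R ψ) (ψ + z • R ψ)).2 ⟨h1, h2⟩
    exact ⟨h, by rw [hT, add_sub_cancel_right]⟩
  · obtain ⟨h1, h2⟩ := (hD.graph_iff ψ (T ψ)).1 ⟨ψ.2, rfl⟩
    apply hD.ext
    · rw [hFR, map_sub, map_smul]
      apply Lp.ext
      filter_upwards [h1, coeFn_mulOp hM (F (T ψ) - z • F ψ), Lp.coeFn_sub (F (T ψ)) (z • F ψ),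
        Lp.coeFn_smul z (F ψ)] with k e1 e2 e3 e4
      rw [e2, e3, Pi.sub_apply, e4, Pi.smul_apply, e1, ← sub_smul, scalarFun, smul_apply,
        ContinuousLinearMap.id_apply, smul_smul, inv_mul_cancel₀ (hne k), one_smul]
    · intro i
      rw [heR, inner_sub_right, h2, inner_smul_right, ← sub_mul, ← mul_assoc,
        inv_mul_cancel₀ (hlam i), one_mul]

lemma spec_eq (hD : Diagonalizes T F lam e) (hn : 0 < n) :
    spec T = Complex.ofReal '' (range lam ∪ Ici 0) := by
  ext z
  constructor
  · intro h
    by_contra hz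
    exact h (hD.mem_resolventSet hz)
  · rintro ⟨t, ⟨i, rfl⟩ | ht, rfl⟩
    · exact hD.notMem_resolventSet_of_eigenvalue i
    · exact hD.notMem_resolventSet_of_nonneg hn ht

end Diagonalizes

end Diagonal

/-! ### The Hamiltonian as an instance of the diagonalization. -/

section Hamiltonian

variable {n : ℕ} {A B : Matrix (Fin n) (Fin n) ℂ}
  (hAB : -(Bᴴ * A) + Aᴴ * B = 0) (hpos : (Aᴴ * A + Bᴴ * B).PosDef)

include hAB hpos in
/-- Both Fourier maps diagonalize `H`, with the same bound states. -/
lemma exists_diagonalizes : ∃ (ι : Type) (_ : Fintype ι) (lam : ι → ℝ) (e : ι → L2 n),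
    Fintype.card ι ≤ n ∧ ∀ (σ : ℝ) (hσ : σ = 1 ∨ σ = -1),
      Diagonalizes (ham A B) (fourierMap hAB hpos hσ) lam e := by
  obtain ⟨ι, _, lam, e, hcard, hon, hneg, hham, hker⟩ := exists_boundStates hAB hpos
  refine ⟨ι, inferInstance, lam, e, hcard, fun σ hσ => ⟨fun f => ?_, hon, hneg, fun i => ?_,
    hker σ hσ, fun i => ?_, fun ψ => ?_, fun f g hfg => ?_⟩⟩
  · rw [adjoint_fourierMap, fourierMap_fourierAdj]
  -- Here λ_i F e_i = k² F e_i with λ_i < 0 ≤ k², so F e_i = 0.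
  · have h := fourierMap_hamRel hAB hpos hσ (hham i)
    rw [map_neg, map_smul] at h
    apply Lp.ext
    filter_upwards [h, Lp.coeFn_neg ((lam i : ℂ) • fourierMap hAB hpos hσ (e i)),
      Lp.coeFn_smul (lam i : ℂ) (fourierMap hAB hpos hσ (e i)),
      Lp.coeFn_zero (EuclideanSpace ℂ (Fin n)) 2 ν₀] with k e1 e2 e3 e4
    rw [e2, Pi.neg_apply, e3, Pi.smul_apply, neg_inj, ← sub_eq_zero, ← sub_smul] at e1
    rw [e4, Pi.zero_apply]
    refine (smul_eq_zero.1 e1).resolve_left fun h0 => ?_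
    have h1 : lam i = k ^ 2 := by exact_mod_cast sub_eq_zero.1 h0
    nlinarith [hneg i, sq_nonneg k]
  · exact ⟨⟨_, hham i⟩, (ham_apply (hham i) _).trans (neg_neg _)⟩
  · obtain ⟨χ, hχ⟩ := ψ.2
    have h1 : ham A B ψ = -χ := ham_apply hχ ψ.2
    rw [h1, map_neg]
    filter_upwards [fourierMap_hamRel hAB hpos hσ hχ, Lp.coeFn_neg (fourierMap hAB hpos hσ χ)]
      with k e1 e2
    rw [e2, Pi.neg_apply, e1, neg_neg]
  · rw [adjoint_fourierMap]
    have h := hamRel_fourierAdj hAB hpos hσ hfg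
    exact ⟨⟨_, h⟩, (ham_apply h _).trans (neg_neg _)⟩

end Hamiltonian

end HalfLine

theorem theorem6p2 (n : ℕ) (hn : 0 < n) (A B : Matrix (Fin n) (Fin n) ℂ)
    (hAB : -(Bᴴ * A) + Aᴴ * B = 0) (hpos : (Aᴴ * A + Bᴴ * B).PosDef) :
    -- no zero or positive eigenvalues
    (∀ t : ℝ, 0 ≤ t → HalfLine.eigenspace (HalfLine.ham A B) (t : ℂ) = ⊥) ∧
    -- finitely many negative eigenvalues, of multiplicity at most `n`
    (HalfLine.negEigenvalues A B).Finite ∧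
    (∀ t ∈ HalfLine.negEigenvalues A B,
      Module.rank ℂ (HalfLine.eigenspace (HalfLine.ham A B) (t : ℂ)) ≤ n) ∧
    -- the spectrum consists of the negative eigenvalues and of `[0, ∞)`
    HalfLine.spec (HalfLine.ham A B) =
      Complex.ofReal '' (HalfLine.negEigenvalues A B ∪ Set.Ici 0) ∧
    -- the spectral resolution `E` of `H_{0,A,B}`
    ∃ E : HalfLine.ProjValuedMeasure (HalfLine.L2 n),
      E.IsSpectralResolution (HalfLine.ham A B) ∧
      -- the spectrum on `[0, ∞)` is absolutely continuous
      (∀ ψ : HalfLine.L2 n,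
        ((E.measure ψ).restrict (Set.Ici 0)) ≪ (MeasureTheory.volume : MeasureTheory.Measure ℝ)) ∧
      -- the generalized Fourier maps for both signs
      ∀ σ : ℝ, σ = 1 ∨ σ = -1 →
        ∃ F : HalfLine.L2 n →L[ℂ] HalfLine.L2 n,
          HalfLine.IsFourierMap A B σ F ∧
          HalfLine.IsPartialIsometry F E.acSubspace ⊤ ∧
          -- the adjoint
          (∀ ψ : HalfLine.L2 n,
            MeasureTheory.Integrable ψ (MeasureTheory.volume.restrict (Set.Ioi (0 : ℝ))) →
            ContinuousLinearMap.adjoint F ψ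
              =ᵐ[MeasureTheory.volume.restrict (Set.Ioi (0 : ℝ))] fun x =>
                √(2 / Real.pi) • ∫ k in Set.Ioi (0 : ℝ),
                  HalfLine.act (HalfLine.physicalSolSigned A B σ k x) (ψ k)) ∧
          -- `F H F†` is multiplication by `k²`, with equality of the domains
          (∀ ψ : HalfLine.L2 n,
            (ContinuousLinearMap.adjoint F ψ ∈ (HalfLine.ham A B).domain ↔
              MeasureTheory.MemLp (fun k : ℝ => ((k : ℂ) ^ 2) • ψ k) 2
                (MeasureTheory.volume.restrict (Set.Ioi (0 : ℝ)))) ∧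
            ∀ h : ContinuousLinearMap.adjoint F ψ ∈ (HalfLine.ham A B).domain,
              F (HalfLine.ham A B ⟨ContinuousLinearMap.adjoint F ψ, h⟩)
                =ᵐ[MeasureTheory.volume.restrict (Set.Ioi (0 : ℝ))]
                  fun k : ℝ => ((k : ℂ) ^ 2) • ψ k) := by
  obtain ⟨ι, _, lam, e, hcard, hD⟩ := HalfLine.exists_diagonalizes hAB hpos
  -- The spectral resolution is built from the sign σ = 1. For the other sign the same λ_i and e_i
  -- serve, so `isPartialIsometry` gives the same initial subspace.
  have hD₁ := hD 1 (Or.inl rfl)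
  have hneg : HalfLine.negEigenvalues A B = Set.range lam := hD₁.setOf_neg_eigenvalues
  refine ⟨fun t ht => hD₁.eigenspace_eq_bot ?_, ?_, fun t _ => ?_, ?_, hD₁.pvm,
    hD₁.isSpectralResolution_pvm, hD₁.absolutelyContinuous_restrict, fun σ hσ =>
    ⟨HalfLine.fourierMap hAB hpos hσ, HalfLine.isFourierMap_fourierMap hAB hpos hσ,
      hD₁.isPartialIsometry (hD σ hσ), fun ψ hψ => ?_, fun ψ => ⟨?_, fun h => ?_⟩⟩⟩
  · rintro ⟨i, rfl⟩
    exact absurd (hD₁.lam_neg i) (not_lt.2 ht)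
  · rw [hneg]
    exact Set.finite_range lam
  · exact (hD₁.rank_eigenspace_le t).trans (by exact_mod_cast hcard)
  · rw [hneg, hD₁.spec_eq hn]
  · rw [HalfLine.adjoint_fourierMap]
    exact HalfLine.coeFn_fourierAdj_of_integrable hAB hpos hσ hψ
  · rw [(hD σ hσ).mem_domain_iff, (hD σ hσ).map_adjoint]
  · have h1 := (hD σ hσ).map_apply ⟨_, h⟩
    simp only [(hD σ hσ).map_adjoint] at h1
    exact h1
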